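/- All logarithms are to base $2$. For $x,y\in\{0,1\}^n$ let $\mathsf{DISJ}(x,y)\in\{0,1\}$ be $1$ if and only if $\sum_{i=1}^n x_iy_i\neq 0$; the $2n$-bit input is the string $xy$. A randomized streaming algorithm is a (uniform) probabilistic multi-stack Turing machine that is given $n$ in binary and reads the $2n$ input bits once, from left to right; its space is the number of symbols on its work stacks, and its time and space are bounded for all inputs and all coin tosses. We consider only algorithms $A$ with bounded probability gap: for every $n$ and every $z\in\{0,1\}^{2n}$ there is a bit, denoted $A(z)$, that $A$ outputs on $z$ with probability at least $2/3$. A family $\{C_n\}$ of Boolean circuits with AND and OR gates of unbounded fan-in and NOT gates, where $C_n$ has $n$ inputs and $2n$ outputs, is polylogtime-uniform $\mathsf{AC}^0$ if it has size $n^{O(1)}$ and depth $O(1)$, and the type of a gate (or that an index is not the index of a gate), whether there is a wire between two given gates, and the gate carrying a given output bit are computable from $n$ and the indices of the gates or of the output bit, all in binary, in time polynomial in the length of these data (hence polynomial in $\log n$). Let $f:\mathbb N\to\mathbb R$ satisfy $f(n)\to\infty$, and assume that $(\log n)^{f(n)}$ is time-constructible up to a constant factor, i.e. some integer-valued $s(n)=\Theta((\log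 n)^{f(n)})$ can be computed in binary from $n$, given in binary, in time $O((\log n)^{f(n)})$. Suppose that there is a polylogtime-uniform-$\mathsf{AC}^0$-constructive separation of $\mathsf{DISJ}$ from randomized streaming algorithms with $O(n\cdot(\log n)^{f(n)})$ time and $O((\log n)^{f(n)})$ space on $2n$-bit inputs, that is: for every such randomized streaming algorithm $A$ there is a polylogtime-uniform $\mathsf{AC}^0$ circuit family $\{C_n\}$ such that, for infinitely many $n$, $A(C_n(1^n))\neq\mathsf{DISJ}(C_n(1^n))$. Then $\mathsf P\neq\mathsf{NP}$. -/

import Mathlib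

open Filter Asymptotics Turing Computability

noncomputable section

/-! ### Polynomial time, `P` and `NP`

Machines are Mathlib's multi-stack Turing machines; all numbers are written in binary, and pairs by
marking the symbols of the two components. -/

/-- `f` is computable in time polynomial in the length of the encoded argument. -/
def PolyTime {α β Γ Γ' : Type} (ea : Encoding α Γ) (eb : β → List Γ') (f : α → β) : Prop :=
  Nonempty (TM2ComputableInPolyTime ea.encode eb f)

open Classical in
/-- The class of languages over `{0,1}` decidable in deterministic polynomial time. -/
def ClassP : Set (Language Bool) :=
  {L | PolyTime (encodingList Bool) encodeBool (fun x => decide (x ∈ L))}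

/-- The class of languages over `{0,1}` with a polynomial-time verifier and witnesses of
polynomial length. -/
def ClassNP : Set (Language Bool) :=
  {L | ∃ (V : List Bool × List Bool → Bool) (q : Polynomial ℕ),
    PolyTime (encodingProd (encodingList Bool) (encodingList Bool)) encodeBool V ∧
    ∀ x, x ∈ L ↔ ∃ w : List Bool, w.length ≤ q.eval x.length ∧ V (x, w) = true}

/-! ### Set-disjointness -/

/-- On the `2n`-bit input `z = x y` the value is `1` iff `∑ i, x i * y i` is nonzero. -/
def DISJ {n : ℕ} (z : Fin (n + n) → Bool) : Bool :=
  decide (∑ i : Fin n, (z (Fin.castAdd n i)).toNat * (z (Fin.natAdd n i)).toNat ≠ 0)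

/-! ### Polylogtime-uniform `AC⁰` -/

/-- The type of a gate in a circuit with `n` input variables. -/
inductive GateKind (n : ℕ) : Type
  | input (i : Fin n)
  | not
  | and
  | or

/-- The description of a gate type as a bit string. -/
def GateKind.code {n : ℕ} : GateKind n → List Bool
  | .input i => false :: false :: encodeNat i
  | .not => [false, true]
  | .and => [true, false]
  | .or => [true, true]

/-- Boolean circuits with `n` inputs and `m` outputs whose AND and OR gates have arbitrary fan-in
(fan-in `0` gives the constants). `wire h g` says that there is a wire from gate `h` to gate `g`. -/
structure Circuit (n m : ℕ) : Type where
  size : ℕ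
  kind : Fin size → GateKind n
  wire : Fin size → Fin size → Bool
  out : Fin m → Fin size
  acyclic : WellFounded fun h g => wire h g = true
  input_source : ∀ g i, kind g = .input i → ∀ h, wire h g = false
  not_unary : ∀ g, kind g = .not → ∃! h, wire h g = true

namespace Circuit

variable {n m : ℕ} (C : Circuit n m)

open Classical in
/-- The value of gate `g` on the input `x`. The only predecessor of a NOT gate is negated. -/
def value (x : Fin n → Bool) : Fin C.size → Bool :=
  C.acyclic.fix fun g rec =>
    match C.kind g with
    | .input i => x i
    | .not => !decide (∃ h, ∃ hw : C.wire h g = true, rec h hw = true)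
    | .and => decide (∀ h, ∀ hw : C.wire h g = true, rec h hw = true)
    | .or => decide (∃ h, ∃ hw : C.wire h g = true, rec h hw = true)

/-- The output string of the circuit on the input `x`. -/
def eval (x : Fin n → Bool) : Fin m → Bool := fun j => C.value x (C.out j)

/-- Every directed path has at most `d` wires. -/
def DepthLE (d : ℕ) : Prop :=
  ∃ ρ : Fin C.size → ℕ, (∀ h g, C.wire h g = true → ρ h < ρ g) ∧ ∀ g, ρ g ≤ d

/-- The answer to "what is the type of gate `g`?"; the empty string means that `g` is not the
index of a gate. -/
def kindQuery (g : ℕ) : List Bool := if h : g < C.size then (C.kind ⟨g, h⟩).code else []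

/-- The answer to "is there a wire from gate `h` to gate `g`?". -/
def wireQuery (h g : ℕ) : Bool :=
  if hh : h < C.size then if hg : g < C.size then C.wire ⟨h, hh⟩ ⟨g, hg⟩ else false else false

end Circuit

/-- A circuit family is polylogtime-uniform `AC⁰` if it has polynomial size and constant depth and
if gate types, wires and the gates carrying the output bits are computed from `n` and gate (output)
indices, all in binary, in time polynomial in the length of these data. As the indices have
`O(log n)` bits, this is time polynomial in `log n`. -/
def PolylogtimeUniformAC0 {m : ℕ → ℕ} (C : ∀ n, Circuit n (m n)) : Prop :=
  (∃ c : ℕ, ∀ n, (C n).size ≤ n ^ c + c) ∧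
  (∃ d : ℕ, ∀ n, (C n).DepthLE d) ∧
  PolyTime (encodingProd encodingNatBool encodingNatBool) (id : List Bool → List Bool)
    (fun q : ℕ × ℕ => (C q.1).kindQuery q.2) ∧
  PolyTime (encodingProd encodingNatBool (encodingProd encodingNatBool encodingNatBool)) encodeBool
    (fun q : ℕ × ℕ × ℕ => (C q.1).wireQuery q.2.1 q.2.2) ∧
  ∃ F : ℕ × ℕ → ℕ, PolyTime (encodingProd encodingNatBool encodingNatBool) encodeNat F ∧
    ∀ n (j : Fin (m n)), F (n, j) = (C n).out j

/-! ### Randomized streaming algorithms -/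

/-- The statement never pushes on stack `k`. -/
def NoPush {K : Type} {Γ : K → Type} {Λ σ : Type} (k : K) : TM2.Stmt Γ Λ σ → Prop
  | .push k' _ q => k' ≠ k ∧ NoPush k q
  | .peek _ _ q => NoPush k q
  | .pop _ _ q => NoPush k q
  | .load _ q => NoPush k q
  | .branch _ q₁ q₂ => NoPush k q₁ ∧ NoPush k q₂
  | .goto _ => True
  | .halt => True

/-- A (uniform) randomized streaming algorithm for `2n`-bit inputs: a probabilistic multi-stack
machine, with one program for each outcome of the coin tossed in every step. The input bits are
on the stack `stream`, which the machine can only pop, so that it reads the input once from left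
to right. The work stack `param` initially holds `n` in binary, the other work stacks are empty.
The answer is a function of the internal state in which the machine halts. -/
structure StreamingAlgorithm : Type 1 where
  K : Type
  [decEqK : DecidableEq K]
  [finK : Fintype K]
  Γ : K → Type
  [finΓ : ∀ k, Fintype (Γ k)]
  Λ : Type
  [finΛ : Fintype Λ]
  σ : Type
  [finσ : Fintype σ]
  stream : K
  param : K
  stream_ne_param : stream ≠ param
  streamSymbol : Bool ↪ Γ stream
  paramSymbol : Bool ↪ Γ param
  main : Λ
  initialState : σ
  program : Bool → Λ → TM2.Stmt Γ Λ σ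
  noPush_stream : ∀ b l, NoPush stream (program b l)
  answer : σ → Bool

namespace StreamingAlgorithm

attribute [instance] decEqK finK finΓ finΛ finσ

variable (A : StreamingAlgorithm)

/-- Configurations. -/
abbrev Cfg : Type := TM2.Cfg A.Γ A.Λ A.σ

/-- The initial configuration for the `2n`-bit input `z`. -/
def start {n : ℕ} (z : Fin (n + n) → Bool) : A.Cfg where
  l := some A.main
  var := A.initialState
  stk := Function.update
    (Function.update (fun _ => []) A.param ((encodeNat n).map A.paramSymbol))
    A.stream ((List.ofFn z).map A.streamSymbol)

/-- One step with coin `b`; a halted machine stays where it is. -/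
def step (c : A.Cfg) (b : Bool) : A.Cfg := (TM2.step (A.program b) c).getD c

/-- The configuration on the input `z` after `r.length` steps with the coin tosses `r`. -/
def run {n : ℕ} (z : Fin (n + n) → Bool) (r : List Bool) : A.Cfg := r.foldl A.step (A.start z)

/-- The number of symbols on the work stacks. -/
def space (c : A.Cfg) : ℕ := ∑ k ∈ Finset.univ.erase A.stream, (c.stk k).length

/-- For all inputs and all coin tosses, the machine halts after at most `T n` steps and never
holds more than `S n` symbols on its work stacks. -/
def RunsWithin (T S : ℕ → ℕ) : Prop :=
  ∀ (n : ℕ) (z : Fin (n + n) → Bool) (r : List Bool),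
    (r.length = T n → (A.run z r).l = none) ∧ A.space (A.run z r) ≤ S n

/-- On the input `z` the machine always halts (within some number `t` of steps), and it answers
`b` with probability at least `2/3` over the coin tosses. -/
def Outputs {n : ℕ} (z : Fin (n + n) → Bool) (b : Bool) : Prop :=
  ∃ t : ℕ, (∀ r : Fin t → Bool, (A.run z (List.ofFn r)).l = none) ∧
    (2 / 3 : ℝ) ≤
      ((Finset.univ.filter fun r : Fin t → Bool =>
        A.answer (A.run z (List.ofFn r)).var = b).card : ℝ) / 2 ^ t

/-- On every input some answer has probability at least `2/3`. -/
def BoundedGap : Prop := ∀ (n : ℕ) (z : Fin (n + n) → Bool), ∃ b, A.Outputs z b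

end StreamingAlgorithm

/-- The function `(log n)^{f(n)}`, with the logarithm to base `2`. -/
def logPow (f : ℕ → ℝ) (n : ℕ) : ℝ := (Real.logb 2 n) ^ (f n)

/-- Randomized streaming algorithms with bounded probability gap that use
`O(n (log n)^{f(n)})` time and `O((log n)^{f(n)})` space on `2n`-bit inputs. -/
def StreamingClass (f : ℕ → ℝ) : Set StreamingAlgorithm :=
  {A | A.BoundedGap ∧ ∃ T S : ℕ → ℕ, A.RunsWithin T S ∧
    (fun n => (T n : ℝ)) =O[atTop] (fun n => (n : ℝ) * logPow f n) ∧
    (fun n => (S n : ℝ)) =O[atTop] logPow f}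

/-- The circuits `C n`, run on `1^n`, produce for infinitely many `n` a `2n`-bit input on which
the answer of `A` is not the value of `DISJ`. -/
def Refutes (C : ∀ n, Circuit n (n + n)) (A : StreamingAlgorithm) : Prop :=
  ∃ᶠ n in atTop, A.Outputs ((C n).eval fun _ => true) (!DISJ ((C n).eval fun _ => true))

/-- Polylogtime-uniform-`AC⁰`-constructive separation of `DISJ` from the randomized streaming
algorithms with `O(n (log n)^{f(n)})` time and `O((log n)^{f(n)})` space. -/
def ConstructiveSeparation (f : ℕ → ℝ) : Prop :=
  ∀ A ∈ StreamingClass f, ∃ C : ∀ n, Circuit n (n + n), PolylogtimeUniformAC0 C ∧ Refutes C A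

/-- `(log n)^{f(n)}` is time-constructible up to a constant factor: some `s(n)` of this order is
computable from `n` in time `O((log n)^{f(n)})`, numbers being written in binary. -/
def TimeConstructible (f : ℕ → ℝ) : Prop :=
  ∃ (s T : ℕ → ℕ) (M : TM2ComputableAux Bool Bool),
    (fun n => (s n : ℝ)) =Θ[atTop] logPow f ∧
    (fun n => (T n : ℝ)) =O[atTop] logPow f ∧
    ∀ n, Nonempty (TM2OutputsInTime M.tm ((encodeNat n).map M.inputAlphabet.symm)
      (some ((encodeNat (s n)).map M.outputAlphabet.symm)) (T n))

end

/-! Suppose `P = NP`. Then one deterministic streaming algorithm answers correctly on the outputs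
`C_n(1^n)` of every uniform `AC⁰` family for all large `n`, so no family refutes it
(`exists_correct_streamingAlgorithm`).

The reason is that these outputs have very short descriptions. The value of a gate is a quantifier
over its predecessors, and gate indices have `O(log n)` bits. If `P = NP`, such a quantifier can be
evaluated in time polynomial in `log n` (`exists_FP_exists_nat`). The depth is constant, so
constantly many quantifiers suffice, and a single output bit is computable from `n` and its index in
time polynomial in `log n` (`exists_FP_value`, `exists_FP_eval`).

The algorithm is a search for a short predictor. Let `r` be roughly the `(k+1)`-st root of a number
`s(n)` of order `(log n)^{f(n)}`. All binary representations of numbers up to `2r + 1` are read as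
descriptions of machines, to be run for that many simulated instructions. While `x` arrives, every
candidate that mispredicts a bit is discarded; while `y` arrives, the predictions of the first
survivor replace the bits of `x`, which were never stored. If the bits of `xy` are computable in
polylogarithmic time, a fixed machine computing them is on the list for all large `n`, because `(log
n)^{f(n)}` exceeds every fixed power of `log n`. It survives, so there is a survivor, and every
survivor knows all of `x` (`finState_stateSeq`).

The space and the time per bit are polynomial in `log n + r`, of a degree that does not depend on
`k` (`exists_streamingAlgorithm`). Hence `k` can be chosen afterwards so large that both are
`O(r^{k+1}) = O((log n)^{f(n)})` (`cost_le_binRoot_pow`).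

To have concrete machines, polynomial-time computation is developed as a class `FP` of functions on
binary trees, realised by structured stack programs. The class contains a universal simulator
`simT`. Thus machines give functions in `FP` (`exists_FP_of_polyTime`), and compilation gives
machines back (`FP.polyTime`) as well as streaming algorithms. -/

noncomputable section

/-! ### Binary trees and their preorder codes -/

/-- Unlabelled binary trees, the data type of the functions considered below. -/
inductive BTree : Type
  | leaf : BTree
  | node (l r : BTree) : BTree

namespace BTree

/-- Preorder code: `false` for a leaf, `true` for an inner node. -/
def code : BTree → List Bool
  | leaf => [false]
  | node l r => true :: (code l ++ code r)

/-- The length of the code. -/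
def size (t : BTree) : ℕ := t.code.length

@[simp] theorem size_leaf : size leaf = 1 := rfl

@[simp] theorem size_node (l r : BTree) : size (node l r) = size l + size r + 1 := by
  simp [size, code]

theorem size_pos (t : BTree) : 0 < size t := by
  cases t <;> simp

/-- Left subtree. -/
def car : BTree → BTree
  | leaf => leaf
  | node l _ => l

/-- Right subtree. -/
def cdr : BTree → BTree
  | leaf => leaf
  | node _ r => r

/-- Case distinction on the first argument being a leaf. -/
def sel : BTree → BTree → BTree → BTree
  | leaf, a, _ => a
  | node _ _, _, b => b

@[simp] theorem car_leaf : car leaf = leaf := rfl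
@[simp] theorem cdr_leaf : cdr leaf = leaf := rfl
@[simp] theorem car_node (l r : BTree) : car (node l r) = l := rfl
@[simp] theorem cdr_node (l r : BTree) : cdr (node l r) = r := rfl
@[simp] theorem sel_leaf (a b : BTree) : sel leaf a b = a := rfl
@[simp] theorem sel_node (l r a b : BTree) : sel (node l r) a b = b := rfl

theorem size_car_le (t : BTree) : size (car t) ≤ size t := by
  cases t <;> simp; omega

theorem size_cdr_le (t : BTree) : size (cdr t) ≤ size t := by
  cases t <;> simp; omega

end BTree

open BTree

/-! ### A structured language for stack programs -/

/-- Programs over stacks of bits indexed by `ℕ`. `pop` branches on the popped symbol, `loop` pops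
until the stack is empty and runs one of its bodies for each symbol. `ext` is a loop over a
read-only external stack and `run` a call of an external machine. -/
inductive Com : Type
  | skip : Com
  | push (k : ℕ) (b : Bool) : Com
  | pop (k : ℕ) (e f t : Com) : Com
  | seq (a b : Com) : Com
  | loop (k : ℕ) (f t : Com) : Com
  | ext (c : Bool ⊕ Bool → Com) : Com
  | run : Com

namespace Com

open Function

/-- Big-step semantics with running time, for programs without external operations. -/
inductive Exec : Com → (ℕ → List Bool) → (ℕ → List Bool) → ℕ → Prop
  | skip {s} : Exec skip s s 1
  | push {s k b} : Exec (push k b) s (update s k (b :: s k)) 1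
  | pop_nil {s s' k e f g t} (h : s k = []) (he : Exec e s s' t) : Exec (pop k e f g) s s' (t + 1)
  | pop_cons {s s' k e f g t b l} (h : s k = b :: l)
      (he : Exec (cond b g f) (update s k l) s' t) : Exec (pop k e f g) s s' (t + 1)
  | seq {a b s s' s'' t u} (ha : Exec a s s' t) (hb : Exec b s' s'' u) :
      Exec (seq a b) s s'' (t + u + 1)
  | loop_nil {s k f g} (h : s k = []) : Exec (loop k f g) s s 1
  | loop_cons {s s' s'' k f g t u b l} (h : s k = b :: l)
      (hb : Exec (cond b g f) (update s k l) s' t) (hl : Exec (loop k f g) s' s'' u) :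
      Exec (loop k f g) s s'' (t + u + 1)

/-- Execution within a time bound. -/
def Runs (c : Com) (s s' : ℕ → List Bool) (T : ℕ) : Prop := ∃ t ≤ T, Exec c s s' t

theorem Runs.mono {c s s' T T'} (h : Runs c s s' T) (hT : T ≤ T') : Runs c s s' T' :=
  let ⟨t, ht, he⟩ := h
  ⟨t, ht.trans hT, he⟩

theorem Runs.of_eq {c s s' s'' T T'} (h : Runs c s s' T) (hs : s' = s'') (hT : T ≤ T') :
    Runs c s s'' T' := hs ▸ h.mono hT

theorem Runs.seq {a b s s' s'' T U} (ha : Runs a s s' T) (hb : Runs b s' s'' U) :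
    Runs (seq a b) s s'' (T + U + 1) :=
  let ⟨_, ht, he⟩ := ha
  let ⟨_, hu, hf⟩ := hb
  ⟨_, by omega, .seq he hf⟩

theorem Runs.loop_cons {k f g s s' s'' T U b l} (h : s k = b :: l)
    (hb : Runs (cond b g f) (update s k l) s' T) (hl : Runs (loop k f g) s' s'' U) :
    Runs (loop k f g) s s'' (T + U + 1) :=
  let ⟨_, ht, he⟩ := hb
  let ⟨_, hu, hf⟩ := hl
  ⟨_, by omega, .loop_cons h he hf⟩

theorem Runs.loop_nil {k f g s} (h : s k = []) : Runs (loop k f g) s s 1 :=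
  ⟨1, le_rfl, .loop_nil h⟩

theorem Runs.pop_nil {k e f g s s' T} (h : s k = []) (he : Runs e s s' T) :
    Runs (pop k e f g) s s' (T + 1) :=
  let ⟨_, ht, he⟩ := he
  ⟨_, by omega, .pop_nil h he⟩

theorem Runs.pop_cons {k e f g s s' T b l} (h : s k = b :: l)
    (he : Runs (cond b g f) (update s k l) s' T) : Runs (pop k e f g) s s' (T + 1) :=
  let ⟨_, ht, he⟩ := he
  ⟨_, by omega, .pop_cons h he⟩

/-- The store that agrees with `s` below `i`, holds `L` from `i` on, and is empty above. -/
def st (s : ℕ → List Bool) (i : ℕ) (L : List (List Bool)) : ℕ → List Bool :=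
  fun j => if j < i then s j else L.getD (j - i) []

@[simp] theorem st_apply (s i L j) : st s i L (i + j) = L.getD j [] := by simp [st]

@[simp] theorem st_apply_zero (s i L) : st s i L i = L.getD 0 [] := by simp [st]

theorem st_update {s i L j} (v : List Bool) (h : j < L.length) :
    update (st s i L) (i + j) v = st s i (L.set j v) := by
  funext k
  by_cases hk : k = i + j
  · subst hk; simp [h]
  · rw [update_of_ne hk]
    unfold st
    split_ifs with h1
    · rfl
    · rw [List.getD_eq_getElem?_getD, List.getD_eq_getElem?_getD, List.getElem?_set_ne (by omega)]

theorem st_update_zero {s i L} (v : List Bool) (h : 0 < L.length) :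
    update (st s i L) i v = st s i (L.set 0 v) := st_update (j := 0) v h

/-- Regarding stack `i` as part of the background store lets a program written for the stacks from
any index on be called one stack higher, with stack `i` preserved. -/
theorem st_cons (s i x L) : st s i (x :: L) = st (update s i x) (i + 1) L := by
  funext k
  unfold st
  by_cases hk : k < i
  · simp [hk, hk.trans (Nat.lt_succ_self i), update_of_ne hk.ne]
  · by_cases hk' : k = i
    · subst hk'; simp
    · have : ¬ k < i + 1 := by omega
      obtain ⟨d, rfl⟩ : ∃ d, k = i + 1 + d := ⟨k - (i + 1), by omega⟩
      simp only [hk, this, if_false, show i + 1 + d - i = d + 1 by omega, Nat.add_sub_cancel_left, List.getD_cons_succ]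

/-- Stacks beyond the list are empty, so empty auxiliary stacks may be listed or dropped at will. -/
theorem st_append_nil (s i L) : st s i (L ++ [[]]) = st s i L := by
  funext k
  unfold st
  split_ifs with h1
  · rfl
  · rw [List.getD_eq_getElem?_getD, List.getD_eq_getElem?_getD, List.getElem?_append]
    split_ifs with h2
    · rfl
    · rw [List.getElem?_eq_none (l := L) (by omega)]
      rcases Nat.eq_zero_or_pos (k - i - L.length) with h | h
      · simp [h]
      · rw [List.getElem?_eq_none (by simp only [List.length_singleton]; omega)]

theorem st_pad1 (s i a) : st s i [a] = st s i [a, []] := (st_append_nil s i [a]).symm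
theorem st_pad2 (s i a b) : st s i [a, b] = st s i [a, b, []] := (st_append_nil s i [a, b]).symm
theorem st_pad3 (s i a b c) : st s i [a, b, c] = st s i [a, b, c, []] :=
  (st_append_nil s i [a, b, c]).symm

theorem Runs.push {s i L j b} (h : j < L.length) :
    Runs (push (i + j) b) (st s i L) (st s i (L.set j (b :: L.getD j []))) 1 := by
  refine ⟨1, le_rfl, ?_⟩
  have := Exec.push (s := st s i L) (k := i + j) (b := b)
  rwa [st_update _ h, st_apply] at this

/-- Pushing a whole word, the last symbol first. -/
def pushes (k : ℕ) : List Bool → Com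
  | [] => skip
  | b :: w => seq (pushes k w) (push k b)

theorem Runs.pushes {s i L j} (h : j < L.length) (w : List Bool) :
    Runs (pushes (i + j) w) (st s i L) (st s i (L.set j (w ++ L.getD j []))) (2 * w.length + 1) := by
  induction w with
  | nil =>
    refine ⟨1, by simp, ?_⟩
    have : L.set j ([] ++ L.getD j []) = L := by
      rw [List.nil_append, List.getD_eq_getElem _ _ h, List.set_getElem_self]
    rw [this]
    exact .skip
  | cons b w ih =>
    refine (ih.seq (Runs.push (by simpa using h))).of_eq ?_ ?_
    · simp [h]
    · simp; omega

/-- A loop that replaces each symbol `b` of stack `i + j` by pushing `w b` on stack `i + k`. -/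
def trans (j k : ℕ) (w : Bool → List Bool) : Com := loop j (pushes k (w false)) (pushes k (w true))

/-- Each symbol costs at most `2 * m + 1` steps for pushing its word and one step for the loop.
Since symbols are popped from the front, the words end up in reverse order. -/
theorem Runs.trans {s i j k} (w : Bool → List Bool) (m : ℕ) (hm : ∀ b, (w b).length ≤ m)
    (hjk : j ≠ k) : ∀ (l : List Bool) (L : List (List Bool)), j < L.length → k < L.length →
    L.getD j [] = l →
    Runs (trans (i + j) (i + k) w) (st s i L)
      (st s i ((L.set j []).set k (l.foldl (fun acc b => w b ++ acc) (L.getD k []))))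
      ((2 * m + 2) * l.length + 1)
  | [], L, hj, hk, hl => by
    have h1 : (L.set j []).set k (L.getD k []) = L := by
      rw [← hl, List.getD_eq_getElem _ _ hj, List.set_getElem_self, List.getD_eq_getElem _ _ hk,
        List.set_getElem_self]
    simp only [List.foldl_nil, h1]
    exact (Runs.loop_nil (by simpa using hl)).mono (by simp)
  | b :: l, L, hj, hk, hl => by
    have key := Runs.trans (s := s) (i := i) w m hm hjk l ((L.set j l).set k (w b ++ L.getD k []))
      (by simpa using hj) (by simpa using hk) (by simp [hjk.symm, hj])
    have hb : Runs (cond b (Com.pushes (i + k) (w true)) (Com.pushes (i + k) (w false)))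
        (update (st s i L) (i + j) l) (st s i ((L.set j l).set k (w b ++ L.getD k [])))
        (2 * m + 1) := by
      rw [st_update _ hj]
      have := Runs.pushes (s := s) (i := i) (L := L.set j l) (j := k) (by simpa using hk) (w b)
      have h2 : (L.set j l).getD k [] = L.getD k [] := by
        simp [List.getD_eq_getElem?_getD, List.getElem?_set_ne hjk]
      rw [h2] at this
      have h3 := this.mono (T' := 2 * m + 1) (by have := hm b; omega)
      cases b <;> exact h3
    refine (Runs.loop_cons (by simpa using hl) hb key).of_eq ?_ ?_
    · rw [List.set_comm _ _ hjk.symm]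
      simp [hk]
    · simp; ring_nf; omega

/-- Moving stack `j` onto stack `k`. -/
def mv (j k : ℕ) : Com := trans j k fun b => [b]

theorem foldl_single (l acc : List Bool) :
    l.foldl (fun acc b => [b] ++ acc) acc = l.reverse ++ acc := by
  induction l generalizing acc with
  | nil => rfl
  | cons b l ih => rw [List.foldl_cons, ih]; simp

theorem Runs.mv {s i L} (j k : ℕ) (hjk : j ≠ k) (hj : j < L.length) (hk : k < L.length) :
    Runs (mv (i + j) (i + k)) (st s i L)
      (st s i ((L.set j []).set k ((L.getD j []).reverse ++ L.getD k [])))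
      (4 * (L.getD j []).length + 1) := by
  have := Runs.trans (s := s) (i := i) (fun b => [b]) 1 (by simp) hjk _ L hj hk rfl
  rwa [foldl_single] at this

/-- Emptying a stack. -/
def clear (j : ℕ) : Com := loop j skip skip

theorem Runs.clear {s i j} : ∀ (l : List Bool) (L : List (List Bool)), j < L.length →
    L.getD j [] = l → Runs (clear (i + j)) (st s i L) (st s i (L.set j [])) (2 * l.length + 1)
  | [], L, hj, hl => by
    have h1 : L.set j [] = L := by rw [← hl, List.getD_eq_getElem _ _ hj, List.set_getElem_self]
    rw [h1]
    exact Runs.loop_nil (by simpa using hl)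
  | b :: l, L, hj, hl => by
    have key := Runs.clear (s := s) (i := i) l (L.set j l) (by simpa using hj) (by simp [hj])
    have hb : Runs (cond b Com.skip Com.skip) (update (st s i L) (i + j) l) (st s i (L.set j l)) 1 := by
      rw [st_update _ hj]
      cases b <;> exact ⟨1, le_rfl, .skip⟩
    refine (Runs.loop_cons (by simpa using hl) hb key).of_eq ?_ ?_
    · simp
    · simp; omega

end Com

open BTree

/-! ### Polynomial bounds -/

/-- Polynomially bounded functions. -/
def PolyBdd (p : ℕ → ℕ) : Prop := ∃ d, ∀ m, p m ≤ (m + 2) ^ d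

namespace PolyBdd

theorem mono {p q : ℕ → ℕ} (hq : PolyBdd q) (h : ∀ m, p m ≤ q m) : PolyBdd p :=
  let ⟨d, hd⟩ := hq
  ⟨d, fun m => (h m).trans (hd m)⟩

theorem const (c : ℕ) : PolyBdd fun _ => c :=
  ⟨c, fun m => (Nat.lt_two_pow_self (n := c)).le.trans (Nat.pow_le_pow_left (by omega) c)⟩

theorem id : PolyBdd fun m => m := ⟨1, fun m => by simp⟩

theorem add {p q : ℕ → ℕ} (hp : PolyBdd p) (hq : PolyBdd q) : PolyBdd fun m => p m + q m := by
  obtain ⟨d, hd⟩ := hp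
  obtain ⟨e, he⟩ := hq
  refine ⟨max d e + 1, fun m => ?_⟩
  have h1 := (hd m).trans (Nat.pow_le_pow_right (by omega) (le_max_left d e))
  have h2 := (he m).trans (Nat.pow_le_pow_right (by omega) (le_max_right d e))
  rw [pow_succ]
  nlinarith [Nat.zero_le ((m + 2) ^ max d e * m)]

theorem mul {p q : ℕ → ℕ} (hp : PolyBdd p) (hq : PolyBdd q) : PolyBdd fun m => p m * q m := by
  obtain ⟨d, hd⟩ := hp
  obtain ⟨e, he⟩ := hq
  exact ⟨d + e, fun m => (Nat.mul_le_mul (hd m) (he m)).trans (pow_add _ _ _).ge⟩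

theorem pow {p : ℕ → ℕ} (hp : PolyBdd p) (k : ℕ) : PolyBdd fun m => p m ^ k := by
  obtain ⟨d, hd⟩ := hp
  exact ⟨d * k, fun m => (Nat.pow_le_pow_left (hd m) k).trans (pow_mul _ _ _).ge⟩

theorem comp {p q : ℕ → ℕ} (hp : PolyBdd p) (hq : PolyBdd q) : PolyBdd fun m => p (q m) := by
  obtain ⟨d, hd⟩ := hp
  exact ((hq.add (const 2)).pow d).mono fun m => hd _

theorem eval (p : Polynomial ℕ) : PolyBdd fun m => p.eval m := by
  induction p using Polynomial.induction_on' with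
  | add p q hp hq => simpa using hp.add hq
  | monomial n a => simpa using (const a).mul (id.pow n)

end PolyBdd

/-! ### Polynomial-time functions on trees -/

/-- Functions on trees computed, in place on the code of the argument, by a program that works on
the stacks from any given stack on and takes polynomial time. -/
@[fun_prop]
def FP (f : BTree → BTree) : Prop :=
  ∃ (c : ℕ → Com) (d : ℕ), ∀ i s x,
    (c i).Runs (Com.st s i [code x]) (Com.st s i [code (f x)]) ((size x + 2) ^ d)

/-! ### Copying, moving and splitting codes on stacks -/

namespace Com

open Function

theorem Exec.length_le {c s s' t} (h : Exec c s s' t) (k : ℕ) :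
    (s' k).length ≤ (s k).length + t := by
  have upd : ∀ (s : ℕ → List Bool) (j : ℕ) (b : Bool) (l : List Bool), s j = b :: l →
      (update s j l k).length ≤ (s k).length := by
    intro s j b l hj
    by_cases hk : k = j
    · subst hk; simp [hj]
    · simp [update_of_ne hk]
  induction h with
  | skip => omega
  | @push s j b =>
    by_cases hk : k = j
    · subst hk; simp
    · simp [update_of_ne hk]
  | pop_nil h he ih => omega
  | pop_cons h he ih => have := upd _ _ _ _ h; omega
  | seq ha hb iha ihb => omega
  | loop_nil h => omega
  | loop_cons h hb hl ihb ihl => have := upd _ _ _ _ h; omega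

/-- Duplicating stack `i` on stack `i + 1`. -/
def dup (i : ℕ) : Com :=
  seq (mv (i + 0) (i + 2)) (loop (i + 2) (seq (push (i + 0) false) (push (i + 1) false))
    (seq (push (i + 0) true) (push (i + 1) true)))

theorem Runs.dup {s i} (x : List Bool) :
    Runs (dup i) (st s i [x]) (st s i [x, x]) (8 * x.length + 3) := by
  have h1 : Runs (Com.mv (i + 0) (i + 2)) (st s i [x, [], []]) (st s i [[], [], x.reverse ++ []])
    (4 * x.length + 1) := Runs.mv 0 2 (by simp) (by simp) (by simp)
  have h2 : ∀ l a b : List Bool, Runs (Com.loop (i + 2)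
      (Com.seq (Com.push (i + 0) false) (Com.push (i + 1) false))
      (Com.seq (Com.push (i + 0) true) (Com.push (i + 1) true))) (st s i [a, b, l])
      (st s i [l.reverse ++ a, l.reverse ++ b, []]) (4 * l.length + 1) := by
    intro l
    induction l with
    | nil => intro a b; exact Runs.loop_nil (st_apply s i _ 2)
    | cons y l ih =>
      intro a b
      have hb : ∀ z, Runs (Com.seq (Com.push (i + 0) z) (Com.push (i + 1) z))
          (st s i [a, b, l]) (st s i [z :: a, z :: b, l]) 3 := fun z =>
        Runs.seq (T := 1) (U := 1) (Runs.push (L := [a, b, l]) (j := 0) (by simp))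
          (Runs.push (L := [z :: a, b, l]) (j := 1) (by simp))
      have hc : Runs (cond y (Com.seq (Com.push (i + 0) true) (Com.push (i + 1) true))
          (Com.seq (Com.push (i + 0) false) (Com.push (i + 1) false)))
          (update (st s i [a, b, y :: l]) (i + 2) l) (st s i [y :: a, y :: b, l]) 3 := by
        rw [st_update _ (by simp)]
        cases y
        · exact hb false
        · exact hb true
      refine (Runs.loop_cons (st_apply s i _ 2) hc (ih _ _)).of_eq ?_ ?_
      · simp
      · simp; omega
  rw [st_pad1, st_pad2]
  refine (h1.seq (h2 _ _ _)).of_eq ?_ ?_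
  · simpa using (st_pad2 s i x x).symm
  · simp; omega

/-- Moving stack `i + j` to stack `i + k` through the auxiliary stack `i + m`. -/
def mv2 (j m k : ℕ) : Com := seq (mv j m) (mv m k)

theorem Runs.mv2 {s i L} (j m k : ℕ) (hjm : j ≠ m) (hmk : m ≠ k) (hjk : j ≠ k)
    (hj : j < L.length) (hm : m < L.length) (hk : k < L.length) (h0 : L.getD m [] = []) :
    Runs (mv2 (i + j) (i + m) (i + k)) (st s i L)
      (st s i ((L.set j []).set k (L.getD j [] ++ L.getD k [])))
      (8 * (L.getD j []).length + 3) := by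
  have h1 := Runs.mv (s := s) (i := i) j m hjm hj hm
  have h2 := Runs.mv (s := s) (i := i)
    (L := (L.set j []).set m ((L.getD j []).reverse ++ L.getD m [])) m k hmk
    (by simpa using hm) (by simpa using hk)
  refine (h1.seq h2).of_eq ?_ ?_
  · congr 1
    have hm' : (((L.set j []).set m ((L.getD j []).reverse ++ L.getD m [])).set m []) =
        L.set j [] := by
      have h3 := List.set_getElem_self (as := L.set j []) (i := m) (by simpa using hm)
      rw [List.getElem_set_ne hjm, ← List.getD_eq_getElem _ [] hm, h0] at h3
      rw [List.set_set, h3]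
    rw [hm', h0]
    simp [hm, hmk, hjk]
  · have : ((L.set j []).set m ((L.getD j []).reverse ++ L.getD m [])).getD m [] =
        (L.getD j []).reverse := by
      rw [h0]; simp [hm]
    rw [this, List.length_reverse]
    omega

/-- The loop body that moves the next subtree code from stack `i` to stack `i + 3`, the number of
subtrees still to be moved being the height of stack `i + 2`. -/
def splitBody (i : ℕ) : Com :=
  pop (i + 0) skip (push (i + 3) false)
    (seq (push (i + 3) true) (seq (push (i + 2) true) (push (i + 2) true)))

/-- The statement is in continuation form: whatever the loop does once this subtree is moved and its
token is spent, it also does, a little later, from the present state. In this form the two subtrees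
of a node can be chained in the induction. A node costs 7 steps of its own, a leaf fewer. -/
theorem Runs.splitLoop {s i} (l : BTree) : ∀ (r k acc : List Bool) (s'' : ℕ → List Bool) (U : ℕ),
    Runs (loop (i + 2) (splitBody i) (splitBody i))
      (st s i [r, [], k, (code l).reverse ++ acc]) s'' U →
    Runs (loop (i + 2) (splitBody i) (splitBody i))
      (st s i [code l ++ r, [], true :: k, acc]) s'' (U + 7 * size l) := by
  induction l with
  | leaf =>
    intro r k acc s'' U h
    have hb : Runs (splitBody i) (update (st s i [code leaf ++ r, [], true :: k, acc]) (i + 2) k)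
        (st s i [r, [], k, (code leaf).reverse ++ acc]) 2 := by
      rw [st_update _ (by simp)]
      refine Runs.pop_cons (b := false) (l := r) (st_apply s i _ 0) ?_
      rw [st_update _ (by simp)]
      exact Runs.push (L := [r, [], k, acc]) (j := 3) (by simp)
    exact (Runs.loop_cons (b := true) (st_apply s i _ 2) hb h).mono (by simp; omega)
  | node l₁ l₂ ih₁ ih₂ =>
    intro r k acc s'' U h
    have hb : Runs (splitBody i)
        (update (st s i [code (node l₁ l₂) ++ r, [], true :: k, acc]) (i + 2) k)
        (st s i [code l₁ ++ (code l₂ ++ r), [], true :: true :: k, true :: acc]) 6 := by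
      rw [st_update _ (by simp)]
      refine Runs.pop_cons (b := true) (l := code l₁ ++ (code l₂ ++ r)) (T := 5) ?_ ?_
      · simp [code]
      rw [st_update _ (by simp)]
      exact Runs.seq (T := 1) (U := 3) (Runs.push (L := [_, [], k, acc]) (j := 3) (by simp))
        (Runs.seq (T := 1) (U := 1) (Runs.push (L := [_, [], k, _]) (j := 2) (by simp))
          (Runs.push (L := [_, [], _, _]) (j := 2) (by simp)))
    refine (Runs.loop_cons (b := true) (st_apply s i _ 2) hb (ih₁ _ _ _ _ _ (ih₂ _ _ _ _ U ?_))).mono ?_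
    · simpa [code] using h
    · simp; omega

/-- Splitting a pair of codes on stack `i`: the first component goes to stack `i + 1`. -/
def split (i : ℕ) : Com :=
  seq (push (i + 2) true) (seq (loop (i + 2) (splitBody i) (splitBody i)) (mv (i + 3) (i + 1)))

theorem Runs.split {s i} (l : BTree) (r : List Bool) :
    Runs (split i) (st s i [code l ++ r]) (st s i [r, code l]) (11 * size l + 5) := by
  have h1 : Runs (Com.push (i + 2) true) (st s i [code l ++ r, [], [], []])
    (st s i [code l ++ r, [], [true], []]) 1 := Runs.push (j := 2) (by simp)
  have h2 := Runs.splitLoop (s := s) (i := i) l r [] [] _ 1 (Runs.loop_nil (st_apply s i _ 2))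
  have h3 : Runs (Com.mv (i + 3) (i + 1)) (st s i [r, [], [], (code l).reverse ++ []])
      (st s i [r, ((code l).reverse ++ []).reverse ++ [], [], []])
      (4 * ((code l).reverse ++ []).length + 1) :=
    Runs.mv 3 1 (by simp) (by simp) (by simp)
  rw [st_pad1, st_pad2, st_pad3]
  refine (h1.seq (h2.seq h3)).of_eq ?_ ?_
  · simp only [List.append_nil, List.reverse_reverse]
    rw [← st_pad3, ← st_pad2]
  · simp only [List.append_nil, List.length_reverse]
    change _ ≤ 11 * (code l).length + 5
    change 1 + (1 + 7 * (code l).length + (4 * (code l).length + 1) + 1) + 1 ≤ _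
    omega

end Com

/-! ### Closure properties of polynomial-time functions on trees -/

namespace FP

open Com

theorem of_polyBdd {f : BTree → BTree} (c : ℕ → Com) (p : ℕ → ℕ) (hp : PolyBdd p)
    (h : ∀ i s x, (c i).Runs (st s i [code x]) (st s i [code (f x)]) (p (size x))) : FP f :=
  let ⟨d, hd⟩ := hp
  ⟨c, d, fun i s x => (h i s x).mono (hd _)⟩

/-- A step adds at most one symbol to a stack, so a polynomial time bound is also a bound on the
size of the value. This is what keeps compositions polynomial. -/
theorem polyBdd_size {f : BTree → BTree} (hf : FP f) :
    ∃ p, PolyBdd p ∧ Monotone p ∧ ∀ x, size (f x) ≤ p (size x) := by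
  obtain ⟨c, d, h⟩ := hf
  refine ⟨fun m => m + (m + 2) ^ d, PolyBdd.id.add ⟨d, fun m => le_rfl⟩, ?_, fun x => ?_⟩
  · intro a b hab
    exact Nat.add_le_add hab (Nat.pow_le_pow_left (by omega) d)
  · obtain ⟨t, ht, he⟩ := h 0 (fun _ => []) x
    have := he.length_le 0
    simp only [st_apply_zero, List.getD_cons_zero] at this
    exact this.trans (Nat.add_le_add_left ht _)

@[fun_prop]
theorem id : FP fun x => x := ⟨fun _ => .skip, 1, fun i s x => ⟨1, by simp, .skip⟩⟩

@[fun_prop]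
theorem comp {f g : BTree → BTree} (hf : FP f) (hg : FP g) : FP fun x => f (g x) := by
  obtain ⟨p, hp, hm, hs⟩ := hg.polyBdd_size
  obtain ⟨c, d, hc⟩ := hf
  obtain ⟨c', d', hc'⟩ := hg
  refine of_polyBdd (fun i => (c' i).seq (c i)) (fun m => (m + 2) ^ d' + (p m + 2) ^ d + 1)
    (.add (.add ⟨d', fun m => le_rfl⟩ ((hp.add (.const 2)).pow d)) (.const 1)) fun i s x => ?_
  refine ((hc' i s x).seq (hc i s (g x))).mono ?_
  have := Nat.pow_le_pow_left (Nat.add_le_add_right (hs x) 2) d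
  omega

-- The value of `f` is computed on a copy of the argument, one stack above the original. The
-- original is then moved above that value and consumed by `g`. Finally both codes are put back in
-- front of each other on stack `i`.
@[fun_prop]
theorem node {f g : BTree → BTree} (hf : FP f) (hg : FP g) :
    FP fun x => node (f x) (g x) := by
  obtain ⟨p, hp, hpm, hps⟩ := hf.polyBdd_size
  obtain ⟨q, hq, hqm, hqs⟩ := hg.polyBdd_size
  obtain ⟨c, d, hc⟩ := hf
  obtain ⟨c', d', hc'⟩ := hg
  refine of_polyBdd (fun i => (dup i).seq <| (c (i + 1)).seq <| (mv2 (i + 0) (i + 3) (i + 2)).seq <|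
    (c' (i + 2)).seq <| (mv2 (i + 2) (i + 3) (i + 0)).seq <|
    (mv2 (i + 1) (i + 2) (i + 0)).seq (push (i + 0) true))
    (fun m => 16 * m + (m + 2) ^ d + (m + 2) ^ d' + 8 * p m + 8 * q m + 19)
    (.add (.add (.add (.add (.add (.mul (.const _) .id) ⟨d, fun m => le_rfl⟩)
      ⟨d', fun m => le_rfl⟩) (.mul (.const _) hp)) (.mul (.const _) hq)) (.const _))
    fun i s x => ?_
  have h1 := Runs.dup (s := s) (i := i) (code x)
  have h2 := hc (i + 1) (Function.update s i (code x)) x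
  rw [← st_cons, ← st_cons, st_pad2 s i (code x) (code (f x)), st_pad3] at h2
  have h3 : Runs (mv2 (i + 0) (i + 3) (i + 2)) (st s i [code x, code (f x), [], []])
    (st s i [[], code (f x), code x ++ [], []]) (8 * (code x).length + 3) :=
    Runs.mv2 0 3 2 (by simp) (by simp) (by simp) (by simp) (by simp) (by simp) rfl
  rw [List.append_nil, ← st_pad3 s i [] (code (f x)) (code x)] at h3
  have h4 := hc' (i + 2) (Function.update (Function.update s i []) (i + 1) (code (f x))) x
  rw [← st_cons, ← st_cons, ← st_cons, ← st_cons, st_pad3 s i [] (code (f x)) (code (g x))] at h4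
  have h5 : Runs (mv2 (i + 2) (i + 3) (i + 0)) (st s i [[], code (f x), code (g x), []])
    (st s i [code (g x) ++ [], code (f x), [], []]) (8 * (code (g x)).length + 3) :=
    Runs.mv2 2 3 0 (by simp) (by simp) (by simp) (by simp) (by simp) (by simp) rfl
  rw [List.append_nil] at h5
  have h6 : Runs (mv2 (i + 1) (i + 2) (i + 0)) (st s i [code (g x), code (f x), [], []])
    (st s i [code (f x) ++ code (g x), [], [], []]) (8 * (code (f x)).length + 3) :=
    Runs.mv2 1 2 0 (by simp) (by simp) (by simp) (by simp) (by simp) (by simp) rfl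
  have h7 : Runs (push (i + 0) true) (st s i [code (f x) ++ code (g x), [], [], []])
    (st s i [code (BTree.node (f x) (g x)), [], [], []]) 1 := Runs.push (j := 0) (by simp)
  rw [← st_pad3 s i (code (BTree.node (f x) (g x))), ← st_pad2, ← st_pad1] at h7
  refine (h1.seq <| h2.seq <| h3.seq <| h4.seq <| h5.seq <| h6.seq h7).mono ?_
  have e1 := hps x
  have e2 := hqs x
  unfold size at *
  omega

theorem leaf : FP fun _ => leaf := by
  refine of_polyBdd (fun i => (clear (i + 0)).seq (push (i + 0) false)) (fun m => 2 * m + 3)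
    (.add (.mul (.const _) .id) (.const _)) fun i s x => ?_
  have h1 : Runs (clear (i + 0)) (st s i [code x]) (st s i [[]]) (2 * (code x).length + 1) :=
    Runs.clear (j := 0) _ _ (by simp) rfl
  have h2 : Runs (push (i + 0) false) (st s i [[]]) (st s i [code .leaf]) 1 :=
    Runs.push (j := 0) (by simp)
  exact (h1.seq h2).mono (by unfold size; omega)

@[fun_prop]
theorem const (t : BTree) : FP fun _ => t := by
  induction t with
  | leaf => exact leaf
  | node l r hl hr => exact hl.node hr

@[fun_prop]
theorem car : FP BTree.car := by
  -- A code is never empty, so the first branch of `pop` is dead. The first symbol tells a leaf from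
  -- a node.
  refine of_polyBdd (fun i => pop (i + 0) skip (push (i + 0) false)
    ((split i).seq <| (clear (i + 0)).seq (mv2 (i + 1) (i + 2) (i + 0))))
    (fun m => 19 * m + 19) (.add (.mul (.const _) .id) (.const _)) fun i s x => ?_
  cases x with
  | leaf =>
    refine (Runs.pop_cons (b := false) (l := []) (st_apply s i _ 0) (T := 1) ?_).mono (by simp)
    rw [st_update _ (by simp)]
    exact Runs.push (L := [[]]) (j := 0) (by simp)
  | node l r =>
    have h1 := Runs.split (s := s) (i := i) l (code r)
    rw [st_pad2] at h1
    have h2 : Runs (clear (i + 0)) (st s i [code r, code l, []]) (st s i [[], code l, []])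
      (2 * (code r).length + 1) := Runs.clear (j := 0) _ _ (by simp) rfl
    have h3 : Runs (mv2 (i + 1) (i + 2) (i + 0)) (st s i [[], code l, []])
      (st s i [code l ++ [], [], []]) (8 * (code l).length + 3) :=
      Runs.mv2 1 2 0 (by simp) (by simp) (by simp) (by simp) (by simp) (by simp) rfl
    rw [List.append_nil, ← st_pad2 s i (code l), ← st_pad1] at h3
    refine (Runs.pop_cons (b := true) (l := code l ++ code r) (st_apply s i _ 0)
      (T := 11 * size l + 5 + (2 * size r + 1 + (8 * size l + 3) + 1) + 1) ?_).mono ?_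
    · rw [st_update _ (by simp)]
      exact h1.seq (h2.seq h3)
    · simp; omega

@[fun_prop]
theorem cdr : FP BTree.cdr := by
  refine of_polyBdd (fun i => pop (i + 0) skip (push (i + 0) false)
    ((split i).seq <| (clear (i + 1))))
    (fun m => 19 * m + 19) (.add (.mul (.const _) .id) (.const _)) fun i s x => ?_
  cases x with
  | leaf =>
    refine (Runs.pop_cons (b := false) (l := []) (st_apply s i _ 0) (T := 1) ?_).mono (by simp)
    rw [st_update _ (by simp)]
    exact Runs.push (L := [[]]) (j := 0) (by simp)
  | node l r =>
    have h1 := Runs.split (s := s) (i := i) l (code r)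
    have h2 : Runs (clear (i + 1)) (st s i [code r, code l]) (st s i [code r, []])
      (2 * (code l).length + 1) := Runs.clear (j := 1) _ _ (by simp) rfl
    rw [← st_pad1] at h2
    refine (Runs.pop_cons (b := true) (l := code l ++ code r) (st_apply s i _ 0)
      (T := 11 * size l + 5 + (2 * size l + 1) + 1) ?_).mono ?_
    · rw [st_update _ (by simp)]
      exact h1.seq h2
    · simp; omega

@[fun_prop]
theorem sel {k f g : BTree → BTree} (hk : FP k) (hf : FP f) (hg : FP g) :
    FP fun x => sel (k x) (f x) (g x) := by
  obtain ⟨p, hp, hpm, hps⟩ := hk.polyBdd_size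
  obtain ⟨c₀, d₀, hc₀⟩ := hk
  obtain ⟨c, d, hc⟩ := hf
  obtain ⟨c', d', hc'⟩ := hg
  refine of_polyBdd (fun i => (dup i).seq <| (c₀ (i + 1)).seq <|
    pop (i + 1) skip (c (i + 0)) ((clear (i + 1)).seq (c' (i + 0))))
    (fun m => 8 * m + (m + 2) ^ d₀ + (m + 2) ^ d + (m + 2) ^ d' + 2 * p m + 9)
    (.add (.add (.add (.add (.add (.mul (.const _) .id) ⟨d₀, fun m => le_rfl⟩) ⟨d, fun m => le_rfl⟩)
      ⟨d', fun m => le_rfl⟩) (.mul (.const _) hp)) (.const _)) fun i s x => ?_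
  have h1 := Runs.dup (s := s) (i := i) (code x)
  have h2 := hc₀ (i + 1) (Function.update s i (code x)) x
  rw [← st_cons, ← st_cons] at h2
  have e1 := hps x
  obtain ⟨T, hT, h3⟩ : ∃ T ≤ (size x + 2) ^ d + (size x + 2) ^ d' + 2 * p (size x) + 3,
      Runs (pop (i + 1) skip (c (i + 0)) ((clear (i + 1)).seq (c' (i + 0))))
        (st s i [code x, code (k x)]) (st s i [code (BTree.sel (k x) (f x) (g x))]) T := by
    cases hk : k x with
    | leaf =>
      refine ⟨_, ?_, Runs.pop_cons (b := false) (l := []) (st_apply s i _ 1)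
        (T := (size x + 2) ^ d) ?_⟩
      · omega
      · rw [st_update _ (by simp)]
        change Runs _ (st s i [code x, []]) _ _
        rw [← st_pad1]
        exact hc i s x
    | node l r =>
      refine ⟨_, ?_, Runs.pop_cons (b := true) (l := code l ++ code r) (st_apply s i _ 1)
        (T := 2 * (code l ++ code r).length + 1 + (size x + 2) ^ d' + 1) ?_⟩
      · have : size (k x) = (code l ++ code r).length + 1 := by rw [hk]; rfl
        omega
      · rw [st_update _ (by simp)]
        have h4 : Runs (clear (i + 1)) (st s i [code x, code l ++ code r]) (st s i [code x, []])
          (2 * (code l ++ code r).length + 1) := Runs.clear (j := 1) _ _ (by simp) rfl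
        rw [← st_pad1] at h4
        exact h4.seq (hc' i s x)
  refine (h1.seq (h2.seq h3)).mono ?_
  change 8 * size x + 3 + _ + 1 ≤ _
  omega

/-- Iterating a function, the number of rounds being the size of a tree. -/
theorem iterate {f n a : BTree → BTree} (hf : FP f) (hn : FP n) (ha : FP a) (p : ℕ → ℕ)
    (hp : PolyBdd p) (hpb : ∀ x, ∀ j ≤ size (n x), size (f^[j] (a x)) ≤ p (size x)) :
    FP fun x => f^[size (n x)] (a x) := by
  obtain ⟨q, hq, hqm, hqs⟩ := (ha.node hn).polyBdd_size
  obtain ⟨c₀, d₀, hc₀⟩ := ha.node hn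
  obtain ⟨c, d, hc⟩ := hf
  -- The code of the pair `node (a x) (n x)` is split: the code of `n x` remains on stack `i` as a
  -- mere counter, one symbol per round, and the iterates live on stack `i + 1`.
  refine of_polyBdd (fun i => (c₀ i).seq <| (pop (i + 0) skip skip (split i)).seq <|
    (loop (i + 0) (c (i + 1)) (c (i + 1))).seq (mv2 (i + 1) (i + 2) (i + 0)))
    (fun m => (m + 2) ^ d₀ + 11 * q m + (q m * ((p m + 2) ^ d + 1)) + 8 * p m + 13)
    (.add (.add (.add (.add ⟨d₀, fun m => le_rfl⟩ (.mul (.const _) hq))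
      (.mul hq (.add (.pow (.add hp (.const _)) _) (.const _)))) (.mul (.const _) hp)) (.const _))
    fun i s x => ?_
  have h1 := hc₀ i s x
  have h2 : Runs (pop (i + 0) skip skip (split i)) (st s i [code (BTree.node (a x) (n x))])
      (st s i [code (n x), code (a x)]) (11 * size (a x) + 5 + 1) := by
    refine Runs.pop_cons (b := true) (l := code (a x) ++ code (n x)) (st_apply s i _ 0) ?_
    rw [st_update _ (by simp)]
    exact Runs.split _ _
  have hloop : ∀ (l : List Bool) (y : BTree), (∀ j ≤ l.length, size (f^[j] y) ≤ p (size x)) →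
      Runs (loop (i + 0) (c (i + 1)) (c (i + 1))) (st s i [l, code y])
        (st s i [[], code (f^[l.length] y)]) (l.length * ((p (size x) + 2) ^ d + 1) + 1) := by
    intro l
    induction l with
    | nil => exact fun y _ => (Runs.loop_nil (st_apply s i _ 0)).mono (by simp)
    | cons b l ih =>
      intro y hy
      have hb : Runs (cond b (c (i + 1)) (c (i + 1)))
          (Function.update (st s i [b :: l, code y]) (i + 0) l)
          (st s i [l, code (f y)]) ((p (size x) + 2) ^ d) := by
        rw [st_update _ (by simp), Bool.cond_self]
        have := hc (i + 1) (Function.update s i l) y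
        rw [← st_cons, ← st_cons] at this
        exact this.mono (Nat.pow_le_pow_left (Nat.add_le_add_right (hy 0 (by simp)) 2) d)
      refine (Runs.loop_cons (st_apply s i _ 0) hb (ih (f y) fun j hj => ?_)).mono ?_
      · exact hy (j + 1) (by simpa using hj)
      · simp only [List.length_cons]; ring_nf; omega
  have h3 := hloop (code (n x)) (a x) (hpb x)
  rw [st_pad2 s i []] at h3
  have h4 : Runs (mv2 (i + 1) (i + 2) (i + 0)) (st s i [[], code (f^[(code (n x)).length] (a x)), []])
    (st s i [code (f^[(code (n x)).length] (a x)) ++ [], [], []])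
    (8 * (code (f^[(code (n x)).length] (a x))).length + 3) :=
    Runs.mv2 1 2 0 (by simp) (by simp) (by simp) (by simp) (by simp) (by simp) rfl
  rw [List.append_nil, ← st_pad2 s i (code _), ← st_pad1] at h4
  refine (h1.seq (h2.seq (h3.seq h4))).mono ?_
  have e1 := hqs x
  rw [size_node] at e1
  have e2 := hpb x _ le_rfl
  change (size x + 2) ^ d₀ + (11 * size (a x) + 5 + 1 + (size (n x) * _ + 1 +
    (8 * size (f^[size (n x)] (a x)) + 3) + 1) + 1) + 1 ≤ _
  have e3 : size (n x) * ((p (size x) + 2) ^ d + 1) ≤ q (size x) * ((p (size x) + 2) ^ d + 1) :=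
    Nat.mul_le_mul_right _ (by omega)
  omega

end FP

namespace FP

/-- Iterating a function with a parameter. -/
theorem iterate_param {g : BTree → BTree → BTree} (hg : FP fun y => g (BTree.car y) (BTree.cdr y))
    {n c a : BTree → BTree} (hn : FP n) (hc : FP c) (ha : FP a) (p : ℕ → ℕ) (hp : PolyBdd p)
    (hpb : ∀ x, ∀ j ≤ size (n x), size ((g (c x))^[j] (a x)) ≤ p (size x)) :
    FP fun x => (g (c x))^[size (n x)] (a x) := by
  set f : BTree → BTree := fun y => .node (BTree.car y) (g (BTree.car y) (BTree.cdr y)) with hf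
  have hfp : FP f := FP.car.node hg
  have hit : ∀ j c a, f^[j] (.node c a) = .node c ((g c)^[j] a) := by
    intro j
    induction j with
    | zero => intros; rfl
    | succ j ih => intro c a; rw [Function.iterate_succ_apply, hf, ← hf, ih]; rfl
  obtain ⟨q, hq, -, hqs⟩ := hc.polyBdd_size
  have key := hfp.iterate hn (hc.node ha) (fun m => q m + p m + 1) ((hq.add hp).add (.const 1))
    fun x j hj => by
      rw [hit, size_node]
      have h1 := hpb x j hj
      have h2 := hqs x
      omega
  have := FP.cdr.comp key
  simpa only [hit, cdr_node] using this

/-- If a round adds at most a constant multiple of the size of the fixed parameter, then `j` rounds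
add at most `j` times as much. All iterates thus stay polynomial, which iteration of a general
function in `FP` does not guarantee. -/
theorem iterate_growth {g : BTree → BTree → BTree} (hg : FP fun y => g (BTree.car y) (BTree.cdr y))
    (K : ℕ) (hK : ∀ c s, size (g c s) ≤ size s + K * size c)
    {n c a : BTree → BTree} (hn : FP n) (hc : FP c) (ha : FP a) :
    FP fun x => (g (c x))^[size (n x)] (a x) := by
  obtain ⟨q, hq, -, hqs⟩ := hc.polyBdd_size
  obtain ⟨r, hr, -, hrs⟩ := hn.polyBdd_size
  obtain ⟨p, hp, -, hps⟩ := ha.polyBdd_size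
  refine iterate_param hg hn hc ha (fun m => p m + r m * (K * q m))
    (hp.add (hr.mul (.mul (.const K) hq))) fun x j hj => ?_
  have : ∀ j, size ((g (c x))^[j] (a x)) ≤ size (a x) + j * (K * size (c x)) := by
    intro j
    induction j with
    | zero => simp
    | succ j ih =>
      rw [Function.iterate_succ_apply']
      refine (hK _ _).trans ?_
      rw [add_mul, one_mul]
      omega
  refine (this j).trans (Nat.add_le_add (hps x) (Nat.mul_le_mul (hj.trans (hrs x)) ?_))
  exact Nat.mul_le_mul_left _ (hqs x)

end FP

namespace BTree

/-- Left fold over the list of left subtrees along the right spine. -/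
def foldT (h : BTree → BTree → BTree) : BTree → BTree → BTree
  | acc, leaf => acc
  | acc, node a r => foldT h (h acc a) r

/-- The tree with the given list of left subtrees along the right spine. -/
def ofList : List BTree → BTree
  | [] => leaf
  | a :: l => node a (ofList l)

@[simp] theorem ofList_nil : ofList [] = leaf := rfl
@[simp] theorem ofList_cons (a l) : ofList (a :: l) = node a (ofList l) := rfl

theorem exists_ofList : ∀ t : BTree, ∃ l, t = ofList l
  | leaf => ⟨[], rfl⟩
  | node a r => let ⟨l, hl⟩ := exists_ofList r; ⟨a :: l, by rw [hl]; rfl⟩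

@[simp] theorem foldT_ofList (h : BTree → BTree → BTree) (l : List BTree) (acc : BTree) :
    foldT h acc (ofList l) = l.foldl h acc := by
  induction l generalizing acc with
  | nil => rfl
  | cons a l ih => exact ih _

end BTree

namespace FP

/-- The hypothesis `hK` allows each entry of the list to contribute its own size only a constant
number of times, so the accumulator remains linear in the list, up to the contribution of the
parameter. -/
theorem foldT {h : BTree → BTree → BTree → BTree}
    (hh : FP fun y => h (BTree.car y) (BTree.car (BTree.cdr y)) (BTree.cdr (BTree.cdr y)))
    (K : ℕ) (hK : ∀ c acc a, size (h c acc a) ≤ size acc + K * (size c + size a))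
    {c init l : BTree → BTree} (hc : FP c) (hi : FP init) (hl : FP l) :
    FP fun x => foldT (h (c x)) (init x) (l x) := by
  -- A state consists of the remaining list and the accumulator. A state with exhausted list is a
  -- fixed point, so running for `size l` rounds, more than the list has entries, does no harm.
  set g : BTree → BTree → BTree := fun c s => BTree.sel (BTree.car s) s
    (.node (BTree.cdr (BTree.car s)) (h c (BTree.cdr s) (BTree.car (BTree.car s)))) with hg
  have hgp : FP fun y => g (BTree.car y) (BTree.cdr y) := by
    have : FP fun y => h (BTree.car y) (BTree.cdr (BTree.cdr y)) (BTree.car (BTree.car (BTree.cdr y))) :=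
      hh.comp (g := fun y => .node (BTree.car y)
        (.node (BTree.cdr (BTree.cdr y)) (BTree.car (BTree.car (BTree.cdr y))))) (by fun_prop)
    exact FP.sel (by fun_prop) (by fun_prop) (FP.node (by fun_prop) this)
  have hsp : ∀ (c l acc : BTree) (j : ℕ), size l ≤ j →
      (g c)^[j] (.node l acc) = .node .leaf (BTree.foldT (h c) acc l) := by
    intro c l
    induction l with
    | leaf =>
      intro acc j _
      exact Function.iterate_fixed rfl j
    | node a r _ ih =>
      intro acc j hj
      obtain ⟨j, rfl⟩ : ∃ j', j = j' + 1 := ⟨j - 1, by simp at hj; omega⟩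
      rw [Function.iterate_succ_apply]
      exact ih _ _ (by simp at hj; omega)
  have hsz : ∀ (c : BTree) (j : ℕ) (s : BTree),
      size ((g c)^[j] s) ≤ (K + 1) * size s + j * (K * size c) := by
    intro c j s
    cases s with
    | leaf => 
      have : (g c)^[j] .leaf = .leaf := Function.iterate_fixed rfl j
      rw [this]; simp
      nlinarith [Nat.zero_le (j * (K * size c))]
    | node l acc =>
      -- The weighted size `(K + 1) * size l + size acc` is a potential: the growth of the
      -- accumulator due to an entry is paid for by the removal of the entry, and only `K * size c`
      -- per round remains.
      have : ∀ j l acc, ∃ l' acc', (g c)^[j] (.node l acc) = .node l' acc' ∧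
          (K + 1) * size l' + size acc' ≤ (K + 1) * size l + size acc + j * (K * size c) := by
        intro j
        induction j with
        | zero => intro l acc; exact ⟨l, acc, rfl, by simp⟩
        | succ j ih =>
          intro l acc
          rw [Function.iterate_succ_apply]
          cases l with
          | leaf =>
            obtain ⟨l', acc', h1, h2⟩ := ih .leaf acc
            refine ⟨l', acc', h1, h2.trans ?_⟩
            exact Nat.add_le_add_left (Nat.mul_le_mul_right _ (by omega)) _
          | node a r =>
            obtain ⟨l', acc', h1, h2⟩ := ih r (h c acc a)
            refine ⟨l', acc', h1, h2.trans ?_⟩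
            have := hK c acc a
            rw [size_node]
            nlinarith
      obtain ⟨l', acc', h1, h2⟩ := this j l acc
      rw [h1, size_node, size_node]
      nlinarith [Nat.zero_le (K * size l'), Nat.zero_le (K * size acc)]
  obtain ⟨q, hq, -, hqs⟩ := hc.polyBdd_size
  obtain ⟨r, hr, -, hrs⟩ := hl.polyBdd_size
  obtain ⟨p, hp, -, hps⟩ := (hl.node hi).polyBdd_size
  have key := iterate_param hgp hl hc (hl.node hi) (fun m => (K + 1) * p m + r m * (K * q m))
    ((PolyBdd.const (K + 1)).mul hp |>.add (hr.mul (.mul (.const K) hq))) fun x j hj =>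
      (hsz _ _ _).trans (Nat.add_le_add (Nat.mul_le_mul_left _ (hps x))
        (Nat.mul_le_mul (hj.trans (hrs x)) (Nat.mul_le_mul_left _ (hqs x))))
  have := FP.cdr.comp key
  simpa only [hsp _ _ _ _ le_rfl, cdr_node] using this

end FP

namespace BTree

/-! ### Lists, numbers and bit strings as trees -/

/-- Reversing the first list onto the second. -/
def revApp (a b : BTree) : BTree := foldT (fun acc x => node x acc) b a

@[simp] theorem revApp_ofList (l m : List BTree) :
    revApp (ofList l) (ofList m) = ofList (l.reverse ++ m) := by
  rw [revApp, foldT_ofList]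
  induction l generalizing m with
  | nil => rfl
  | cons a l ih => rw [List.foldl_cons]; exact (ih (a :: m)).trans (by simp)

@[simp] theorem revApp_ofList_leaf (l : List BTree) :
    revApp (ofList l) leaf = ofList l.reverse := by
  simpa using revApp_ofList l []

/-- Concatenation. -/
def app (a b : BTree) : BTree := revApp (revApp a leaf) b

@[simp] theorem app_ofList (l m : List BTree) : app (ofList l) (ofList m) = ofList (l ++ m) := by
  simp [app]

/-- Unary numbers. -/
def num (k : ℕ) : BTree := ofList (List.replicate k leaf)

@[simp] theorem num_zero : num 0 = leaf := rfl
theorem num_succ (k : ℕ) : num (k + 1) = node leaf (num k) := rfl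

theorem size_num (k : ℕ) : size (num k) = 2 * k + 1 := by
  induction k with
  | zero => rfl
  | succ k ih => rw [num_succ, size_node, ih, size_leaf]; omega

/-- Dropping as many entries as the first list has. -/
def dropT (k l : BTree) : BTree := foldT (fun acc _ => cdr acc) l k

/-- The entry of a list at the position given by a unary number. -/
def nthT (k l : BTree) : BTree := car (dropT k l)

@[simp] theorem dropT_leaf (l : BTree) : dropT leaf l = l := rfl
@[simp] theorem dropT_node (a k l : BTree) : dropT (node a k) l = dropT k (cdr l) := rfl
@[simp] theorem nthT_leaf (l : BTree) : nthT leaf l = car l := rfl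
@[simp] theorem nthT_node (a k l : BTree) : nthT (node a k) l = nthT k (cdr l) := rfl

theorem nthT_num_ofList (k : ℕ) (l : List BTree) : nthT (num k) (ofList l) = l.getD k leaf := by
  induction k generalizing l with
  | zero => cases l <;> rfl
  | succ k ih =>
    rw [num_succ, nthT_node]
    cases l with
    | nil => exact ih []
    | cons a l => exact ih l

/-- The reversed initial segment and the remaining list. -/
def seek (k l : BTree) : BTree :=
  foldT (fun acc _ => node (node (car (cdr acc)) (car acc)) (cdr (cdr acc))) (node leaf l) k

/-- Replacing the entry at the position given by a unary number. -/
def setT (k v l : BTree) : BTree :=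
  revApp (car (seek k l)) (node v (cdr (cdr (seek k l))))

/-- The reversed prefix collected by `seek` is generalised to an arbitrary accumulator; the
recursion equations of `setT` follow. -/
theorem setT_aux (k v l acc : BTree) :
    let r := foldT (fun acc _ => node (node (car (cdr acc)) (car acc)) (cdr (cdr acc)))
      (node acc l) k
    revApp (car r) (node v (cdr (cdr r))) = revApp acc (setT k v l) := by
  induction k generalizing l acc with
  | leaf => rfl
  | node a k _ ih =>
    have h1 := ih (cdr l) (node (car l) acc)
    have h2 := ih (cdr l) (node (car l) leaf)
    have h3 : setT (node a k) v l = revApp (node (car l) leaf) (setT k v (cdr l)) := h2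
    rw [h3]
    exact h1

@[simp] theorem setT_leaf (v l : BTree) : setT leaf v l = node v (cdr l) := rfl

@[simp] theorem setT_node (a k v l : BTree) :
    setT (node a k) v l = node (car l) (setT k v (cdr l)) :=
  setT_aux k v (cdr l) (node (car l) leaf)

/-- No bound on the positions is needed: entries beyond the end read as `leaf`, and `setT` pads the
list with leaves. A list of stacks therefore need not mention empty stacks. -/
theorem nthT_setT (k j : ℕ) (v l : BTree) :
    nthT (num j) (setT (num k) v l) = if j = k then v else nthT (num j) l := by
  induction k generalizing j l with
  | zero => cases j <;> simp [num_succ]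
  | succ k ih => cases j <;> simp [num_succ, ih]

/-- Keeping the size of the replaced entry on the left matters: when a stack is replaced by a
slightly longer one, the total grows only by the difference. -/
theorem size_setT_le (k v l : BTree) :
    size (setT k v l) + size (nthT k l) ≤ size l + size v + 2 * size k := by
  induction k generalizing l with
  | leaf => cases l <;> simp <;> omega
  | node a k _ ih =>
    have := ih (cdr l)
    cases l <;> (simp at *; omega)

/-- Replacing each entry of a list, a unary number, by the corresponding entry of a table. -/
def mapT (tbl l : BTree) : BTree :=
  revApp (foldT (fun acc a => node (nthT a tbl) acc) leaf l) leaf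

theorem mapT_ofList (tbl : BTree) (l : List BTree) :
    mapT tbl (ofList l) = ofList (l.map fun a => nthT a tbl) := by
  have : ∀ (l m : List BTree), l.foldl (fun acc a => node (nthT a tbl) acc) (ofList m) =
      ofList ((l.map fun a => nthT a tbl).reverse ++ m) := by
    intro l
    induction l with
    | nil => intro m; rfl
    | cons a l ih => intro m; rw [List.foldl_cons, ← ofList_cons, ih]; simp
  have h := this l []
  rw [List.append_nil, ofList_nil] at h
  rw [mapT, foldT_ofList, h]
  simp

/-- Truth values: a leaf stands for `false`. -/
def bit (b : Bool) : BTree := num b.toNat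

@[simp] theorem bit_false : bit false = leaf := rfl
@[simp] theorem bit_true : bit true = node leaf leaf := rfl

/-- The truth value of a tree. -/
def isNode : BTree → Bool
  | leaf => false
  | node _ _ => true

@[simp] theorem isNode_leaf : isNode leaf = false := rfl
@[simp] theorem isNode_node (l r) : isNode (node l r) = true := rfl
@[simp] theorem isNode_bit (b : Bool) : isNode (bit b) = b := by cases b <;> rfl

theorem sel_eq_cond (a b c : BTree) : sel a b c = cond (isNode a) c b := by cases a <;> rfl

/-- Bit strings as lists of truth values. -/
def ofBits (l : List Bool) : BTree := ofList (l.map bit)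

@[simp] theorem ofBits_nil : ofBits [] = leaf := rfl
@[simp] theorem ofBits_cons (b l) : ofBits (b :: l) = node (bit b) (ofBits l) := rfl

theorem size_ofBits (l : List Bool) : size (ofBits l) ≤ 4 * l.length + 1 := by
  induction l with
  | nil => simp
  | cons b l ih => cases b <;> simp <;> omega

theorem length_le_size_ofBits (l : List Bool) : l.length ≤ size (ofBits l) := by
  induction l with
  | nil => simp
  | cons b l ih => simp; omega

theorem app_ofBits (l m : List Bool) : app (ofBits l) (ofBits m) = ofBits (l ++ m) := by
  simp [ofBits]

end BTree

namespace FP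

@[fun_prop]
theorem revApp {f g : BTree → BTree} (hf : FP f) (hg : FP g) :
    FP fun x => revApp (f x) (g x) :=
  foldT (h := fun _ acc a => .node a acc) (c := fun _ => .leaf) (by fun_prop) 1
    (fun c acc a => by have := size_pos c; rw [size_node]; omega) (by fun_prop) hg hf

@[fun_prop]
theorem app {f g : BTree → BTree} (hf : FP f) (hg : FP g) : FP fun x => app (f x) (g x) := by
  unfold BTree.app; fun_prop

@[fun_prop]
theorem dropT {f g : BTree → BTree} (hf : FP f) (hg : FP g) :
    FP fun x => dropT (f x) (g x) :=
  foldT (h := fun _ acc _ => BTree.cdr acc) (c := fun _ => .leaf) (by fun_prop) 0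
    (fun c acc a => by simpa using size_cdr_le acc) (by fun_prop) hg hf

@[fun_prop]
theorem nthT {f g : BTree → BTree} (hf : FP f) (hg : FP g) : FP fun x => nthT (f x) (g x) := by
  unfold BTree.nthT; fun_prop

@[fun_prop]
theorem seek {f g : BTree → BTree} (hf : FP f) (hg : FP g) : FP fun x => seek (f x) (g x) :=
  foldT (h := fun _ acc _ => .node (.node (BTree.car (BTree.cdr acc)) (BTree.car acc))
      (BTree.cdr (BTree.cdr acc))) (c := fun _ => .leaf) (by fun_prop) 2
    (fun c acc a => by
      have := size_pos c
      have := size_pos a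
      cases acc with
      | leaf => simp; omega
      | node l r => cases r <;> simp <;> omega) (by fun_prop)
    (by fun_prop) hf

@[fun_prop]
theorem setT {f g h : BTree → BTree} (hf : FP f) (hg : FP g) (hh : FP h) :
    FP fun x => setT (f x) (g x) (h x) := by
  unfold BTree.setT; fun_prop

end FP

namespace BTree

theorem size_dropT_le (k l : BTree) : size (dropT k l) ≤ size l := by
  induction k generalizing l with
  | leaf => exact le_rfl
  | node a k _ ih => exact (ih _).trans (size_cdr_le l)

theorem size_nthT_le (k l : BTree) : size (nthT k l) ≤ size l :=
  (size_car_le _).trans (size_dropT_le k l)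

end BTree

namespace FP

@[fun_prop]
theorem mapT {f g : BTree → BTree} (hf : FP f) (hg : FP g) : FP fun x => mapT (f x) (g x) := by
  have : FP fun x => BTree.foldT (fun acc a => .node (BTree.nthT a (f x)) acc) .leaf (g x) :=
    foldT (h := fun c acc a => .node (BTree.nthT a c) acc) (by fun_prop) 1
      (fun c acc a => by
        have h1 := size_pos a
        have h2 := size_nthT_le a c
        rw [size_node]; omega) hf (by fun_prop) hg
  unfold BTree.mapT
  fun_prop

end FP

/-! ### Parsing, clocks, comparison and increment -/

namespace BTree

/-- The tree described by a list of bits, read as a preorder code. -/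
def parse (l : BTree) : BTree :=
  car (foldT (fun st b => sel b (node leaf st)
    (node (node (car st) (car (cdr st))) (cdr (cdr st)))) leaf (revApp l leaf))

/-- Preorder code is read from right to left with a stack of trees: a leaf is pushed, a node
combines the two topmost trees. Whatever follows the code has been processed earlier and lies deeper
on the stack, so it is ignored. This permits the leading bit `true` that completes a code to the
representation of a number. -/
theorem parse_code (t : BTree) (l : List Bool) : parse (ofBits (code t ++ l)) = t := by
  set h : BTree → BTree → BTree := fun st b => sel b (node leaf st)
    (node (node (car st) (car (cdr st))) (cdr (cdr st))) with hh
  have key : ∀ (t : BTree) (st : BTree),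
      ((code t).map bit).foldr (fun b st => h st b) st = node t st := by
    intro t
    induction t with
    | leaf => intro st; rfl
    | node l r hl hr =>
      intro st
      simp only [code, List.map_cons, List.map_append, List.foldr_cons, List.foldr_append, hr, hl]
      simp [hh]
  have h1 : parse (ofBits (code t ++ l)) =
      car (((code t ++ l).map bit).foldr (fun b st => h st b) leaf) := by
    rw [parse, ofBits, revApp_ofList_leaf, foldT_ofList, List.foldl_reverse]
  rw [h1, List.map_append, List.foldr_append, key, car_node]

/-- The code of a tree as a list of bits. -/
def ser (t : BTree) : BTree := ofBits (code t)

/-- A tree with about the square of the size. -/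
def sq (u : BTree) : BTree := (fun acc => node u acc)^[size u] leaf

theorem size_sq (u : BTree) : size (sq u) = 1 + size u * (size u + 1) := by
  have : ∀ j, size ((fun acc => node u acc)^[j] leaf) = 1 + j * (size u + 1) := by
    intro j
    induction j with
    | zero => simp
    | succ j ih => rw [Function.iterate_succ_apply', size_node, ih]; ring
  exact this _

/-- A tree of size at least `(size x + 2) ^ d`. -/
def clock (d : ℕ) (x : BTree) : BTree := sq^[d] (node leaf x)

/-- Each `sq` at least squares the size, and the initial size is `size x + 2`, so the exponent
reached is `2 ^ d ≥ d`. -/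
theorem le_size_clock (d : ℕ) (x : BTree) : (size x + 2) ^ d ≤ size (clock d x) := by
  have : ∀ d, (size x + 2) ^ (2 ^ d) ≤ size (clock d x) := by
    intro d
    induction d with
    | zero => simp [clock]
    | succ d ih =>
      rw [clock, Function.iterate_succ_apply', size_sq, pow_succ, pow_mul]
      have := Nat.pow_le_pow_left ih 2
      rw [clock] at this
      nlinarith
  exact (Nat.pow_le_pow_right (by omega) Nat.lt_two_pow_self.le).trans (this d)

/-- Negation. -/
def notT (a : BTree) : BTree := sel a (node leaf leaf) leaf

/-- Conjunction. -/
def andT (a b : BTree) : BTree := sel a leaf b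

@[simp] theorem isNode_notT (a : BTree) : isNode (notT a) = !isNode a := by cases a <;> rfl

@[simp] theorem isNode_andT (a b : BTree) : isNode (andT a b) = (isNode a && isNode b) := by
  cases a <;> simp [andT]

/-- One step of the comparison of two lists of bits. -/
def eqStep (acc x : BTree) : BTree :=
  node (sel (cdr acc) (node leaf leaf) (sel x (sel (car (cdr acc)) (car acc) (node leaf leaf))
    (sel (car (cdr acc)) (node leaf leaf) (car acc)))) (cdr (cdr acc))

/-- Equality of lists of bits. -/
def eqT (a b : BTree) : BTree :=
  sel (car (foldT eqStep (node leaf b) a))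
    (sel (cdr (foldT eqStep (node leaf b) a)) (node leaf leaf) leaf) leaf

theorem isNode_eqT (l m : List Bool) : isNode (eqT (ofBits l) (ofBits m)) = decide (l = m) := by
  -- A recorded mismatch, that is a node in the first component, is never erased.
  have bad : ∀ (l : List Bool) (x y r : BTree), ∃ x' y' r',
      foldT eqStep (node (node x y) r) (ofBits l) = node (node x' y') r' := by
    intro l
    induction l with
    | nil => intro x y r; exact ⟨x, y, r, rfl⟩
    | cons b l ih =>
      intro x y r
      rw [ofBits_cons, foldT]
      have : ∃ x' y' r', eqStep (node (node x y) r) (bit b) = node (node x' y') r' := by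
        cases b <;> cases r with
        | leaf => exact ⟨_, _, _, rfl⟩
        | node u v => cases u <;> exact ⟨_, _, _, rfl⟩
      obtain ⟨x', y', r', h⟩ := this
      rw [h]
      exact ih _ _ _
  induction l generalizing m with
  | nil => cases m <;> simp [eqT, foldT]
  | cons b l ih =>
    cases m with
    | nil =>
      obtain ⟨x, y, r, h⟩ := bad l leaf leaf leaf
      have : eqT (ofBits (b :: l)) (ofBits []) = leaf := by
        rw [eqT, ofBits_cons, foldT, ofBits_nil]
        have e : eqStep (node leaf leaf) (bit b) = node (node leaf leaf) leaf := by cases b <;> rfl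
        rw [e, h]; rfl
      rw [this]; simp
    | cons c m =>
      by_cases hbc : b = c
      · subst hbc
        have : eqT (ofBits (b :: l)) (ofBits (b :: m)) = eqT (ofBits l) (ofBits m) := by
          rw [eqT, ofBits_cons b l, foldT, ofBits_cons]
          have e : eqStep (node leaf (node (bit b) (ofBits m))) (bit b) = node leaf (ofBits m) := by
            cases b <;> rfl
          rw [e]; rfl
        rw [this, ih]; simp
      · obtain ⟨x, y, r, h⟩ := bad l leaf leaf (ofBits m)
        have : eqT (ofBits (b :: l)) (ofBits (c :: m)) = leaf := by
          rw [eqT, ofBits_cons b l, foldT, ofBits_cons]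
          have e : eqStep (node leaf (node (bit c) (ofBits m))) (bit b) =
              node (node leaf leaf) (ofBits m) := by
            cases b <;> cases c <;> simp_all [eqStep]
          rw [e, h]; rfl
        rw [this]; simp [hbc]

/-- One step of the increment; the accumulator holds the carry and the reversed result. -/
def incStep (acc b : BTree) : BTree :=
  node (andT (car acc) b) (node (sel (car acc) b (notT b)) (cdr acc))

/-- Increment of a binary number, lowest bit first. -/
def incT (l : BTree) : BTree :=
  revApp (sel (car (foldT incStep (node (node leaf leaf) leaf) l))
    (cdr (foldT incStep (node (node leaf leaf) leaf) l))
    (node (node leaf leaf) (cdr (foldT incStep (node (node leaf leaf) leaf) l)))) leaf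

/-- Increment of a binary number, lowest bit first. -/
def incBits : List Bool → List Bool
  | [] => [true]
  | false :: l => true :: l
  | true :: l => false :: incBits l

theorem encodeNat_succ (n : ℕ) : encodeNat (n + 1) = incBits (encodeNat n) := by
  have hpos : ∀ p : PosNum, encodePosNum p.succ = incBits (encodePosNum p) := by
    intro p
    induction p with
    | one => rfl
    | bit0 p _ => rfl
    | bit1 p ih => simp [PosNum.succ, encodePosNum, incBits, ih]
  unfold encodeNat
  rw [Nat.cast_succ, Num.add_one]
  cases (n : Num) with
  | zero => rfl
  | pos p => exact hpos p

theorem incT_ofBits (l : List Bool) : incT (ofBits l) = ofBits (incBits l) := by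
  have nocarry : ∀ (l : List Bool) (m : List BTree), foldT incStep (node leaf (ofList m)) (ofBits l) =
      node leaf (ofList ((l.map bit).reverse ++ m)) := by
    intro l
    induction l with
    | nil => intro m; rfl
    | cons b l ih =>
      intro m
      rw [ofBits_cons, foldT]
      exact (ih (bit b :: m)).trans (by simp)
  have carry : ∀ (l : List Bool) (m : List BTree),
      let r := foldT incStep (node (node leaf leaf) (ofList m)) (ofBits l)
      sel (car r) (cdr r) (node (node leaf leaf) (cdr r)) =
        ofList (((incBits l).map bit).reverse ++ m) := by
    intro l
    induction l with
    | nil => intro m; rfl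
    | cons b l ih =>
      intro m
      cases b
      · have := nocarry l (node leaf leaf :: m)
        have e : foldT incStep (node (node leaf leaf) (ofList m)) (ofBits (false :: l)) =
          foldT incStep (node leaf (ofList (node leaf leaf :: m))) (ofBits l) := rfl
        simp only [e, this]
        simp [incBits]
      · have := ih (leaf :: m)
        have e : foldT incStep (node (node leaf leaf) (ofList m)) (ofBits (true :: l)) =
          foldT incStep (node (node leaf leaf) (ofList (leaf :: m))) (ofBits l) := rfl
        simp only [e] at this ⊢
        rw [this]
        simp [incBits]
  have := carry l []
  simp only [ofList_nil] at this
  rw [incT, this]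
  simp [ofBits]

theorem length_incBits_le (l : List Bool) : (incBits l).length ≤ l.length + 1 := by
  induction l with
  | nil => simp [incBits]
  | cons b l ih => cases b <;> simp [incBits]; omega

end BTree

namespace FP

@[fun_prop]
theorem parse : FP BTree.parse := by
  have : FP fun x => BTree.foldT (fun st b => BTree.sel b (.node .leaf st)
      (.node (.node (BTree.car st) (BTree.car (BTree.cdr st))) (BTree.cdr (BTree.cdr st))))
      .leaf (BTree.revApp x .leaf) :=
    foldT (h := fun _ st b => BTree.sel b (.node .leaf st)
      (.node (.node (BTree.car st) (BTree.car (BTree.cdr st))) (BTree.cdr (BTree.cdr st))))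
      (c := fun _ => .leaf) (by fun_prop) 2
      (fun c acc a => by
        have := size_pos c
        have := size_pos a
        cases a with
        | leaf => simp; omega
        | node l r =>
          cases acc with
          | leaf => simp; omega
          | node u v => cases v <;> simp <;> omega)
      (by fun_prop) (by fun_prop) (by fun_prop)
  unfold BTree.parse
  fun_prop

-- This is written directly as a program because it works on the code of the argument symbol by
-- symbol: each symbol is replaced by the code of a list cell holding it, and a final `false` closes
-- the list.
@[fun_prop]
theorem ser : FP BTree.ser := by
  open Com in
  refine of_polyBdd (fun i => (trans (i + 0) (i + 1) fun b => (true :: code (bit b)).reverse).seq <|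
    (push (i + 1) false).seq (mv (i + 1) (i + 0))) (fun m => 30 * m + 9)
    (.add (.mul (.const _) .id) (.const _)) fun i s x => ?_
  have hw : ∀ (l acc : List Bool),
      l.foldl (fun acc b => (true :: code (bit b)).reverse ++ acc) acc =
      (l.flatMap fun b => true :: code (bit b)).reverse ++ acc := by
    intro l
    induction l with
    | nil => intro acc; rfl
    | cons b l ih => intro acc; rw [List.foldl_cons, ih]; simp
  have hc : ∀ l : List Bool, code (ofBits l) = (l.flatMap fun b => true :: code (bit b)) ++ [false] := by
    intro l
    induction l with
    | nil => rfl
    | cons b l ih => rw [ofBits_cons, code, ih]; simp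
  have h1 : Com.Runs (Com.trans (i + 0) (i + 1) fun b => (true :: code (bit b)).reverse)
      (Com.st s i [code x, []]) _ _ :=
    Com.Runs.trans (fun b => (true :: code (bit b)).reverse) 4 (by decide) (by simp) (code x) _
      (by simp) (by simp) rfl
  rw [hw] at h1
  have h2 : Com.Runs (Com.push (i + 1) false)
      (Com.st s i [[], ((code x).flatMap fun b => true :: code (bit b)).reverse ++ []])
      (Com.st s i [[], false :: (((code x).flatMap fun b => true :: code (bit b)).reverse ++ [])]) 1 :=
    Com.Runs.push (j := 1) (by simp)
  have h3 : Com.Runs (Com.mv (i + 1) (i + 0))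
      (Com.st s i [[], false :: (((code x).flatMap fun b => true :: code (bit b)).reverse ++ [])])
      (Com.st s i
        [(false :: (((code x).flatMap fun b => true :: code (bit b)).reverse ++ [])).reverse ++ [], []])
      _ := Com.Runs.mv 1 0 (by simp) (by simp) (by simp)
  have e : (false :: (((code x).flatMap fun b => true :: code (bit b)).reverse ++ [])).reverse ++ [] =
      code (ofBits (code x)) := by rw [hc]; simp
  rw [e, ← Com.st_pad1] at h3
  rw [Com.st_pad1]
  refine (h1.seq (h2.seq h3)).mono ?_
  have hlen : ∀ l : List Bool, (l.flatMap fun b => true :: code (bit b)).length ≤ 4 * l.length := by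
    intro l
    induction l with
    | nil => simp
    | cons b l ih => cases b <;> simp [code] at * <;> omega
  have := hlen (code x)
  simp only [List.getD_cons_succ, List.getD_cons_zero, List.length_cons, List.append_nil,
    List.length_reverse]
  unfold size
  omega

@[fun_prop]
theorem sq : FP BTree.sq :=
  iterate_growth (g := fun c s => .node c s) (by fun_prop) 2
    (fun c s => by have := size_pos c; rw [size_node]; omega) FP.id FP.id (const .leaf)

@[fun_prop]
theorem clock (d : ℕ) : FP (BTree.clock d) := by
  induction d with
  | zero => change FP fun x => .node .leaf x; fun_prop
  | succ d ih =>
    have : BTree.clock (d + 1) = fun x => BTree.sq (BTree.clock d x) := by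
      funext x; rw [BTree.clock, Function.iterate_succ_apply']; rfl
    rw [this]
    fun_prop

@[fun_prop]
theorem notT : FP BTree.notT := by unfold BTree.notT; fun_prop

@[fun_prop]
theorem andT {f g : BTree → BTree} (hf : FP f) (hg : FP g) : FP fun x => andT (f x) (g x) := by
  unfold BTree.andT; fun_prop

@[fun_prop]
theorem eqT {f g : BTree → BTree} (hf : FP f) (hg : FP g) : FP fun x => eqT (f x) (g x) := by
  have : FP fun x => BTree.foldT BTree.eqStep (.node .leaf (g x)) (f x) :=
    foldT (h := fun _ acc a => eqStep acc a) (c := fun _ => .leaf)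
      (by unfold eqStep; fun_prop) 3
      (fun c acc a => by
        have := size_pos c
        have := size_pos a
        unfold eqStep
        cases acc with
        | leaf => simp; omega
        | node u v =>
          cases v with
          | leaf => simp; omega
          | node v w => cases a <;> cases v <;> simp <;> omega)
      (by fun_prop) (by fun_prop) hf
  unfold BTree.eqT
  fun_prop

@[fun_prop]
theorem incT : FP BTree.incT := by
  have : FP fun x => BTree.foldT BTree.incStep (.node (.node .leaf .leaf) .leaf) x :=
    foldT (h := fun _ acc a => incStep acc a) (c := fun _ => .leaf)
      (by unfold incStep; fun_prop) 4
      (fun c acc a => by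
        have := size_pos c
        unfold incStep BTree.andT BTree.notT
        cases acc with
        | leaf => simp; omega
        | node u v => cases a <;> cases u <;> simp <;> omega)
      (by fun_prop) (by fun_prop) (by fun_prop)
  unfold BTree.incT
  fun_prop

end FP

/-! ### Runs of stack machines -/

namespace Turing.TM2

section

variable {K : Type} [DecidableEq K] {Γ : K → Type} {Λ σ : Type}

/-- The machine goes from `c` to `c'` in exactly `j` steps. -/
def StepsIn (m : Λ → Stmt Γ Λ σ) (j : ℕ) (c c' : Cfg Γ Λ σ) : Prop :=
  (flip Bind.bind (step m))^[j] (some c) = some c'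

variable {m : Λ → Stmt Γ Λ σ}

theorem StepsIn.trans {i j : ℕ} {a b c : Cfg Γ Λ σ} (h : StepsIn m i a b) (h' : StepsIn m j b c) :
    StepsIn m (i + j) a c := by
  unfold StepsIn at *
  rw [add_comm, Function.iterate_add_apply, h, h']

theorem StepsIn.single {c c' : Cfg Γ Λ σ} (h : step m c = some c') : StepsIn m 1 c c' := h

theorem StepsIn.succ_iff {j : ℕ} {a c : Cfg Γ Λ σ} :
    StepsIn m (j + 1) a c ↔ ∃ b, step m a = some b ∧ StepsIn m j b c := by
  unfold StepsIn
  rw [Function.iterate_succ_apply]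
  change (flip Bind.bind (step m))^[j] (step m a) = _ ↔ _
  cases h : step m a with
  | none =>
    have : (flip Bind.bind (step m))^[j] none = none := Function.iterate_fixed rfl j
    rw [this]
    simp
  | some b => simp

theorem StepsIn.iterate {j : ℕ} {a c : Cfg Γ Λ σ} (h : StepsIn m j a c) :
    (fun c => (step m c).getD c)^[j] a = c := by
  induction j generalizing a with
  | zero => simpa [StepsIn] using h
  | succ j ih =>
    obtain ⟨b, h1, h2⟩ := StepsIn.succ_iff.1 h
    rw [Function.iterate_succ_apply, h1]
    exact ih h2

end

end Turing.TM2

namespace Turing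

theorem initList_stk (tm : FinTM2) (s : List (tm.Γ tm.k₀)) :
    (initList tm s).stk = Function.update (fun _ => []) tm.k₀ s := by
  funext k
  by_cases h : k = tm.k₀
  · subst h; simp [initList]
  · simp [initList, h]

theorem haltList_stk (tm : FinTM2) (s : List (tm.Γ tm.k₁)) :
    (haltList tm s).stk = Function.update (fun _ => []) tm.k₁ s := by
  funext k
  by_cases h : k = tm.k₁
  · subst h; simp [haltList]
  · simp [haltList, h]

/-- The machine `M` outputs `y` on the input `x` in at most `T` steps. -/
def TM2ComputableAux.Outputs {A B : Type} (M : TM2ComputableAux A B) (x : List A) (y : List B)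
    (T : ℕ) : Prop :=
  ∃ j ≤ T, TM2.StepsIn M.tm.m j
    ⟨some M.tm.main, M.tm.initialState,
      Function.update (fun _ => []) M.tm.k₀ (x.map M.inputAlphabet.symm)⟩
    ⟨none, M.tm.initialState,
      Function.update (fun _ => []) M.tm.k₁ (y.map M.outputAlphabet.symm)⟩

theorem TM2ComputableAux.outputs_iff {A B : Type} (M : TM2ComputableAux A B) (x : List A)
    (y : List B) (T : ℕ) : M.Outputs x y T ↔
    Nonempty (TM2OutputsInTime M.tm (x.map M.inputAlphabet.symm)
      (some (y.map M.outputAlphabet.symm)) T) := by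
  have hi : initList M.tm (x.map M.inputAlphabet.symm) = ⟨some M.tm.main, M.tm.initialState,
      Function.update (fun _ => []) M.tm.k₀ (x.map M.inputAlphabet.symm)⟩ := by
    rw [← initList_stk]; rfl
  have hh : haltList M.tm (y.map M.outputAlphabet.symm) = ⟨none, M.tm.initialState,
      Function.update (fun _ => []) M.tm.k₁ (y.map M.outputAlphabet.symm)⟩ := by
    rw [← haltList_stk]; rfl
  constructor
  · rintro ⟨j, hj, h⟩
    rw [← hi, ← hh] at h
    exact ⟨⟨⟨j, h⟩, hj⟩⟩
  · rintro ⟨⟨⟨j, h⟩, hj⟩⟩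
    refine ⟨j, hj, ?_⟩
    rw [← hi, ← hh]
    exact h

/-! ### Restriction to finite alphabets -/

section Restrict

open TM2

variable {K : Type} {Γ : K → Type} {Λ σ : Type}

/-- The symbols that a statement may push. -/
def TM2.Stmt.pushed : TM2.Stmt Γ Λ σ → Set (Σ k, Γ k)
  | .push k f q => Set.range (fun v => (⟨k, f v⟩ : Σ k, Γ k)) ∪ pushed q
  | .peek _ _ q => pushed q
  | .pop _ _ q => pushed q
  | .load _ q => pushed q
  | .branch _ q₁ q₂ => pushed q₁ ∪ pushed q₂
  | .goto _ => ∅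
  | .halt => ∅

theorem TM2.Stmt.finite_pushed [Finite σ] (q : TM2.Stmt Γ Λ σ) : q.pushed.Finite := by
  induction q with
  | push k f q ih => exact (Set.finite_range _).union ih
  | peek _ _ _ ih => exact ih
  | pop _ _ _ ih => exact ih
  | load _ _ ih => exact ih
  | branch _ _ _ ih₁ ih₂ => exact ih₁.union ih₂
  | goto _ => exact Set.finite_empty
  | halt => exact Set.finite_empty

variable (U : ∀ k, Set (Γ k))

/-- A statement as a statement over smaller alphabets. -/
def TM2.Stmt.restrict : (q : TM2.Stmt Γ Λ σ) → (∀ p ∈ q.pushed, p.2 ∈ U p.1) →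
    TM2.Stmt (fun k => U k) Λ σ
  | .push k f q, h => .push k (fun v => ⟨f v, h ⟨k, f v⟩ (Or.inl ⟨v, rfl⟩)⟩)
      (restrict q fun p hp => h p (Or.inr hp))
  | .peek k f q, h => .peek k (fun v o => f v (o.map Subtype.val)) (restrict q h)
  | .pop k f q, h => .pop k (fun v o => f v (o.map Subtype.val)) (restrict q h)
  | .load a q, h => .load a (restrict q h)
  | .branch p q₁ q₂, h => .branch p (restrict q₁ fun p hp => h p (Or.inl hp))
      (restrict q₂ fun p hp => h p (Or.inr hp))
  | .goto l, _ => .goto l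
  | .halt, _ => .halt

/-- Stacks over the smaller alphabets as stacks over the larger ones. -/
def inclStk (S : ∀ k, List (U k)) : ∀ k, List (Γ k) := fun k => (S k).map Subtype.val

theorem inclStk_injective : Function.Injective (inclStk U) := fun S S' h => by
  funext k
  exact (List.map_injective_iff.2 Subtype.val_injective) (congrFun h k)

theorem inclStk_update [DecidableEq K] (S : ∀ k, List (U k)) (k : K) (l : List (U k)) :
    inclStk U (Function.update S k l) = Function.update (inclStk U S) k (l.map Subtype.val) := by
  funext j
  by_cases h : j = k
  · subst h; simp [inclStk]
  · simp [inclStk, h]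

/-- Configurations over the smaller alphabets as configurations over the larger ones. -/
def inclCfg (c : TM2.Cfg (fun k => U k) Λ σ) : TM2.Cfg Γ Λ σ := ⟨c.l, c.var, inclStk U c.stk⟩

theorem inclCfg_injective : Function.Injective (inclCfg (Λ := Λ) (σ := σ) U) := by
  rintro ⟨l, v, S⟩ ⟨l', v', S'⟩ h
  simp only [inclCfg, TM2.Cfg.mk.injEq] at h
  obtain ⟨rfl, rfl, h⟩ := h
  rw [inclStk_injective U h]

theorem inclCfg_stepAux [DecidableEq K] (q : TM2.Stmt Γ Λ σ) (h : ∀ p ∈ q.pushed, p.2 ∈ U p.1)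
    (v : σ) (S : ∀ k, List (U k)) :
    inclCfg U (TM2.stepAux (q.restrict U h) v S) = TM2.stepAux q v (inclStk U S) := by
  induction q generalizing v S with
  | push k f q ih =>
    simp only [TM2.Stmt.restrict, TM2.stepAux, ih, inclStk_update, List.map_cons]
    rfl
  | peek k f q ih =>
    refine (ih h _ _).trans ?_
    rw [TM2.stepAux, inclStk, List.head?_map]
  | pop k f q ih =>
    refine (ih h _ _).trans ?_
    rw [TM2.stepAux, inclStk_update, inclStk, List.head?_map, List.map_tail]
  | load a q ih => exact ih h _ _
  | branch p q₁ q₂ ih₁ ih₂ =>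
    simp only [TM2.Stmt.restrict, TM2.stepAux]
    cases p v
    · simpa using ih₂ _ _ _
    · simpa using ih₁ _ _ _
  | goto l => rfl
  | halt => rfl

end Restrict

/-- Every machine can be replaced by one all of whose stack alphabets are finite. -/
theorem TM2ComputableAux.exists_finite_alphabets {A B : Type} [Finite B]
    (M : TM2ComputableAux A B) : ∃ M' : TM2ComputableAux A B, (∀ k, Finite (M'.tm.Γ k)) ∧
      ∀ x y T, M.Outputs x y T → M'.Outputs x y T := by
  obtain ⟨tm, ia, oa⟩ := M
  obtain @⟨K, iK, iF, k₀, k₁, Γ, Λ, main, iΛ, σ, s₀, iσ, iΓ, m⟩ := tm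
  change Γ k₀ ≃ A at ia
  change Γ k₁ ≃ B at oa
  have : Finite (Γ k₁) := Finite.of_equiv _ oa.symm
  -- A finite alphabet is kept whole; from an infinite one only the symbols that some statement can
  -- push are kept. These are finitely many, as there are finitely many labels and states. The
  -- alphabets of the input and output stacks are finite and hence unchanged.
  let U : ∀ k, Set (Γ k) :=
    fun k => {a | Finite (Γ k) ∨ ∃ l, (⟨k, a⟩ : Σ k, Γ k) ∈ (m l).pushed}
  have hU : ∀ k, Finite (U k) := by
    intro k
    by_cases hk : Finite (Γ k)
    · infer_instance
    · have : (U k) ⊆ (Sigma.mk k) ⁻¹' (⋃ l, (m l).pushed) := by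
        rintro a (h | ⟨l, h⟩)
        · exact absurd h hk
        · exact Set.mem_iUnion.2 ⟨l, h⟩
      exact (Set.Finite.subset (Set.Finite.preimage sigma_mk_injective.injOn
        (Set.finite_iUnion fun l => (m l).finite_pushed)) this).to_subtype
  have hm : ∀ l, ∀ p ∈ (m l).pushed, p.2 ∈ U p.1 := fun l p hp => Or.inr ⟨l, hp⟩
  let e₀ : U k₀ ≃ Γ k₀ := Equiv.subtypeUnivEquiv fun a => Or.inl inferInstance
  let e₁ : U k₁ ≃ Γ k₁ := Equiv.subtypeUnivEquiv fun a => Or.inl inferInstance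
  have := Fintype.ofFinite (U k₀)
  let tm' : FinTM2 := @FinTM2.mk K iK iF k₀ k₁ (fun k => U k) Λ main iΛ σ s₀ iσ this
    (fun l => (m l).restrict U (hm l))
  refine ⟨⟨tm', e₀.trans ia, e₁.trans oa⟩, hU, ?_⟩
  rintro x y T ⟨j, hj, h⟩
  refine ⟨j, hj, ?_⟩
  have key : ∀ (j : ℕ) (c : TM2.Cfg (fun k => U k) Λ σ) (d : TM2.Cfg Γ Λ σ),
      TM2.StepsIn m j (inclCfg U c) d →
      ∃ c', TM2.StepsIn (fun l => (m l).restrict U (hm l)) j c c' ∧ inclCfg U c' = d := by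
    intro j
    induction j with
    | zero => exact fun c d h => ⟨c, rfl, by simpa [TM2.StepsIn] using h⟩
    | succ j ih =>
      intro c d h
      obtain ⟨b, h1, h2⟩ := TM2.StepsIn.succ_iff.1 h
      obtain ⟨l, v, S⟩ := c
      cases l with
      | none => simp [inclCfg] at h1
      | some l =>
        simp only [inclCfg, TM2.step, Option.some.injEq] at h1
        rw [← inclCfg_stepAux U (m l) (hm l) v S] at h1
        subst h1
        obtain ⟨c', h3, h4⟩ := ih _ _ h2
        exact ⟨c', TM2.StepsIn.succ_iff.2 ⟨_, rfl, h3⟩, h4⟩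
  have e1 : ∀ k (l : List (U k)), Function.update (fun _ => []) k (l.map Subtype.val) =
      inclStk U (Function.update (fun _ => []) k l) := by
    intro k l
    rw [inclStk_update]
    rfl
  have e2 : x.map ia.symm = (x.map (e₀.trans ia).symm).map Subtype.val := by
    rw [List.map_map]; rfl
  have e3 : y.map oa.symm = (y.map (e₁.trans oa).symm).map Subtype.val := by
    rw [List.map_map]; rfl
  change TM2.StepsIn m j ⟨some main, s₀, Function.update (fun _ => []) k₀ (x.map ia.symm)⟩
    ⟨none, s₀, Function.update (fun _ => []) k₁ (y.map oa.symm)⟩ at h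
  rw [e2, e3, e1, e1] at h
  obtain ⟨c', h3, h4⟩ := key j ⟨some main, s₀,
    Function.update (fun _ => []) k₀ (x.map (e₀.trans ia).symm)⟩ _ h
  have : c' = ⟨none, s₀, Function.update (fun _ => []) k₁ (y.map (e₁.trans oa).symm)⟩ :=
    inclCfg_injective U h4
  rw [← this]
  exact h3

end Turing

namespace BTree

/-! ### Universal simulation of stack machines -/

/-- The new content of a stack after an action: a leaf pops, a node with an empty left subtree
keeps the stack, and any other node pushes its left subtree. -/
def actT (act s : BTree) : BTree := sel act (cdr s) (sel (car act) s (node (car act) s))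

/-- One step of the machine with transition table `tbl` on the configuration `c`, which consists of
the current state and the list of stacks. The entry of a state holds a stack and, for each possible
top symbol of that stack, the next state and an action on the stack. -/
def stepT (tbl c : BTree) : BTree :=
  node (car (nthT (car (nthT (car (nthT (car c) tbl)) (cdr c))) (cdr (nthT (car c) tbl))))
    (setT (car (nthT (car c) tbl))
      (actT (cdr (nthT (car (nthT (car (nthT (car c) tbl)) (cdr c))) (cdr (nthT (car c) tbl))))
        (nthT (car (nthT (car c) tbl)) (cdr c))) (cdr c))

/-- Running the machine with transition table `tbl` for `size t` steps. -/
def simT (tbl c t : BTree) : BTree := (stepT tbl)^[size t] c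

theorem size_actT_le (act s : BTree) : size (actT act s) ≤ size s + size act := by
  unfold actT
  cases act with
  | leaf => have := size_cdr_le s; simp; omega
  | node a b => cases a <;> simp; omega

/-- Only one stack changes, and the next state as well as a pushed symbol are subtrees of the table.
So a step adds an amount linear in the table alone, and `iterate_growth` makes the universal
simulation polynomial. -/
theorem size_stepT_le (tbl c : BTree) : size (stepT tbl c) ≤ size c + 5 * size tbl := by
  set ins := nthT (car c) tbl with hins
  set s := nthT (car ins) (cdr c) with hs
  set br := nthT (car s) (cdr ins) with hbr
  have h0 : stepT tbl c = node (car br) (setT (car ins) (actT (cdr br) s) (cdr c)) := rfl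
  have h1 : size ins ≤ size tbl := size_nthT_le _ _
  have h2 : size br ≤ size ins := (size_nthT_le _ _).trans (size_cdr_le _)
  have h3 := size_setT_le (car ins) (actT (cdr br) s) (cdr c)
  rw [← hs] at h3
  have h4 := size_actT_le (cdr br) s
  have h5 := size_car_le ins
  have h6 : size (car br) + size (cdr br) ≤ size br + 1 := by cases br <;> simp; omega
  have h7 : size (cdr c) ≤ size c := size_cdr_le c
  have h8 := size_pos tbl
  rw [h0, size_node]
  omega

end BTree

namespace FP

@[fun_prop]
theorem stepT {f g : BTree → BTree} (hf : FP f) (hg : FP g) : FP fun x => stepT (f x) (g x) := by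
  unfold BTree.stepT actT; fun_prop

@[fun_prop]
theorem simT {f g h : BTree → BTree} (hf : FP f) (hg : FP g) (hh : FP h) :
    FP fun x => simT (f x) (g x) (h x) :=
  iterate_growth (g := BTree.stepT) (by fun_prop) 5 size_stepT_le hh hf hg

end FP

/-! ### Transition tables of stack machines -/

namespace Turing.TM2

section Symbols

variable {K : Type} {Γ : K → Type} [∀ k, Fintype (Γ k)]

/-- The code of an optional stack symbol. -/
def symT (k : K) : Option (Γ k) → BTree
  | none => leaf
  | some a => num ((Fintype.equivFin (Γ k) a : ℕ) + 1)

/-- The table of a function of an optional stack symbol. -/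
def brs (k : K) (F : Option (Γ k) → BTree) : BTree :=
  node (F none) (ofList (List.ofFn fun i => F (some ((Fintype.equivFin (Γ k)).symm i))))

theorem nthT_brs (k : K) (F : Option (Γ k) → BTree) (o : Option (Γ k)) :
    nthT (symT k o) (brs k F) = F o := by
  cases o with
  | none => rfl
  | some a =>
    rw [symT, brs, num_succ, nthT_node, cdr_node, nthT_num_ofList,
      List.getD_eq_getElem _ _ (by simp)]
    simp

end Symbols

variable {K : Type} [DecidableEq K] {Γ : K → Type} {Λ σ : Type}

/-- Execution of a single instruction of a statement. -/
def microStep (m : Λ → Stmt Γ Λ σ) : (Option (Stmt Γ Λ σ) × σ) × (∀ k, List (Γ k)) →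
    (Option (Stmt Γ Λ σ) × σ) × (∀ k, List (Γ k))
  | ((none, v), S) => ((none, v), S)
  | ((some (.push k f q), v), S) => ((some q, v), Function.update S k (f v :: S k))
  | ((some (.peek k f q), v), S) => ((some q, f v (S k).head?), S)
  | ((some (.pop k f q), v), S) => ((some q, f v (S k).head?), Function.update S k (S k).tail)
  | ((some (.load a q), v), S) => ((some q, a v), S)
  | ((some (.branch p q₁ q₂), v), S) => ((some (cond (p v) q₁ q₂), v), S)
  | ((some (.goto l), v), S) => ((some (m (l v)), v), S)
  | ((some .halt, v), S) => ((none, v), S)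

/-- The number of instructions on the longest path through a statement. -/
def Stmt.depth : Stmt Γ Λ σ → ℕ
  | .push _ _ q => depth q + 1
  | .peek _ _ q => depth q + 1
  | .pop _ _ q => depth q + 1
  | .load _ q => depth q + 1
  | .branch _ q₁ q₂ => max (depth q₁) (depth q₂) + 1
  | .goto _ => 1
  | .halt => 1

/-- A configuration before the execution of the first instruction of the current statement. -/
def Cfg.toMicro (m : Λ → Stmt Γ Λ σ) (c : Cfg Γ Λ σ) :
    (Option (Stmt Γ Λ σ) × σ) × (∀ k, List (Γ k)) := ((c.l.map m, c.var), c.stk)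

/-- A machine step executes a whole statement, while a table entry describes a single instruction.
How many instructions a statement takes depends on the branches chosen, so only the bound by its
depth is claimed. -/
theorem microStep_stepAux (m : Λ → Stmt Γ Λ σ) (q : Stmt Γ Λ σ) (v : σ) (S : ∀ k, List (Γ k)) :
    ∃ j ≤ q.depth, (microStep m)^[j] ((some q, v), S) = (stepAux q v S).toMicro m := by
  have lift : ∀ {q q' : Stmt Γ Λ σ} {v v' S S'} {c : Cfg Γ Λ σ} {d : ℕ},
      microStep m ((some q, v), S) = ((some q', v'), S') →
      (∃ j ≤ d, (microStep m)^[j] ((some q', v'), S') = c.toMicro m) →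
      ∃ j ≤ d + 1, (microStep m)^[j] ((some q, v), S) = c.toMicro m := by
    rintro q q' v v' S S' c d h ⟨j, hj, e⟩
    exact ⟨j + 1, by omega, by rw [Function.iterate_succ_apply, h, e]⟩
  induction q generalizing v S with
  | push k f q ih => exact lift rfl (ih _ _)
  | peek k f q ih => exact lift rfl (ih _ _)
  | pop k f q ih => exact lift rfl (ih _ _)
  | load a q ih => exact lift rfl (ih _ _)
  | branch p q₁ q₂ ih₁ ih₂ =>
    refine lift (q' := cond (p v) q₁ q₂) (v' := v) (S' := S) rfl ?_
    rw [stepAux]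
    cases p v
    · obtain ⟨j, hj, e⟩ := ih₂ v S
      exact ⟨j, hj.trans (le_max_right _ _), e⟩
    · obtain ⟨j, hj, e⟩ := ih₁ v S
      exact ⟨j, hj.trans (le_max_left _ _), e⟩
  | goto l => exact ⟨1, le_rfl, rfl⟩
  | halt => exact ⟨1, le_rfl, rfl⟩

theorem StepsIn.micro {m : Λ → Stmt Γ Λ σ} {B : ℕ} (hB : ∀ l, (m l).depth ≤ B) {j : ℕ}
    {c c' : Cfg Γ Λ σ} (h : StepsIn m j c c') :
    ∃ i ≤ B * j, (microStep m)^[i] (c.toMicro m) = c'.toMicro m := by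
  induction j generalizing c with
  | zero =>
    have : c = c' := by simpa [StepsIn] using h
    exact ⟨0, by simp, by rw [this]; rfl⟩
  | succ j ih =>
    obtain ⟨b, h1, h2⟩ := StepsIn.succ_iff.1 h
    obtain ⟨i, hi, e⟩ := ih h2
    obtain ⟨l, v, S⟩ := c
    cases l with
    | none => simp at h1
    | some l =>
      obtain ⟨i', hi', e'⟩ := microStep_stepAux m (m l) v S
      simp only [step, Option.some.injEq] at h1
      rw [h1] at e'
      refine ⟨i + i', ?_, ?_⟩
      · have := hB l
        rw [mul_add, mul_one]; omega
      · rw [Function.iterate_add_apply]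
        exact (congrArg _ e').trans e

section Table

variable [∀ k, Fintype (Γ k)]

variable (m : Λ → Stmt Γ Λ σ) (k₀ : K) (kx : K → ℕ) (pc : Option (Stmt Γ Λ σ) × σ → BTree)

/-- The entry of the transition table for the next instruction. -/
def entry : Option (Stmt Γ Λ σ) × σ → BTree
  | (none, v) => node (num (kx k₀)) (brs (Γ := Γ) k₀ fun _ => node (pc (none, v)) (node leaf leaf))
  | (some (.push k f q), v) =>
    node (num (kx k)) (brs (Γ := Γ) k fun _ => node (pc (some q, v)) (node (symT k (some (f v))) leaf))
  | (some (.peek k f q), v) =>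
    node (num (kx k)) (brs (Γ := Γ) k fun o => node (pc (some q, f v o)) (node leaf leaf))
  | (some (.pop k f q), v) => node (num (kx k)) (brs (Γ := Γ) k fun o => node (pc (some q, f v o)) leaf)
  | (some (.load a q), v) =>
    node (num (kx k₀)) (brs (Γ := Γ) k₀ fun _ => node (pc (some q, a v)) (node leaf leaf))
  | (some (.branch p q₁ q₂), v) => node (num (kx k₀))
      (brs (Γ := Γ) k₀ fun _ => node (pc (some (cond (p v) q₁ q₂), v)) (node leaf leaf))
  | (some (.goto l), v) =>
    node (num (kx k₀)) (brs (Γ := Γ) k₀ fun _ => node (pc (some (m (l v)), v)) (node leaf leaf))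
  | (some .halt, v) =>
    node (num (kx k₀)) (brs (Γ := Γ) k₀ fun _ => node (pc (none, v)) (node leaf leaf))

/-- The tree of a stack. -/
def stkT (k : K) (l : List (Γ k)) : BTree := ofList (l.map fun a => symT k (some a))

/-- The tree `c` represents the given instruction, state and stacks. -/
def Represents (q : (Option (Stmt Γ Λ σ) × σ) × (∀ k, List (Γ k))) (c : BTree) : Prop :=
  ∃ ST, c = node (pc q.1) ST ∧ ∀ k, nthT (num (kx k)) ST = stkT k (q.2 k)

variable {m k₀ kx pc}

/-- All instructions share one form: inspect the top of one stack, change the state, act on that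
stack. Instructions that do not modify a stack fit in with the action that keeps it, and those that
concern none inspect `k₀`. -/
theorem represents_stepT_of_entry (hkx : Function.Injective kx) {tbl c : BTree}
    {q q' : Option (Stmt Γ Λ σ) × σ} {S : ∀ k, List (Γ k)} {k : K} {F : Option (Γ k) → BTree}
    {act : BTree} {l : List (Γ k)} (h : Represents kx pc (q, S) c)
    (he : nthT (pc q) tbl = node (num (kx k)) (brs k F))
    (hF : F (S k).head? = node (pc q') act) (hl : actT act (stkT k (S k)) = stkT k l) :
    Represents kx pc (q', Function.update S k l) (stepT tbl c) := by
  obtain ⟨ST, rfl, hST⟩ := h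
  have hhd : car (stkT k (S k)) = symT k (S k).head? := by
    cases hk : S k with
    | nil => rfl
    | cons a s => rfl
  refine ⟨setT (num (kx k)) (stkT k l) ST, ?_, ?_⟩
  · simp only [stepT, car_node, cdr_node, he, hST]
    rw [hhd, nthT_brs, hF]
    simp only [car_node, cdr_node, hl]
  · intro j
    rw [nthT_setT]
    by_cases hj : j = k
    · subst hj; simp
    · rw [if_neg (fun h => hj (hkx h)), hST]
      simp [hj]

theorem represents_stepT (hkx : Function.Injective kx) {tbl c : BTree}
    {q : (Option (Stmt Γ Λ σ) × σ) × (∀ k, List (Γ k))} (h : Represents kx pc q c)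
    (he : nthT (pc q.1) tbl = entry m k₀ kx pc q.1) :
    Represents kx pc (microStep m q) (stepT tbl c) := by
  obtain ⟨⟨q, v⟩, S⟩ := q
  have keep : ∀ (q' : Option (Stmt Γ Λ σ) × σ) (k : K) (F : Option (Γ k) → BTree),
      nthT (pc (q, v)) tbl = node (num (kx k)) (brs k F) →
      F (S k).head? = node (pc q') (node leaf leaf) → Represents kx pc (q', S) (stepT tbl c) := by
    intro q' k F h1 h2
    have := represents_stepT_of_entry hkx (l := S k) h h1 h2 rfl
    rwa [Function.update_eq_self] at this
  cases q with
  | none => exact keep _ _ _ he rfl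
  | some q =>
    cases q with
    | push k f q => exact represents_stepT_of_entry hkx h he rfl rfl
    | peek k f q => exact keep _ _ _ he rfl
    | pop k f q =>
      refine represents_stepT_of_entry hkx h he rfl ?_
      cases S k <;> rfl
    | load a q => exact keep _ _ _ he rfl
    | branch p q₁ q₂ => exact keep _ _ _ he rfl
    | goto l => exact keep _ _ _ he rfl
    | halt => exact keep _ _ _ he rfl

end Table

open scoped Classical in
-- The finite set of statements occurring in the program is closed under single instructions, so a
-- finite table has an entry for every state that is reached.
theorem microStep_mem_stmts [Fintype Λ] (m : Λ → Stmt Γ Λ σ)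
    (q : (Option (Stmt Γ Λ σ) × σ) × (∀ k, List (Γ k))) (h : q.1.1 ∈ stmts m Finset.univ) :
    (microStep m q).1.1 ∈ stmts m Finset.univ := by
  obtain ⟨⟨q, v⟩, S⟩ := q
  cases q with
  | none => exact h
  | some q =>
    cases q with
    | push k f q => exact stmts_trans (by simp [stmts₁, stmts₁_self]) h
    | peek k f q => exact stmts_trans (by simp [stmts₁, stmts₁_self]) h
    | pop k f q => exact stmts_trans (by simp [stmts₁, stmts₁_self]) h
    | load a q => exact stmts_trans (by simp [stmts₁, stmts₁_self]) h
    | branch p q₁ q₂ =>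
      refine stmts_trans (q₂ := .branch p q₁ q₂) ?_ h
      cases p v <;> simp [stmts₁, stmts₁_self]
    | goto l =>
      simp only [microStep, stmts, Finset.mem_insertNone, Option.mem_def, Option.some.injEq,
        Finset.mem_biUnion, Finset.mem_univ, true_and]
      rintro _ rfl
      exact ⟨_, stmts₁_self⟩
    | halt => simp [microStep, stmts]

end Turing.TM2

/-- Every machine is simulated by a transition table. The input stack is the first one, the output
is found on the stack `ko` and is translated into bits by the table `tb`. -/
theorem Turing.TM2ComputableAux.exists_table {A : Type} (M : TM2ComputableAux A Bool) :
    ∃ (tbl pc ko tb : BTree) (sym : A → BTree) (B : ℕ), ∀ x y T, M.Outputs x y T →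
      ∀ t : BTree, B * T ≤ size t →
        mapT tb (nthT ko (cdr (simT tbl (node pc (node (ofList (x.map sym)) leaf)) t))) =
          ofBits y := by
  classical
  obtain ⟨M, hfin, hM⟩ := M.exists_finite_alphabets
  suffices H : ∃ (tbl pc ko tb : BTree) (sym : A → BTree) (B : ℕ), ∀ x y T, M.Outputs x y T →
      ∀ t : BTree, B * T ≤ size t →
        mapT tb (nthT ko (cdr (simT tbl (node pc (node (ofList (x.map sym)) leaf)) t))) =
          ofBits y by
    obtain ⟨tbl, pc, ko, tb, sym, B, H⟩ := H
    exact ⟨tbl, pc, ko, tb, sym, B, fun x y T h => H x y T (hM x y T h)⟩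
  clear hM
  obtain ⟨tm, ia, oa⟩ := M
  obtain @⟨K, iK, iF, k₀, k₁, Γ, Λ, main, iΛ, σ, s₀, iσ, iΓ, m⟩ := tm
  change Γ k₀ ≃ A at ia
  change Γ k₁ ≃ Bool at oa
  change ∀ k, Finite (Γ k) at hfin
  have := fun k => Fintype.ofFinite (Γ k)
  -- With the input stack at position 0, the initial list of stacks needs only this entry; the
  -- missing ones read as empty stacks.
  let kx : K → ℕ := fun k => if k = k₀ then 0 else (Fintype.equivFin K k : ℕ) + 1
  have hkx : Function.Injective kx := by
    intro a b h
    simp only [kx] at h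
    split_ifs at h with h1 h2 h2
    · rw [h1, h2]
    · simpa [Fin.val_inj] using h
  let Q : List (Option (TM2.Stmt Γ Λ σ) × σ) := (TM2.stmts m Finset.univ ×ˢ Finset.univ).toList
  let pc : Option (TM2.Stmt Γ Λ σ) × σ → BTree := fun q => num (Q.idxOf q)
  let tbl : BTree := ofList (Q.map (TM2.entry m k₀ kx pc))
  have hQ : ∀ q, q ∈ Q ↔ q.1 ∈ TM2.stmts m Finset.univ := by
    intro q; simp [Q]
  have htbl : ∀ q ∈ Q, nthT (pc q) tbl = TM2.entry m k₀ kx pc q := by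
    intro q hq
    have hlt := List.idxOf_lt_length_of_mem hq
    rw [nthT_num_ofList, List.getD_eq_getElem _ _ (by simpa using hlt)]
    simp
  let tb : BTree := TM2.brs k₁ fun o => bit ((o.map oa).getD false)
  let B := Finset.univ.sup fun l => (m l).depth
  have hB : ∀ l, (m l).depth ≤ B := fun l => Finset.le_sup (f := fun l => (m l).depth) (by simp)
  refine ⟨tbl, pc (some (m main), s₀), num (kx k₁), tb,
    fun a => TM2.symT k₀ (some (ia.symm a)), B, ?_⟩
  rintro x y T ⟨j, hj, h⟩ t ht
  change TM2.StepsIn m j ⟨some main, s₀, Function.update (fun _ => []) k₀ (x.map ia.symm)⟩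
    ⟨none, s₀, Function.update (fun _ => []) k₁ (y.map oa.symm)⟩ at h
  obtain ⟨i, hi, e⟩ := h.micro hB
  -- A halted machine is a fixed point of `microStep`, so any clock of size at least `B * T` shows
  -- the final configuration.
  have e' : (TM2.microStep m)^[size t] ((some (m main), s₀),
      Function.update (fun _ => []) k₀ (x.map ia.symm)) =
      ((none, s₀), Function.update (fun _ => []) k₁ (y.map oa.symm)) := by
    obtain ⟨r, hr⟩ : ∃ r, size t = r + i := ⟨size t - i, by
      have := hi.trans ((Nat.mul_le_mul_left B hj).trans ht); omega⟩
    rw [hr, Function.iterate_add_apply]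
    exact (congrArg _ e).trans (Function.iterate_fixed rfl r)
  have hmain : (some (m main), s₀) ∈ Q := by
    rw [hQ]
    simp only [TM2.stmts, Finset.mem_insertNone, Option.mem_def, Option.some.injEq,
      Finset.mem_biUnion, Finset.mem_univ, true_and]
    rintro _ rfl
    exact ⟨_, TM2.stmts₁_self⟩
  have key : ∀ r, let q := (TM2.microStep m)^[r] ((some (m main), s₀),
        Function.update (fun _ => []) k₀ (x.map ia.symm))
      q.1 ∈ Q ∧ TM2.Represents kx pc q ((stepT tbl)^[r] (node (pc (some (m main), s₀))
        (node (ofList (x.map fun a => TM2.symT k₀ (some (ia.symm a)))) leaf))) := by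
    intro r
    induction r with
    | zero =>
      refine ⟨hmain, _, rfl, fun k => ?_⟩
      by_cases hk : k = k₀
      · subst hk
        simp [kx, TM2.stkT, Function.comp_def]
      · have : kx k = (Fintype.equivFin K k : ℕ) + 1 := if_neg hk
        have hl : ∀ n : ℕ, nthT (num n) leaf = leaf := fun n => by
          simpa using nthT_num_ofList n []
        simp [this, num_succ, hl, hk, TM2.stkT]
    | succ r ih =>
      simp only [Function.iterate_succ_apply']
      refine ⟨?_, TM2.represents_stepT hkx ih.2 (htbl _ ih.1)⟩
      rw [hQ]
      exact TM2.microStep_mem_stmts m _ ((hQ _).1 ih.1)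
  obtain ⟨-, ST, hc, hST⟩ := key (size t)
  rw [simT, hc, cdr_node, hST, e', TM2.stkT, mapT_ofList, ofBits]
  simp [tb, TM2.nthT_brs, Function.comp_def]

/-- The words over the alphabet of an encoding can be computed from the trees `r a`. -/
def Readable {α A : Type} (ea : Encoding α A) (r : α → BTree) : Prop :=
  ∀ sym : A → BTree, ∃ inp, FP inp ∧ ∀ a, inp (r a) = ofList ((ea.encode a).map sym)

theorem readable_bits {α : Type} (ea : Encoding α Bool) :
    Readable ea fun a => ofBits (ea.encode a) := by
  intro sym
  refine ⟨fun x => mapT (ofList [sym false, sym true]) x, by fun_prop, fun a => ?_⟩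
  simp only [ofBits, mapT_ofList, List.map_map]
  congr 2
  funext b
  cases b <;> rfl

theorem Readable.prod {α β A B : Type} {ea : Encoding α A} {eb : Encoding β B} {r : α → BTree}
    {r' : β → BTree} (h : Readable ea r) (h' : Readable eb r') :
    Readable (encodingProd ea eb) fun p => node (r p.1) (r' p.2) := by
  intro sym
  obtain ⟨i, hi, hi'⟩ := h fun a => sym (.inl a)
  obtain ⟨j, hj, hj'⟩ := h' fun a => sym (.inr a)
  refine ⟨fun x => app (i (car x)) (j (cdr x)), by fun_prop, fun p => ?_⟩
  simp only [car_node, cdr_node, hi', hj', app_ofList]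
  simp [encodingProd, Function.comp_def]

theorem length_le_size_ofList (l : List BTree) : l.length ≤ size (ofList l) := by
  induction l with
  | nil => simp
  | cons a l ih => simp; omega

/-- Functions computable by stack machines in polynomial time are in `FP`. -/
theorem exists_FP_of_polyTime {α β A : Type} {ea : Encoding α A} {eb : β → List Bool} {f : α → β}
    (h : PolyTime ea eb f) {r : α → BTree} (hr : Readable ea r) :
    ∃ F, FP F ∧ ∀ a, F (r a) = ofBits (eb (f a)) := by
  obtain ⟨M⟩ := h
  obtain ⟨tbl, pc, ko, tb, sym, B, H⟩ := M.toTM2ComputableAux.exists_table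
  obtain ⟨inp, hinp, hinp'⟩ := hr sym
  obtain ⟨q, hq, -, hqs⟩ := hinp.polyBdd_size
  obtain ⟨e, he⟩ := PolyBdd.eval M.time
  -- The clock has to outlast `B` instructions for each step of the machine, whose input has length
  -- at most `q` of the size of the argument.
  obtain ⟨d, hd⟩ : PolyBdd fun m => B * (q m + 2) ^ e := .mul (.const B) (.pow (.add hq (.const 2)) e)
  refine ⟨fun x => mapT tb (nthT ko (cdr (simT tbl (node pc (node (inp x) leaf)) (clock d x)))),
    by fun_prop, fun a => ?_⟩
  simp only [hinp']
  refine H _ _ _ ((M.outputs_iff _ _ _).2 ⟨M.outputsFun a⟩) _ ?_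
  have h1 : (ea.encode a).length ≤ q (size (r a)) := by
    have := length_le_size_ofList ((ea.encode a).map sym)
    rw [← hinp', List.length_map] at this
    exact this.trans (hqs _)
  calc B * M.time.eval (ea.encode a).length ≤ B * ((ea.encode a).length + 2) ^ e :=
        Nat.mul_le_mul_left _ (he _)
    _ ≤ B * (q (size (r a)) + 2) ^ e :=
        Nat.mul_le_mul_left _ (Nat.pow_le_pow_left (by omega) _)
    _ ≤ _ := (hd _).trans (le_size_clock d _)

namespace Com

/-! ### Compilation to stack machines -/

/-- The continuations that can occur in the execution of a program followed by `κ`, apart from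
`κ` itself. -/
def conts : Com → List Com → Set (List Com)
  | skip, κ => {skip :: κ}
  | push k b, κ => {push k b :: κ}
  | pop k e f t, κ => insert (pop k e f t :: κ) (conts e κ ∪ conts f κ ∪ conts t κ)
  | seq a b, κ => insert (seq a b :: κ) (conts a (b :: κ) ∪ conts b κ)
  | loop k f t, κ =>
    insert (loop k f t :: κ) (conts f (loop k f t :: κ) ∪ conts t (loop k f t :: κ))
  | ext c, κ => insert (ext c :: κ) (⋃ x, conts (c x) (ext c :: κ))
  | run, κ => {run :: κ}

theorem finite_conts (c : Com) (κ : List Com) : (conts c κ).Finite := by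
  induction c generalizing κ with
  | skip => exact Set.finite_singleton _
  | push => exact Set.finite_singleton _
  | pop k e f t he hf ht => exact ((((he κ).union (hf κ)).union (ht κ))).insert _
  | seq a b ha hb => exact ((ha _).union (hb κ)).insert _
  | loop k f t hf ht => exact ((hf _).union (ht _)).insert _
  | ext c hc => exact (Set.finite_iUnion fun x => hc x _).insert _
  | run => exact Set.finite_singleton _

theorem mem_conts_self (c : Com) (κ : List Com) : c :: κ ∈ conts c κ := by
  cases c <;> simp [conts]

/-- All stacks used by the program have index at most `N`. -/
def StkLE (N : ℕ) : Com → Prop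
  | skip => True
  | push k _ => k ≤ N
  | pop k e f t => k ≤ N ∧ StkLE N e ∧ StkLE N f ∧ StkLE N t
  | seq a b => StkLE N a ∧ StkLE N b
  | loop k f t => k ≤ N ∧ StkLE N f ∧ StkLE N t
  | ext c => ∀ x, StkLE N (c x)
  | run => 1 ≤ N

theorem StkLE.mono {N N' : ℕ} (h : N ≤ N') {c : Com} (hc : StkLE N c) : StkLE N' c := by
  induction c with
  | skip => trivial
  | push => exact le_trans hc h
  | pop k e f t he hf ht => exact ⟨hc.1.trans h, he hc.2.1, hf hc.2.2.1, ht hc.2.2.2⟩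
  | seq a b ha hb => exact ⟨ha hc.1, hb hc.2⟩
  | loop k f t hf ht => exact ⟨hc.1.trans h, hf hc.2.1, ht hc.2.2⟩
  | ext c ih => exact fun x => ih x (hc x)
  | run => exact le_trans hc h

theorem exists_stkLE (c : Com) : ∃ N, StkLE N c := by
  induction c with
  | skip => exact ⟨0, trivial⟩
  | push k b => exact ⟨k, le_rfl⟩
  | pop k e f t he hf ht =>
    obtain ⟨N₁, h₁⟩ := he
    obtain ⟨N₂, h₂⟩ := hf
    obtain ⟨N₃, h₃⟩ := ht
    exact ⟨k + N₁ + N₂ + N₃, show k ≤ _ by omega, h₁.mono (by omega), h₂.mono (by omega),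
      h₃.mono (by omega)⟩
  | seq a b ha hb =>
    obtain ⟨N₁, h₁⟩ := ha
    obtain ⟨N₂, h₂⟩ := hb
    exact ⟨N₁ + N₂, h₁.mono (by omega), h₂.mono (by omega)⟩
  | loop k f t hf ht =>
    obtain ⟨N₁, h₁⟩ := hf
    obtain ⟨N₂, h₂⟩ := ht
    exact ⟨k + N₁ + N₂, show k ≤ _ by omega, h₁.mono (by omega), h₂.mono (by omega)⟩
  | ext c ih =>
    choose N hN using ih
    exact ⟨Finset.univ.sup N, fun x => (hN x).mono (Finset.le_sup (Finset.mem_univ x))⟩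
  | run => exact ⟨1, le_rfl⟩

section Compile

variable (tm : FinTM2) (ia : tm.Γ tm.k₀ ≃ Bool) (oa : tm.Γ tm.k₁ ≃ Bool) (c₀ : Com) (N : ℕ)

/-- The stack alphabets of the compiled machine: the external stack, the stacks of the program, and
the stacks of the called machine. -/
abbrev Alph : Option (Fin (N + 1) ⊕ tm.K) → Type
  | none => Bool ⊕ Bool
  | some (.inl _) => Bool
  | some (.inr k) => tm.Γ k

/-- The continuations serving as labels. -/
abbrev Conts : Type := {κ : List Com // κ ∈ insert [] (conts c₀ [])}

/-- The labels: a continuation and, during a call, the label of the called machine, where `some none`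
stands for the copying of its output. -/
abbrev Lab : Type := Conts c₀ × Option (Option tm.Λ)

/-- The states: the symbol popped last and the state of the called machine. -/
abbrev Mem : Type := Option (Bool ⊕ Bool) × tm.σ

/-- Statements of the compiled machine. -/
abbrev Stm : Type := TM2.Stmt (Alph tm N) (Lab tm c₀) (Mem tm)

open Classical in
/-- A continuation as a label. -/
def toConts (κ : List Com) : Conts c₀ :=
  if h : κ ∈ insert [] (conts c₀ []) then ⟨κ, h⟩ else ⟨[], by simp⟩

/-- The label of a continuation. -/
def lab (κ : List Com) : Lab tm c₀ := (toConts c₀ κ, none)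

/-- The stack of the compiled machine for stack `k` of the program. -/
abbrev stack (k : ℕ) : Option (Fin (N + 1) ⊕ tm.K) := some (.inl (Fin.ofNat (N + 1) k))

/-- The statements of the called machine. -/
def callStmt (κ : Conts c₀) : TM2.Stmt tm.Γ tm.Λ tm.σ → Stm tm c₀ N
  | .push k f q => .push (some (.inr k)) (fun v => f v.2) (callStmt κ q)
  | .peek k f q => .peek (some (.inr k)) (fun v o => (v.1, f v.2 o)) (callStmt κ q)
  | .pop k f q => .pop (some (.inr k)) (fun v o => (v.1, f v.2 o)) (callStmt κ q)
  | .load a q => .load (fun v => (v.1, a v.2)) (callStmt κ q)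
  | .branch p q₁ q₂ => .branch (fun v => p v.2) (callStmt κ q₁) (callStmt κ q₂)
  | .goto l => .goto fun v => (κ, some (some (l v.2)))
  | .halt => .goto fun _ => (κ, some none)

/-- The bit popped last. -/
def lastBit : Option (Bool ⊕ Bool) → Bool
  | some (.inl b) => b
  | _ => false

/-- Popping from a stack of the program. -/
def popStmt (k : ℕ) (next : Option (Bool ⊕ Bool) → List Com) : Stm tm c₀ N :=
  .pop (stack tm N k) (fun v o => (o.map Sum.inl, v.2)) (.goto fun v => lab tm c₀ (next v.1))

/-- The statement for a continuation. -/
def stmt (κ : Conts c₀) (ph : Option (Option tm.Λ)) : Stm tm c₀ N :=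
  match κ.1, ph with
  -- Before halting, the register receives the top of stack 0. A streaming algorithm reads its
  -- answer from there. If stack 0 is empty, the register is reset to `none`, its initial value, as
  -- is required of a machine computing a function.
  | [], _ => .peek (stack tm N 0) (fun v o => (o.map Sum.inl, v.2)) .halt
  | skip :: κ', _ => .goto fun _ => lab tm c₀ κ'
  | push k b :: κ', _ => .push (stack tm N k) (fun _ => b) (.goto fun _ => lab tm c₀ κ')
  | pop k e f t :: κ', _ => popStmt tm c₀ N k fun o =>
      (match o with | none => e | some _ => cond (lastBit o) t f) :: κ'
  | seq a b :: κ', _ => .goto fun _ => lab tm c₀ (a :: b :: κ')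
  | loop k f t :: κ', _ => popStmt tm c₀ N k fun o =>
      match o with | none => κ' | some _ => cond (lastBit o) t f :: loop k f t :: κ'
  | ext c :: κ', _ => .pop none (fun v o => (o, v.2)) (.goto fun v => lab tm c₀
      (match v.1 with | none => κ' | some x => c x :: ext c :: κ'))
  -- A call has three phases: stack 1 is poured onto the input stack, the called machine runs, and
  -- its output is poured back onto stack 1. Pouring reverses, hence the reversed words in
  -- `reachIn_run`.
  | run :: _, none => .pop (stack tm N 1) (fun v o => (o.map Sum.inl, v.2))
      (.branch (fun v => v.1.isSome)
        (.push (some (.inr tm.k₀)) (fun v => ia.symm (lastBit v.1)) (.goto fun _ => (κ, none)))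
        (.goto fun _ => (κ, some (some tm.main))))
  | run :: _, some (some l) => callStmt tm c₀ N κ (tm.m l)
  | run :: κ', some none => .pop (some (.inr tm.k₁)) (fun v o => (o.map fun a => Sum.inl (oa a), v.2))
      (.branch (fun v => v.1.isSome)
        (.push (stack tm N 1) (fun v => lastBit v.1) (.goto fun _ => (κ, some none)))
        (.goto fun _ => lab tm c₀ κ'))

/-- The compiled program. -/
def prog (l : Lab tm c₀) : Stm tm c₀ N := stmt tm ia oa c₀ N l.1 l.2

/-- The stacks of the compiled machine. -/
def allStk (x : List (Bool ⊕ Bool)) (s : ℕ → List Bool) (S : ∀ k, List (tm.Γ k)) :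
    ∀ k, List (Alph tm N k)
  | none => x
  | some (.inl i) => s i
  | some (.inr k) => S k

theorem allStk_stack {x s S k} (hk : k ≤ N) : allStk tm N x s S (stack tm N k) = s k := by
  simp only [allStk, Fin.val_ofNat]
  rw [Nat.mod_eq_of_lt (by omega)]

theorem update_stack {x s S k} (hk : k ≤ N) (l : List Bool) :
    Function.update (allStk tm N x s S) (stack tm N k) l =
      allStk tm N x (Function.update s k l) S := by
  funext j
  by_cases hj : j = stack tm N k
  · subst hj
    rw [Function.update_self, allStk_stack tm N hk, Function.update_self]
  · rw [Function.update_of_ne hj]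
    match j, hj with
    | none, _ => rfl
    | some (.inr k), _ => rfl
    | some (.inl i), hj =>
      have : (i : ℕ) ≠ k := by
        rintro rfl
        exact hj (by simp [stack])
      simp [allStk, this]

theorem update_ext {x s S} (l : List (Bool ⊕ Bool)) :
    Function.update (allStk tm N x s S) none l = allStk tm N l s S := by
  funext j
  match j with
  | none => rfl
  | some (.inr k) => rfl
  | some (.inl i) => rfl

theorem update_call {x s S} (k : tm.K) (l : List (tm.Γ k)) :
    Function.update (allStk tm N x s S) (some (.inr k)) l =
      allStk tm N x s (Function.update S k l) := by
  funext j
  match j with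
  | none => rfl
  | some (.inl i) => rfl
  | some (.inr j) =>
    by_cases hj : j = k
    · subst hj
      simp [allStk]
    · simp [allStk, hj]

/-- Configurations of the compiled machine. -/
def cfg (κ : List Com) (v : Mem tm) (x : List (Bool ⊕ Bool)) (s : ℕ → List Bool)
    (S : ∀ k, List (tm.Γ k)) : TM2.Cfg (Alph tm N) (Lab tm c₀) (Mem tm) :=
  ⟨some (lab tm c₀ κ), v, allStk tm N x s S⟩

variable {c₀ N}

theorem prog_lab {κ : List Com} (h : κ ∈ insert [] (conts c₀ [])) :
    prog tm ia oa c₀ N (lab tm c₀ κ) = stmt tm ia oa c₀ N ⟨κ, h⟩ none := by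
  rw [prog, lab, toConts, dif_pos h]

/-- Execution of a program by the compiled machine. -/
theorem Exec.stepsIn {c : Com} {s s' : ℕ → List Bool} {t : ℕ} (h : Exec c s s' t) (hN : StkLE N c)
    {κ : List Com} (hc : conts c κ ⊆ insert [] (conts c₀ [])) (hκ : κ ∈ insert [] (conts c₀ []))
    (v : Mem tm) (x : List (Bool ⊕ Bool)) (S : ∀ k, List (tm.Γ k)) :
    ∃ o, TM2.StepsIn (prog tm ia oa c₀ N) t (cfg tm c₀ N (c :: κ) v x s S)
      (cfg tm c₀ N κ (o, v.2) x s' S) := by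
  induction h generalizing κ v with
  | skip =>
    refine ⟨v.1, .single ?_⟩
    rw [cfg, TM2.step, prog_lab tm ia oa (hc (mem_conts_self _ _))]
    rfl
  | push =>
    refine ⟨v.1, .single ?_⟩
    rw [cfg, TM2.step, prog_lab tm ia oa (hc (mem_conts_self _ _))]
    simp only [stmt, TM2.stepAux]
    rw [allStk_stack tm N hN, update_stack tm N hN]
    rfl
  | @pop_nil s s' k e f g t h _ ih =>
    obtain ⟨o, ho⟩ := ih hN.2.1 (κ := κ) (fun y hy => hc (by simp [conts, hy])) hκ (none, v.2)
    refine ⟨o, TM2.StepsIn.succ_iff.2 ⟨_, ?_, ho⟩⟩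
    rw [cfg, TM2.step, prog_lab tm ia oa (hc (mem_conts_self _ _))]
    simp only [stmt, popStmt, TM2.stepAux]
    rw [allStk_stack tm N hN.1, update_stack tm N hN.1, h, List.tail_nil, ← h,
      Function.update_eq_self, h]
    rfl
  | @pop_cons s s' k e f g t b l h _ ih =>
    obtain ⟨o, ho⟩ := ih (by cases b; exacts [hN.2.2.1, hN.2.2.2]) (κ := κ)
      (fun y hy => hc (by cases b <;> simp_all [conts])) hκ (some (.inl b), v.2)
    refine ⟨o, TM2.StepsIn.succ_iff.2 ⟨_, ?_, ho⟩⟩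
    rw [cfg, TM2.step, prog_lab tm ia oa (hc (mem_conts_self _ _))]
    simp only [stmt, popStmt, TM2.stepAux]
    rw [allStk_stack tm N hN.1, update_stack tm N hN.1, h]
    rfl
  | @seq a b s s' s'' t u _ _ iha ihb =>
    have hb : conts b κ ⊆ insert [] (conts c₀ []) := fun y hy => hc (by simp [conts, hy])
    obtain ⟨o, ho⟩ := iha hN.1 (κ := b :: κ) (fun y hy => hc (by simp [conts, hy]))
      (hb (mem_conts_self _ _)) v
    obtain ⟨o', ho'⟩ := ihb hN.2 (κ := κ) hb hκ (o, v.2)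
    refine ⟨o', TM2.StepsIn.succ_iff.2 ⟨_, ?_, ho.trans ho'⟩⟩
    rw [cfg, TM2.step, prog_lab tm ia oa (hc (mem_conts_self _ _))]
    rfl
  | @loop_nil s k f g h =>
    refine ⟨none, .single ?_⟩
    rw [cfg, TM2.step, prog_lab tm ia oa (hc (mem_conts_self _ _))]
    simp only [stmt, popStmt, TM2.stepAux]
    rw [allStk_stack tm N hN.1, update_stack tm N hN.1, h, List.tail_nil, ← h,
      Function.update_eq_self, h]
    rfl
  | @loop_cons s s' s'' k f g t u b l h _ _ ihb ihl =>
    have hl : loop k f g :: κ ∈ insert [] (conts c₀ []) := hc (mem_conts_self _ _)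
    obtain ⟨o, ho⟩ := ihb (by cases b; exacts [hN.2.1, hN.2.2]) (κ := loop k f g :: κ)
      (fun y hy => hc (by cases b <;> simp_all [conts])) hl (some (.inl b), v.2)
    obtain ⟨o', ho'⟩ := ihl hN (κ := κ) hc hκ (o, v.2)
    refine ⟨o', TM2.StepsIn.succ_iff.2 ⟨_, ?_, ho.trans ho'⟩⟩
    rw [cfg, TM2.step, prog_lab tm ia oa hl]
    simp only [stmt, popStmt, TM2.stepAux]
    rw [allStk_stack tm N hN.1, update_stack tm N hN.1, h]
    rfl

end Compile

end Com

/-! ### Time-bounded reachability and the growth of stacks -/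

namespace Turing.TM2

variable {K : Type} [DecidableEq K] {Γ : K → Type} {Λ σ : Type}

/-- The machine goes from `c` to `c'` in at most `T` steps. -/
def ReachIn (m : Λ → Stmt Γ Λ σ) (T : ℕ) (c c' : Cfg Γ Λ σ) : Prop := ∃ j ≤ T, StepsIn m j c c'

variable {m : Λ → Stmt Γ Λ σ}

theorem ReachIn.trans {T U : ℕ} {a b c : Cfg Γ Λ σ} (h : ReachIn m T a b) (h' : ReachIn m U b c) :
    ReachIn m (T + U) a c :=
  let ⟨_, hi, hi'⟩ := h
  let ⟨_, hj, hj'⟩ := h'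
  ⟨_, Nat.add_le_add hi hj, hi'.trans hj'⟩

theorem ReachIn.single {c c' : Cfg Γ Λ σ} (h : step m c = some c') : ReachIn m 1 c c' :=
  ⟨1, le_rfl, h⟩

theorem ReachIn.mono {T U : ℕ} {a b : Cfg Γ Λ σ} (h : ReachIn m T a b) (hT : T ≤ U) :
    ReachIn m U a b :=
  let ⟨j, hj, h⟩ := h
  ⟨j, hj.trans hT, h⟩

/-- Each instruction pushes at most one symbol, so the depth of the statement bounds the growth. In
this way time bounds yield space bounds. -/
theorem sum_length_stepAux_le (F : Finset K) (q : Stmt Γ Λ σ) (v : σ) (S : ∀ k, List (Γ k)) :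
    ∑ k ∈ F, ((stepAux q v S).stk k).length ≤ ∑ k ∈ F, (S k).length + q.depth := by
  have upd : ∀ (S : ∀ k, List (Γ k)) (k : K) (l : List (Γ k)) (d : ℕ), l.length ≤ (S k).length + d →
      ∑ j ∈ F, (Function.update S k l j).length ≤ ∑ j ∈ F, (S j).length + d := by
    intro S k l d hl
    by_cases hk : k ∈ F
    · rw [← Finset.add_sum_erase F _ hk, ← Finset.add_sum_erase F (fun j => (S j).length) hk]
      have : ∑ j ∈ F.erase k, (Function.update S k l j).length =
          ∑ j ∈ F.erase k, (S j).length :=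
        Finset.sum_congr rfl fun j hj => by rw [Function.update_of_ne (Finset.ne_of_mem_erase hj)]
      rw [this, Function.update_self]
      omega
    · have : ∑ j ∈ F, (Function.update S k l j).length = ∑ j ∈ F, (S j).length :=
        Finset.sum_congr rfl fun j hj => by
          rw [Function.update_of_ne (fun h => hk (by rwa [h] at hj))]
      omega
  induction q generalizing v S with
  | push k f q ih =>
    have h1 := ih v (Function.update S k (f v :: S k))
    have h2 := upd S k (f v :: S k) 1 (by simp)
    simp only [stepAux, Stmt.depth]
    omega
  | peek k f q ih => have := ih (f v (S k).head?) S; simp only [stepAux, Stmt.depth]; omega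
  | pop k f q ih =>
    have h1 := ih (f v (S k).head?) (Function.update S k (S k).tail)
    have h2 := upd S k (S k).tail 0 (by simp)
    simp only [stepAux, Stmt.depth]
    omega
  | load a q ih => have := ih (a v) S; simp only [stepAux, Stmt.depth]; omega
  | branch p q₁ q₂ ih₁ ih₂ =>
    have h1 := ih₁ v S
    have h2 := ih₂ v S
    simp only [stepAux, Stmt.depth]
    cases p v
    · simp only [cond_false]; omega
    · simp only [cond_true]; omega
  | goto l => simp [stepAux]
  | halt => simp [stepAux]

end Turing.TM2

namespace Com

section Compile

variable (tm : FinTM2) (ia : tm.Γ tm.k₀ ≃ Bool) (oa : tm.Γ tm.k₁ ≃ Bool) {c₀ : Com} {N : ℕ}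

theorem Runs.reachIn {c : Com} {s s' : ℕ → List Bool} {T : ℕ} (h : Runs c s s' T) (hN : StkLE N c)
    {κ : List Com} (hc : conts c κ ⊆ insert [] (conts c₀ [])) (hκ : κ ∈ insert [] (conts c₀ []))
    (o : Option (Bool ⊕ Bool)) (u : tm.σ) (x : List (Bool ⊕ Bool)) (S : ∀ k, List (tm.Γ k)) :
    ∃ o', TM2.ReachIn (prog tm ia oa c₀ N) T (cfg tm c₀ N (c :: κ) (o, u) x s S)
      (cfg tm c₀ N κ (o', u) x s' S) :=
  let ⟨t, ht, he⟩ := h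
  let ⟨o', ho'⟩ := he.stepsIn tm ia oa hN hc hκ (o, u) x S
  ⟨o', t, ht, ho'⟩

theorem reachIn_seq {a b : Com} {κ : List Com} (h : seq a b :: κ ∈ insert [] (conts c₀ []))
    (v : Mem tm) (x : List (Bool ⊕ Bool)) (s : ℕ → List Bool) (S : ∀ k, List (tm.Γ k)) :
    TM2.ReachIn (prog tm ia oa c₀ N) 1 (cfg tm c₀ N (seq a b :: κ) v x s S)
      (cfg tm c₀ N (a :: b :: κ) v x s S) := by
  refine .single ?_
  rw [cfg, TM2.step, prog_lab tm ia oa h]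
  rfl

theorem reachIn_ext_nil {c : Bool ⊕ Bool → Com} {κ : List Com}
    (h : ext c :: κ ∈ insert [] (conts c₀ [])) (v : Mem tm) (s : ℕ → List Bool)
    (S : ∀ k, List (tm.Γ k)) :
    TM2.ReachIn (prog tm ia oa c₀ N) 1 (cfg tm c₀ N (ext c :: κ) v [] s S)
      (cfg tm c₀ N κ (none, v.2) [] s S) := by
  refine .single ?_
  rw [cfg, TM2.step, prog_lab tm ia oa h]
  simp only [stmt, TM2.stepAux]
  rw [update_ext]
  rfl

theorem reachIn_ext_cons {c : Bool ⊕ Bool → Com} {κ : List Com}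
    (h : ext c :: κ ∈ insert [] (conts c₀ [])) (v : Mem tm) (y : Bool ⊕ Bool)
    (x : List (Bool ⊕ Bool)) (s : ℕ → List Bool) (S : ∀ k, List (tm.Γ k)) :
    TM2.ReachIn (prog tm ia oa c₀ N) 1 (cfg tm c₀ N (ext c :: κ) v (y :: x) s S)
      (cfg tm c₀ N (c y :: ext c :: κ) (some y, v.2) x s S) := by
  refine .single ?_
  rw [cfg, TM2.step, prog_lab tm ia oa h]
  simp only [stmt, TM2.stepAux]
  rw [update_ext]
  rfl

theorem reachIn_halt (v : Mem tm) (x : List (Bool ⊕ Bool)) (s : ℕ → List Bool)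
    (S : ∀ k, List (tm.Γ k)) :
    TM2.ReachIn (prog tm ia oa c₀ N) 1 (cfg tm c₀ N [] v x s S)
      ⟨none, ((s 0).head?.map Sum.inl, v.2), allStk tm N x s S⟩ := by
  refine .single ?_
  rw [cfg, TM2.step, prog_lab tm ia oa (Set.mem_insert _ _)]
  simp only [stmt, TM2.stepAux]
  rw [allStk_stack tm N (Nat.zero_le N)]

theorem stepAux_callStmt (κ : Conts c₀) (q : TM2.Stmt tm.Γ tm.Λ tm.σ) (o : Option (Bool ⊕ Bool))
    (v : tm.σ) (x : List (Bool ⊕ Bool)) (s : ℕ → List Bool) (S : ∀ k, List (tm.Γ k)) :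
    TM2.stepAux (callStmt tm c₀ N κ q) (o, v) (allStk tm N x s S) =
      ⟨some (κ, some (TM2.stepAux q v S).l), (o, (TM2.stepAux q v S).var),
        allStk tm N x s (TM2.stepAux q v S).stk⟩ := by
  induction q generalizing v S with
  | push k f q ih =>
    simp only [callStmt, TM2.stepAux]
    rw [update_call]
    exact ih _ _
  | peek k f q ih => exact ih _ _
  | pop k f q ih =>
    simp only [callStmt, TM2.stepAux]
    rw [update_call]
    exact ih _ _
  | load a q ih => exact ih _ _
  | branch p q₁ q₂ ih₁ ih₂ =>
    simp only [callStmt, TM2.stepAux]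
    cases p v
    · exact ih₂ _ _
    · exact ih₁ _ _
  | goto l => rfl
  | halt => rfl

/-- The two copying loops take one step more than the number of symbols copied. The called machine
ends in its initial state with nothing but its output on its stacks, so its part of the
configuration is clean again afterwards. -/
theorem reachIn_run {κ : List Com} (h : run :: κ ∈ insert [] (conts c₀ [])) (hN : 1 ≤ N)
    {xs ys : List Bool} {T : ℕ} (hM : TM2ComputableAux.Outputs ⟨tm, ia, oa⟩ xs ys T)
    (o : Option (Bool ⊕ Bool)) (x : List (Bool ⊕ Bool)) (s : ℕ → List Bool)
    (hs : s 1 = xs.reverse) :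
    TM2.ReachIn (prog tm ia oa c₀ N) (xs.length + T + ys.length + 2)
      (cfg tm c₀ N (run :: κ) (o, tm.initialState) x s fun _ => [])
      (cfg tm c₀ N κ (none, tm.initialState) x (Function.update s 1 ys.reverse) fun _ => []) := by
  have hlab : lab tm c₀ (run :: κ) = (⟨run :: κ, h⟩, none) := by rw [lab, toConts, dif_pos h]
  have hself : ∀ s : ℕ → List Bool, s 1 = [] → Function.update s 1 [] = s := by
    intro s hs; rw [← hs, Function.update_eq_self]
  -- copying the input
  have hin : ∀ (l acc : List Bool) (o : Option (Bool ⊕ Bool)) (s : ℕ → List Bool), s 1 = l →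
      TM2.ReachIn (prog tm ia oa c₀ N) (l.length + 1)
        (cfg tm c₀ N (run :: κ) (o, tm.initialState) x s
          (Function.update (fun _ => []) tm.k₀ (acc.map ia.symm)))
        ⟨some (⟨run :: κ, h⟩, some (some tm.main)), (none, tm.initialState),
          allStk tm N x (Function.update s 1 [])
            (Function.update (fun _ => []) tm.k₀ ((l.reverse ++ acc).map ia.symm))⟩ := by
    intro l
    induction l with
    | nil =>
      intro acc o s hs
      refine .single ?_
      rw [cfg, TM2.step, prog_lab tm ia oa h]
      simp only [stmt, TM2.stepAux]
      rw [allStk_stack tm N hN, update_stack tm N hN, hs]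
      rfl
    | cons b l ih =>
      intro acc o s hs
      have h1 : TM2.ReachIn (prog tm ia oa c₀ N) 1
          (cfg tm c₀ N (run :: κ) (o, tm.initialState) x s
            (Function.update (fun _ => []) tm.k₀ (acc.map ia.symm)))
          (cfg tm c₀ N (run :: κ) (some (.inl b), tm.initialState) x (Function.update s 1 l)
            (Function.update (fun _ => []) tm.k₀ ((b :: acc).map ia.symm))) := by
        refine .single ?_
        rw [cfg, TM2.step, prog_lab tm ia oa h]
        simp only [stmt, TM2.stepAux]
        rw [allStk_stack tm N hN, update_stack tm N hN, hs, update_call]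
        simp only [List.head?_cons, Option.map_some, Option.isSome_some, cond_true, cfg, hlab,
          List.tail_cons, allStk, Function.update_self, Function.update_idem, lastBit,
          List.map_cons]
      have h2 := h1.trans (ih (b :: acc) _ _ (by simp))
      rw [Function.update_idem] at h2
      simpa [add_comm] using h2
  -- the run of the called machine
  have hrun : ∀ (j : ℕ) (c c' : TM2.Cfg tm.Γ tm.Λ tm.σ) (s : ℕ → List Bool),
      TM2.StepsIn tm.m j c c' → TM2.StepsIn (prog tm ia oa c₀ N) j
        ⟨some (⟨run :: κ, h⟩, some c.l), (none, c.var), allStk tm N x s c.stk⟩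
        ⟨some (⟨run :: κ, h⟩, some c'.l), (none, c'.var), allStk tm N x s c'.stk⟩ := by
    intro j
    induction j with
    | zero =>
      intro c c' s hc
      have : c = c' := by simpa [TM2.StepsIn] using hc
      subst this
      rfl
    | succ j ih =>
      intro c c' s hc
      obtain ⟨b, h1, h2⟩ := TM2.StepsIn.succ_iff.1 hc
      obtain ⟨l, v, S⟩ := c
      cases l with
      | none => simp at h1
      | some l =>
        simp only [TM2.step, Option.some.injEq] at h1
        subst h1
        exact TM2.StepsIn.succ_iff.2 ⟨_, congrArg some (stepAux_callStmt tm _ _ _ _ _ _ _), ih _ _ s h2⟩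
  -- copying the output
  have hout : ∀ (l : List Bool) (o : Option (Bool ⊕ Bool)) (s : ℕ → List Bool),
      TM2.ReachIn (prog tm ia oa c₀ N) (l.length + 1)
        ⟨some (⟨run :: κ, h⟩, some none), (o, tm.initialState),
          allStk tm N x s (Function.update (fun _ => []) tm.k₁ (l.map oa.symm))⟩
        (cfg tm c₀ N κ (none, tm.initialState) x (Function.update s 1 (l.reverse ++ s 1))
          fun _ => []) := by
    intro l
    induction l with
    | nil =>
      intro o s
      refine .single ?_
      simp only [TM2.step, prog, stmt, TM2.stepAux]
      rw [update_call]
      simp [allStk, cfg]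
    | cons b l ih =>
      intro o s
      have h1 : TM2.ReachIn (prog tm ia oa c₀ N) 1
          ⟨some (⟨run :: κ, h⟩, some none), (o, tm.initialState),
            allStk tm N x s (Function.update (fun _ => []) tm.k₁ ((b :: l).map oa.symm))⟩
          ⟨some (⟨run :: κ, h⟩, some none), (some (.inl b), tm.initialState),
            allStk tm N x (Function.update s 1 (b :: s 1))
              (Function.update (fun _ => []) tm.k₁ (l.map oa.symm))⟩ := by
        refine .single ?_
        simp only [TM2.step, prog, stmt, TM2.stepAux]
        rw [update_call, allStk_stack tm N hN, update_stack tm N hN]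
        simp [allStk, lastBit]
      have h2 := h1.trans (ih _ _)
      rw [Function.update_idem] at h2
      simpa [add_comm] using h2
  obtain ⟨j, hj, hM⟩ := hM
  have h1 := hin xs.reverse [] o s hs
  have h2 : TM2.ReachIn (prog tm ia oa c₀ N) T _ _ := ⟨j, hj, hrun j _ _ (Function.update s 1 []) hM⟩
  have h3 := hout ys none (Function.update s 1 [])
  simp only [List.append_nil, List.reverse_reverse, List.map_nil, Function.update_self,
    Function.update_idem, List.length_reverse] at h1 h3
  have e : Function.update (fun _ => []) tm.k₀ ([] : List (tm.Γ tm.k₀)) = fun _ => [] :=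
    Function.update_eq_self tm.k₀ (fun k => ([] : List (tm.Γ k)))
  rw [e] at h1
  exact (h1.trans (h2.trans h3)).mono (by omega)

theorem noPush_prog (l : Lab tm c₀) : NoPush none (prog tm ia oa c₀ N l) := by
  have hcall : ∀ (κ : Conts c₀) (q : TM2.Stmt tm.Γ tm.Λ tm.σ), NoPush none (callStmt tm c₀ N κ q) := by
    intro κ q
    induction q with
    | push k f q ih => exact ⟨by simp, ih⟩
    | peek k f q ih => exact ih
    | pop k f q ih => exact ih
    | load a q ih => exact ih
    | branch p q₁ q₂ ih₁ ih₂ => exact ⟨ih₁, ih₂⟩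
    | goto l => trivial
    | halt => trivial
  obtain ⟨⟨κ, hκ⟩, ph⟩ := l
  unfold prog stmt
  dsimp only
  split <;> simp [NoPush, popStmt, hcall]

instance : Finite (Conts c₀) := ((finite_conts c₀ []).insert []).to_subtype

end Compile

end Com

namespace BTree

/-- The code of the entries of a list of bits. -/
def bitsCode (l : List Bool) : List Bool := l.flatMap fun b => true :: code (bit b)

theorem code_ofBits (l : List Bool) : code (ofBits l) = bitsCode l ++ [false] := by
  induction l with
  | nil => rfl
  | cons b l ih => rw [ofBits_cons, code, ih]; simp [bitsCode]

theorem length_bitsCode_le (l : List Bool) : (bitsCode l).length ≤ 4 * l.length := by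
  have h1 : (code (ofBits l)).length ≤ 4 * l.length + 1 := size_ofBits l
  rw [code_ofBits, List.length_append, List.length_singleton] at h1
  omega

theorem head?_code (t : BTree) : (code t).head? = some (isNode t) := by cases t <;> rfl

end BTree

/-! ### From polynomial-time functions on trees to polynomial-time machines -/

namespace Com

/-- Reading a pair of bit strings from the external stack. -/
def readPair : Bool ⊕ Bool → Com
  | .inl b => pushes (0 + 2) (true :: code (bit b)).reverse
  | .inr b => pushes (0 + 3) (true :: code (bit b)).reverse

/-- Deciding a property of the pair that has been read. -/
def decidePair (c : Com) : Com :=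
  (push (0 + 0) false).seq <| (mv (0 + 3) (0 + 0)).seq <| (push (0 + 0) false).seq <|
  (mv (0 + 2) (0 + 0)).seq <| (push (0 + 0) true).seq <| c.seq <|
  (pop (0 + 0) skip (push (0 + 1) false) (push (0 + 1) true)).seq (clear (0 + 0))

/-- The code of the pair is assembled from its end: moving the two reversed words restores their
order, and a `false` pushed before each closes its list. The truth value of the result is the first
symbol of its code. Stack 0 is emptied so that the final `peek` resets the register. -/
theorem runs_decidePair {c : Com} {s : ℕ → List Bool} {x w : List Bool} {y : BTree} {T : ℕ}
    (hc : Runs c (st s 0 [code (node (ofBits x) (ofBits w))]) (st s 0 [code y]) T) :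
    Runs (decidePair c) (st s 0 [[], [], (bitsCode x).reverse, (bitsCode w).reverse])
      (st s 0 [[], [isNode y]]) (16 * x.length + 16 * w.length + T + 2 * size y + 20) := by
  have h1 : Runs (push (0 + 0) false) (st s 0 [[], [], (bitsCode x).reverse, (bitsCode w).reverse])
    (st s 0 [[false], [], (bitsCode x).reverse, (bitsCode w).reverse]) 1 :=
    Runs.push (j := 0) (by simp)
  have h2 : Runs (mv (0 + 3) (0 + 0))
      (st s 0 [[false], [], (bitsCode x).reverse, (bitsCode w).reverse])
      (st s 0 [(bitsCode w).reverse.reverse ++ [false], [], (bitsCode x).reverse, []])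
      (4 * (bitsCode w).reverse.length + 1) := Runs.mv 3 0 (by simp) (by simp) (by simp)
  rw [List.reverse_reverse, ← code_ofBits, List.length_reverse] at h2
  have h3 : Runs (push (0 + 0) false) (st s 0 [code (ofBits w), [], (bitsCode x).reverse, []])
    (st s 0 [false :: code (ofBits w), [], (bitsCode x).reverse, []]) 1 :=
    Runs.push (j := 0) (by simp)
  have h4 : Runs (mv (0 + 2) (0 + 0))
      (st s 0 [false :: code (ofBits w), [], (bitsCode x).reverse, []])
      (st s 0 [(bitsCode x).reverse.reverse ++ false :: code (ofBits w), [], [], []])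
      (4 * (bitsCode x).reverse.length + 1) := Runs.mv 2 0 (by simp) (by simp) (by simp)
  rw [List.reverse_reverse, List.length_reverse, List.append_cons, ← code_ofBits] at h4
  have h5 : Runs (push (0 + 0) true) (st s 0 [code (ofBits x) ++ code (ofBits w), [], [], []])
    (st s 0 [code (node (ofBits x) (ofBits w)), [], [], []]) 1 := Runs.push (j := 0) (by simp)
  rw [← st_pad3 s 0 (code _), ← st_pad2, ← st_pad1] at h5
  obtain ⟨r, hr, h6⟩ : ∃ r : List Bool, r.length ≤ size y ∧
      Runs (pop (0 + 0) skip (push (0 + 1) false) (push (0 + 1) true)) (st s 0 [code y])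
        (st s 0 [r, [isNode y]]) 2 := by
    rw [st_pad1]
    cases y with
    | leaf =>
      refine ⟨[], by simp, Runs.pop_cons (b := false) (l := []) (T := 1) (st_apply s 0 _ 0) ?_⟩
      rw [st_update _ (by simp)]
      exact Runs.push (L := [[], []]) (j := 1) (by simp)
    | node l r =>
      refine ⟨code l ++ code r, by simp [size, code],
        Runs.pop_cons (b := true) (l := code l ++ code r) (T := 1) (st_apply s 0 _ 0) ?_⟩
      rw [st_update _ (by simp)]
      exact Runs.push (L := [_, []]) (j := 1) (by simp)
  have h7 : Runs (clear (0 + 0)) (st s 0 [r, [isNode y]]) (st s 0 [[], [isNode y]])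
    (2 * r.length + 1) := Runs.clear (j := 0) _ _ (by simp) rfl
  refine (h1.seq <| h2.seq <| h3.seq <| h4.seq <| h5.seq <| hc.seq <| h6.seq h7).mono ?_
  have e1 := length_bitsCode_le x
  have e2 := length_bitsCode_le w
  omega

/-- An input symbol costs 10 steps: one for popping it and `2 * 4 + 1` for pushing at most four
symbols. -/
theorem reachIn_readPair (tm : FinTM2) (ia : tm.Γ tm.k₀ ≃ Bool) (oa : tm.Γ tm.k₁ ≃ Bool) {c₀ : Com}
    {N : ℕ} {κ : List Com} (hκ : conts (ext readPair) κ ⊆ insert [] (conts c₀ [])) (hN : 3 ≤ N)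
    (u : tm.σ) (s : ℕ → List Bool) (S : ∀ k, List (tm.Γ k)) :
    ∀ (x w a b : List Bool) (o : Option (Bool ⊕ Bool)),
    TM2.ReachIn (prog tm ia oa c₀ N) (10 * (x.length + w.length) + 1)
      (cfg tm c₀ N (ext readPair :: κ) (o, u) (x.map .inl ++ w.map .inr) (st s 0 [[], [], a, b]) S)
      (cfg tm c₀ N κ (none, u) [] (st s 0 [[], [], (bitsCode x).reverse ++ a,
        (bitsCode w).reverse ++ b]) S) := by
  have hself := hκ (mem_conts_self _ _)
  have hstk : ∀ y, StkLE N (readPair y) := by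
    have hp : ∀ k ≤ N, ∀ w, StkLE N (pushes k w) := by
      intro k hk w
      induction w with
      | nil => trivial
      | cons b w ih => exact ⟨ih, hk⟩
    rintro (b | b)
    · exact hp _ (by omega) _
    · exact hp _ (by omega) _
  have step : ∀ (y : Bool ⊕ Bool) (l : List (Bool ⊕ Bool)) (o : Option (Bool ⊕ Bool))
      (t t' : ℕ → List Bool), Runs (readPair y) t t' 9 → ∃ o',
      TM2.ReachIn (prog tm ia oa c₀ N) 10 (cfg tm c₀ N (ext readPair :: κ) (o, u) (y :: l) t S)
        (cfg tm c₀ N (ext readPair :: κ) (o', u) l t' S) := by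
    intro y l o t t' h
    have h1 := reachIn_ext_cons tm ia oa (N := N) hself (o, u) y l t S
    obtain ⟨o', h2⟩ := h.reachIn tm ia oa (hstk y) (κ := ext readPair :: κ)
      (fun z hz => hκ (Or.inr (Set.mem_iUnion.2 ⟨y, hz⟩))) hself (some y) u l S
    exact ⟨o', (h1.trans h2).mono (by omega)⟩
  have hlen : ∀ b, (true :: code (bit b)).length ≤ 4 := by decide
  have hl : ∀ (b : Bool) (a c : List Bool), Runs (readPair (.inl b)) (st s 0 [[], [], a, c])
      (st s 0 [[], [], (true :: code (bit b)).reverse ++ a, c]) 9 := by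
    intro b a c
    refine (Runs.pushes (i := 0) (j := 2) (L := [[], [], a, c]) (by simp) _).mono ?_
    have := hlen b
    rw [List.length_reverse]; omega
  have hr : ∀ (b : Bool) (a c : List Bool), Runs (readPair (.inr b)) (st s 0 [[], [], a, c])
      (st s 0 [[], [], a, (true :: code (bit b)).reverse ++ c]) 9 := by
    intro b a c
    refine (Runs.pushes (i := 0) (j := 3) (L := [[], [], a, c]) (by simp) _).mono ?_
    have := hlen b
    rw [List.length_reverse]; omega
  intro x
  induction x with
  | nil =>
    intro w
    induction w with
    | nil => intro a b o; exact reachIn_ext_nil tm ia oa hself _ _ _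
    | cons y w ih =>
      intro a b o
      obtain ⟨o', h1⟩ := step (.inr y) (w.map .inr) o _ _ (hr y a b)
      have h := (h1.trans (ih a _ o')).mono
        (U := 10 * (([] : List Bool).length + (y :: w).length) + 1) (by simp; omega)
      simpa [bitsCode] using h
  | cons y x ih =>
    intro w a b o
    obtain ⟨o', h1⟩ := step (.inl y) (x.map .inl ++ w.map .inr) o _ _ (hl y a b)
    have h := (h1.trans (ih w _ b o')).mono
      (U := 10 * ((y :: x).length + w.length) + 1) (by simp; omega)
    simpa [bitsCode] using h

end Com

open Com in
/-- Functions in `FP` decide properties of pairs of bit strings in polynomial time. -/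
theorem FP.polyTime {v : BTree → BTree} (hv : FP v) :
    PolyTime (encodingProd (encodingList Bool) (encodingList Bool)) encodeBool
      fun p => isNode (v (.node (ofBits p.1) (ofBits p.2))) := by
  obtain ⟨p, hp, hpm, hps⟩ := hv.polyBdd_size
  obtain ⟨c, d, hc⟩ := hv
  set c₀ : Com := (ext readPair).seq (decidePair (c 0)) with hc₀
  obtain ⟨N₀, hN₀⟩ := exists_stkLE c₀
  set N := N₀ + 3
  have hN : StkLE N c₀ := hN₀.mono (by omega)
  -- No execution considered here reaches a `run`, so an arbitrary machine may serve as the called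
  -- one.
  obtain ⟨tm, ⟨ia⟩, ⟨oa⟩⟩ : ∃ tm : FinTM2, Nonempty (tm.Γ tm.k₀ ≃ Bool) ∧
      Nonempty (tm.Γ tm.k₁ ≃ Bool) := ⟨idComputer Bool, ⟨.refl Bool⟩, ⟨.refl Bool⟩⟩
  have := tm.kFin
  have := tm.ΛFin
  have := tm.σFin
  have : Fintype (Lab tm c₀) := Fintype.ofFinite _
  have : Fintype (Mem tm) := Fintype.ofFinite _
  let M : FinTM2 := {
    K := Option (Fin (N + 1) ⊕ tm.K)
    k₀ := none
    k₁ := stack tm N 1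
    Γ := Alph tm N
    Λ := Lab tm c₀
    main := lab tm c₀ [c₀]
    σ := Mem tm
    initialState := (none, tm.initialState)
    Γk₀Fin := inferInstanceAs (Fintype (Bool ⊕ Bool))
    m := prog tm ia oa c₀ N }
  let aux : TM2ComputableAux (Bool ⊕ Bool) Bool := ⟨M, Equiv.refl _, Equiv.refl _⟩
  obtain ⟨D, hD⟩ : PolyBdd fun m => 26 * m + (4 * m + 3 + 2) ^ d + 2 * p (4 * m + 3) + 30 :=
    .add (.add (.add (.mul (.const _) .id)
      (.pow (.add (.add (.mul (.const _) .id) (.const _)) (.const _)) d))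
      (.mul (.const _) (hp.comp (.add (.mul (.const _) .id) (.const _))))) (.const _)
  suffices H : ∀ q : List Bool × List Bool, aux.Outputs (q.1.map .inl ++ q.2.map .inr)
      [isNode (v (.node (ofBits q.1) (ofBits q.2)))]
      (((Polynomial.X + Polynomial.C 2 : Polynomial ℕ) ^ D).eval
        (q.1.map .inl ++ q.2.map .inr : List (Bool ⊕ Bool)).length) from
    ⟨{ toTM2ComputableAux := aux
       time := (Polynomial.X + Polynomial.C 2) ^ D
       outputsFun := fun q => Classical.choice ((aux.outputs_iff _ _ _).1 (H q)) }⟩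
  rintro ⟨x, w⟩
  have hroot : conts c₀ [] ⊆ insert [] (conts c₀ []) := Set.subset_insert _ _
  have s₀ : ℕ → List Bool := fun _ => []
  set y := BTree.node (ofBits x) (ofBits w) with hy
  have h1 := reachIn_seq tm ia oa (N := N) (hroot (mem_conts_self _ _)) (none, tm.initialState)
    (x.map .inl ++ w.map .inr) (st s₀ 0 [[], [], [], []]) fun _ => []
  have h2 := reachIn_readPair tm ia oa (c₀ := c₀) (κ := [decidePair (c 0)])
    (fun z hz => hroot (by rw [hc₀, conts]; exact Or.inr (Or.inl hz))) (N := N) (by omega)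
    tm.initialState s₀ (fun _ => []) x w [] [] none
  rw [List.append_nil, List.append_nil] at h2
  obtain ⟨o, h3⟩ := (runs_decidePair (hc 0 s₀ y)).reachIn tm ia oa (N := N) (c₀ := c₀) hN.2 (κ := [])
    (fun z hz => hroot (by rw [hc₀, conts]; exact Or.inr (Or.inr hz))) (Set.mem_insert _ _)
    none tm.initialState [] (fun _ => [])
  have h4 := reachIn_halt tm ia oa (c₀ := c₀) (N := N) (o, tm.initialState) []
    (st s₀ 0 [[], [isNode (v y)]]) (fun _ => [])
  have h5 := h1.trans (h2.trans (h3.trans h4))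
  have e1 : st s₀ 0 [[], [], [], []] = fun _ => [] := by
    funext j
    match j with
    | 0 => rfl
    | 1 => rfl
    | 2 => rfl
    | 3 => rfl
    | j + 4 => rfl
  have e2 : allStk tm N [] (st s₀ 0 [[], [isNode (v y)]]) (fun _ => []) =
      Function.update (β := fun k => List (Alph tm N k)) (fun _ => []) (stack tm N 1)
        [isNode (v y)] := by
    have h6 := update_stack tm N (x := []) (s := fun _ => []) (S := fun _ => []) (k := 1)
      (by omega) [isNode (v y)]
    have h7 : allStk tm N [] (fun _ => []) (fun _ => []) = fun _ => [] := by
      funext j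
      match j with
      | none => rfl
      | some (.inl _) => rfl
      | some (.inr _) => rfl
    have h8 : st s₀ 0 [[], [isNode (v y)]] = Function.update (fun _ => []) 1 [isNode (v y)] := by
      funext j
      match j with
      | 0 => rfl
      | 1 => rfl
      | j + 2 => rfl
    rw [h8, ← h6, h7]
  have e3 : cfg tm c₀ N [c₀] (none, tm.initialState) (x.map .inl ++ w.map .inr) (fun _ => [])
      (fun _ => []) = ⟨some (lab tm c₀ [c₀]), (none, tm.initialState),
        Function.update (β := fun k => List (Alph tm N k)) (fun _ => []) none
          (x.map .inl ++ w.map .inr)⟩ := by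
    unfold cfg
    congr 1
    funext j
    match j with
    | none => rfl
    | some (.inl _) => rfl
    | some (.inr _) => rfl
  rw [e1, e2, e3] at h5
  obtain ⟨j, hj, h6⟩ := h5
  refine ⟨j, hj.trans ?_, ?_⟩
  · have hsz : size y ≤ 4 * (x.length + w.length) + 3 := by
      have h1 := size_ofBits x
      have h2 := size_ofBits w
      rw [hy, size_node]; omega
    have h7 : (size y + 2) ^ d ≤ (4 * (x.length + w.length) + 3 + 2) ^ d :=
      Nat.pow_le_pow_left (by omega) d
    have h8 := (hps y).trans (hpm hsz)
    have h9 := hD (x.length + w.length)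
    simp only [Polynomial.eval_pow, Polynomial.eval_add, Polynomial.eval_X, Polynomial.eval_C,
      List.length_append, List.length_map]
    refine le_trans ?_ h9
    dsimp only
    omega
  · rw [← List.map_id (x.map Sum.inl ++ w.map Sum.inr)] at h6
    exact h6

/-! ### Quantifiers -/

/-- If `P = NP`, then `FP` is closed under existential quantification over strings of polynomial
length. -/
theorem exists_FP_exists_bits (hPNP : ClassP = ClassNP) {v : BTree → BTree} (hv : FP v)
    (q : Polynomial ℕ) :
    ∃ F, FP F ∧ ∀ t, isNode (F t) = true ↔
      ∃ w : List Bool, w.length ≤ q.eval (size t) ∧ isNode (v (node t (ofBits w))) = true := by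
  have hv' : FP fun x => v (node (parse (car x)) (cdr x)) := hv.comp (by fun_prop)
  -- Languages consist of strings, so trees are passed as their preorder codes via `ser` and
  -- recovered by `parse`. The code of `t` has length `size t`, so the bound on the witness is
  -- unchanged.
  let L : Language Bool := {x | ∃ w : List Bool, w.length ≤ q.eval x.length ∧
    isNode (v (node (parse (ofBits x)) (ofBits w))) = true}
  have hL : L ∈ ClassP := by
    rw [hPNP]
    exact ⟨_, q, hv'.polyTime, fun x => Iff.rfl⟩
  obtain ⟨F, hF, hF'⟩ := exists_FP_of_polyTime hL (readable_bits _)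
  refine ⟨fun t => car (F (ser t)), by fun_prop, fun t => ?_⟩
  have h1 : F (ser t) = _ := hF' (code t)
  dsimp only
  rw [h1]
  have h2 := parse_code t []
  rw [List.append_nil] at h2
  simp only [encodeBool, List.pure_def, ofBits_cons, car_node, isNode_bit, decide_eq_true_eq]
  change (∃ w : List Bool, _ ∧ isNode (v (node (parse (ofBits (code t))) (ofBits w))) = true) ↔ _
  rw [h2]
  rfl

/-! ### Binary representations of numbers and quantification over numbers -/

theorem exists_encodePosNum (u : List Bool) : ∃ p : PosNum, encodePosNum p = u ++ [true] := by
  induction u with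
  | nil => exact ⟨.one, rfl⟩
  | cons b u ih =>
    obtain ⟨p, hp⟩ := ih
    cases b
    · exact ⟨.bit0 p, by simp [encodePosNum, hp]⟩
    · exact ⟨.bit1 p, by simp [encodePosNum, hp]⟩

theorem encodePosNum_eq (p : PosNum) : ∃ u, encodePosNum p = u ++ [true] := by
  induction p with
  | one => exact ⟨[], rfl⟩
  | bit0 p ih => obtain ⟨u, hu⟩ := ih; exact ⟨false :: u, by simp [encodePosNum, hu]⟩
  | bit1 p ih => obtain ⟨u, hu⟩ := ih; exact ⟨true :: u, by simp [encodePosNum, hu]⟩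

theorem encodeNat_cast_posNum (p : PosNum) : encodeNat (p : ℕ) = encodePosNum p := by
  have : (((p : ℕ) : ℕ) : Num) = Num.pos p := by
    rw [← Num.cast_pos, Num.of_to_nat]
  rw [encodeNat, this, encodeNum]

theorem eq_zero_or_eq_posNum (m : ℕ) : m = 0 ∨ ∃ p : PosNum, m = p := by
  have h := Num.to_of_nat m
  cases hm : (m : Num) with
  | zero => left; rw [hm] at h; exact h.symm
  | pos p => right; rw [hm] at h; exact ⟨p, h.symm⟩

theorem encodeNat_zero : encodeNat 0 = [] := rfl

theorem exists_encodeNat_eq_append (u : List Bool) : ∃ m, encodeNat m = u ++ [true] := by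
  obtain ⟨p, hp⟩ := exists_encodePosNum u
  exact ⟨p, by rw [encodeNat_cast_posNum, hp]⟩

theorem encodeNat_eq (m : ℕ) : encodeNat m = [] ∨ ∃ u, encodeNat m = u ++ [true] := by
  rcases eq_zero_or_eq_posNum m with rfl | ⟨p, rfl⟩
  · exact .inl rfl
  · rw [encodeNat_cast_posNum]
    exact .inr (encodePosNum_eq p)

theorem lt_two_pow_length_encodeNat (m : ℕ) : m < 2 ^ (encodeNat m).length := by
  rcases eq_zero_or_eq_posNum m with rfl | ⟨p, rfl⟩
  · simp [encodeNat_zero]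
  · rw [encodeNat_cast_posNum]
    induction p with
    | one => simp [encodePosNum]
    | bit0 p ih => simp only [encodePosNum, List.length_cons, pow_succ, PosNum.cast_bit0]; omega
    | bit1 p ih => simp only [encodePosNum, List.length_cons, pow_succ, PosNum.cast_bit1]; omega

theorem two_pow_length_encodeNat_le (m : ℕ) : 2 ^ (encodeNat m).length ≤ 2 * m + 1 := by
  rcases eq_zero_or_eq_posNum m with rfl | ⟨p, rfl⟩
  · simp [encodeNat_zero]
  · rw [encodeNat_cast_posNum]
    refine le_trans (b := 2 * (p : ℕ)) ?_ (by omega)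
    induction p with
    | one => simp [encodePosNum]
    | bit0 p ih => simp only [encodePosNum, List.length_cons, pow_succ, PosNum.cast_bit0]; omega
    | bit1 p ih => simp only [encodePosNum, List.length_cons, pow_succ, PosNum.cast_bit1]; omega

/-- If `P = NP`, then `FP` is closed under existential quantification over numbers of polynomial
length. -/
theorem exists_FP_exists_nat (hPNP : ClassP = ClassNP) {v : BTree → BTree} (hv : FP v)
    (q : Polynomial ℕ) :
    ∃ F, FP F ∧ ∀ t, isNode (F t) = true ↔ ∃ m : ℕ, (encodeNat m).length ≤ q.eval (size t) ∧
      isNode (v (node t (ofBits (encodeNat m)))) = true := by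
  -- The empty string stands for 0. A nonempty string `b :: u` stands for the number with bits `u`
  -- followed by the leading bit `true`; the symbol `b` is a dummy that makes the lengths agree.
  have hv' : FP fun x => v (node (car x) (sel (cdr x) leaf (app (cdr (cdr x)) (ofBits [true])))) :=
    hv.comp (by fun_prop)
  obtain ⟨F, hF, hF'⟩ := exists_FP_exists_bits hPNP hv' q
  refine ⟨F, hF, fun t => (hF' t).trans ⟨?_, ?_⟩⟩
  · rintro ⟨w, hw, h⟩
    rcases w with _ | ⟨b, u⟩
    · exact ⟨0, by simp [encodeNat_zero], h⟩
    · obtain ⟨m, hm⟩ := exists_encodeNat_eq_append u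
      refine ⟨m, by simpa [hm] using hw, ?_⟩
      rw [hm, ← app_ofBits]
      exact h
  · rintro ⟨m, hm, h⟩
    rcases encodeNat_eq m with h0 | ⟨u, hu⟩
    · exact ⟨[], by simp, by rw [h0] at h; exact h⟩
    · refine ⟨false :: u, by simpa [hu] using hm, ?_⟩
      rw [hu, ← app_ofBits] at h
      exact h

/-! ### The output bits of uniform circuits -/

theorem Circuit.value_eq {n m : ℕ} (C : Circuit n m) (x : Fin n → Bool) (g : Fin C.size) :
    C.value x g = match C.kind g with
      | .input i => x i
      | .not => !decide (∃ h, C.wire h g = true ∧ C.value x h = true)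
      | .and => decide (∀ h, C.wire h g = true → C.value x h = true)
      | .or => decide (∃ h, C.wire h g = true ∧ C.value x h = true) := by
  unfold Circuit.value
  rw [WellFounded.fix_eq]
  cases C.kind g <;> simp

/-- Gate indices of a circuit of polynomial size are of length linear in that of `n`. This is why
quantifying over gates is a polynomially bounded quantifier relative to `n` in binary. -/
theorem length_encodeNat_le_of_lt {n c h : ℕ} (hh : h < n ^ c + c) :
    (encodeNat h).length ≤ c * (encodeNat n).length + c + 2 := by
  have h1 := two_pow_length_encodeNat_le h
  have h2 := lt_two_pow_length_encodeNat n
  set a := (encodeNat n).length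
  have h3 : n ^ c ≤ 2 ^ (c * a) := by
    rw [mul_comm, pow_mul]; exact Nat.pow_le_pow_left h2.le c
  have h4 : c < 2 ^ c := Nat.lt_two_pow_self
  have h5 : (2 : ℕ) ^ (c * a) ≤ 2 ^ (c * a + c) := Nat.pow_le_pow_right (by omega) (by omega)
  have h6 : (2 : ℕ) ^ c ≤ 2 ^ (c * a + c) := Nat.pow_le_pow_right (by omega) (by omega)
  refine (Nat.pow_le_pow_iff_right (a := 2) (by omega)).1 (h1.trans ?_)
  rw [pow_add _ _ 2]
  omega

/-- Induction on the rank: the value of a gate is a bounded quantifier applied to wire queries and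
to values at smaller ranks, and `P = NP` removes the quantifier. The degree of the polynomial may
increase with each level, which is harmless since the number of levels is constant. -/
theorem exists_FP_value (hPNP : ClassP = ClassNP) {m : ℕ → ℕ} {C : ∀ n, Circuit n (m n)}
    {c : ℕ} (hc : ∀ n, (C n).size ≤ n ^ c + c)
    (hkind : PolyTime (encodingProd encodingNatBool encodingNatBool) (id : List Bool → List Bool)
      (fun q : ℕ × ℕ => (C q.1).kindQuery q.2))
    (hwire : PolyTime (encodingProd encodingNatBool (encodingProd encodingNatBool encodingNatBool))
      encodeBool (fun q : ℕ × ℕ × ℕ => (C q.1).wireQuery q.2.1 q.2.2))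
    {ρ : ∀ n, Fin (C n).size → ℕ} (hρ : ∀ n h g, (C n).wire h g = true → ρ n h < ρ n g) (d : ℕ) :
    ∃ V, FP V ∧ ∀ n (g : Fin (C n).size), ρ n g < d →
      isNode (V (node (ofBits (encodeNat n)) (ofBits (encodeNat g)))) =
        (C n).value (fun _ => true) g := by
  obtain ⟨KF, hKF, hK⟩ := exists_FP_of_polyTime hkind ((readable_bits _).prod (readable_bits _))
  obtain ⟨WF, hWF, hW⟩ := exists_FP_of_polyTime hwire
    ((readable_bits _).prod ((readable_bits _).prod (readable_bits _)))
  induction d with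
  | zero => exact ⟨fun x => x, FP.id, fun n g h => absurd h (Nat.not_lt_zero _)⟩
  | succ d ih =>
    obtain ⟨V, hV, hVv⟩ := ih
    have hE : FP fun x => andT (car (WF (node (car (car x)) (node (cdr x) (cdr (car x))))))
        (V (node (car (car x)) (cdr x))) := by fun_prop
    have hN : FP fun x => andT (car (WF (node (car (car x)) (node (cdr x) (cdr (car x))))))
        (notT (V (node (car (car x)) (cdr x)))) := by fun_prop
    let q : Polynomial ℕ := Polynomial.C c * Polynomial.X + Polynomial.C (c + 2)
    obtain ⟨E, hEF, hE'⟩ := exists_FP_exists_nat hPNP hE q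
    obtain ⟨N, hNF, hN'⟩ := exists_FP_exists_nat hPNP hN q
    -- The case distinction follows the two leading bits of `GateKind.code`. An input gate carries
    -- `true` because the input is `1^n`, and an AND gate is the negation of the existence of a
    -- false predecessor.
    refine ⟨fun t => sel (car (KF t)) (sel (car (cdr (KF t))) (bit true) (notT (E t)))
      (sel (car (cdr (KF t))) (notT (N t)) (E t)), by fun_prop, fun n g hg => ?_⟩
    set t := node (ofBits (encodeNat n)) (ofBits (encodeNat g)) with ht
    have hlen : ∀ h : Fin (C n).size, (encodeNat h).length ≤ q.eval (size t) := by
      intro h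
      have h1 := length_encodeNat_le_of_lt (h.2.trans_le (hc n))
      have h2 : (encodeNat n).length ≤ size t := by
        have := length_le_size_ofBits (encodeNat n)
        rw [ht, size_node]; omega
      have h3 : c * (encodeNat n).length ≤ c * size t := Nat.mul_le_mul_left _ h2
      simp only [q, Polynomial.eval_add, Polynomial.eval_mul, Polynomial.eval_C, Polynomial.eval_X]
      omega
    have hwq : ∀ h : ℕ, isNode (car (WF (node (ofBits (encodeNat n))
        (node (ofBits (encodeNat h)) (ofBits (encodeNat g)))))) = (C n).wireQuery h g := by
      intro h
      have h1 : WF (node (ofBits (encodeNat n)) (node (ofBits (encodeNat h))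
        (ofBits (encodeNat g)))) = ofBits (encodeBool ((C n).wireQuery h g)) := hW (n, h, g)
      rw [h1]
      simp [encodeBool, ofBits_cons]
    have hwq' : ∀ h : ℕ, (C n).wireQuery h g = true ↔
        ∃ hh : h < (C n).size, (C n).wire ⟨h, hh⟩ g = true := by
      intro h
      simp [Circuit.wireQuery]
    have hEv : isNode (E t) = decide (∃ h, (C n).wire h g = true ∧
        (C n).value (fun _ => true) h = true) := by
      rw [Bool.eq_iff_iff, hE', decide_eq_true_iff]
      simp only [ht, car_node, cdr_node, isNode_andT, hwq, Bool.and_eq_true, hwq']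
      constructor
      · rintro ⟨h, -, ⟨hh, h1⟩, h2⟩
        have := hρ n _ _ h1
        rw [hVv n ⟨h, hh⟩ (by omega)] at h2
        exact ⟨_, h1, h2⟩
      · rintro ⟨h, h1, h2⟩
        have := hρ n _ _ h1
        exact ⟨h, hlen h, ⟨h.2, h1⟩, (hVv n h (by omega)).trans h2⟩
    have hNv : isNode (N t) = decide (∃ h, (C n).wire h g = true ∧
        (C n).value (fun _ => true) h = false) := by
      rw [Bool.eq_iff_iff, hN', decide_eq_true_iff]
      simp only [ht, car_node, cdr_node, isNode_andT, hwq, Bool.and_eq_true, hwq', isNode_notT,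
        Bool.not_eq_true']
      constructor
      · rintro ⟨h, -, ⟨hh, h1⟩, h2⟩
        have := hρ n _ _ h1
        rw [hVv n ⟨h, hh⟩ (by omega)] at h2
        exact ⟨_, h1, h2⟩
      · rintro ⟨h, h1, h2⟩
        have := hρ n _ _ h1
        exact ⟨h, hlen h, ⟨h.2, h1⟩, (hVv n h (by omega)).trans h2⟩
    have hKt : KF t = ofBits ((C n).kind g).code := by
      have h1 : KF t = ofBits ((C n).kindQuery g) := hK (n, g)
      rw [h1, Circuit.kindQuery, dif_pos g.2]
    dsimp only
    rw [Circuit.value_eq, hKt]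
    cases (C n).kind g with
    | input i => simp [GateKind.code, ofBits_cons]
    | not => simp [GateKind.code, ofBits_cons, hEv]
    | and =>
      rw [Bool.eq_iff_iff]
      simp [GateKind.code, ofBits_cons, hNv]
    | or => simp [GateKind.code, ofBits_cons, hEv]

/-- If `P = NP`, then the output bits of uniform `AC⁰` circuits on `1^n` are in `FP`. -/
theorem exists_FP_eval (hPNP : ClassP = ClassNP) {m : ℕ → ℕ} {C : ∀ n, Circuit n (m n)}
    (hC : PolylogtimeUniformAC0 C) :
    ∃ B, FP B ∧ ∀ n (j : Fin (m n)),
      isNode (B (node (ofBits (encodeNat n)) (ofBits (encodeNat j)))) =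
        (C n).eval (fun _ => true) j := by
  obtain ⟨⟨c, hc⟩, ⟨d, hd⟩, hkind, hwire, F, hF, hFo⟩ := hC
  choose ρ hρ hρd using hd
  obtain ⟨V, hV, hV'⟩ := exists_FP_value hPNP hc hkind hwire hρ (d + 1)
  obtain ⟨O, hO, hO'⟩ := exists_FP_of_polyTime hF ((readable_bits _).prod (readable_bits _))
  refine ⟨fun x => V (node (car x) (O x)), by fun_prop, fun n j => ?_⟩
  have h1 : O (node (ofBits (encodeNat n)) (ofBits (encodeNat j))) =
    ofBits (encodeNat (F (n, j))) := hO' (n, j)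
  dsimp only
  rw [h1, hFo, car_node, hV' n _ (Nat.lt_succ_of_le (hρd n _))]
  rfl

theorem length_encodeNat_le (m : ℕ) : (encodeNat m).length ≤ m := by
  induction m with
  | zero => simp [encodeNat_zero]
  | succ m ih =>
    rw [encodeNat_succ]
    exact (length_incBits_le _).trans (by omega)

theorem length_encodeNat_mono {m n : ℕ} (h : m ≤ n) :
    (encodeNat m).length ≤ (encodeNat n).length := by
  have h1 := two_pow_length_encodeNat_le m
  have h2 := lt_two_pow_length_encodeNat n
  have h3 : 2 ^ (encodeNat m).length < 2 ^ ((encodeNat n).length + 1) := by rw [pow_succ]; omega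
  have := (Nat.pow_lt_pow_iff_right (a := 2) (by omega)).1 h3
  omega

theorem encodeNat_injective : Function.Injective encodeNat := fun m n h => by
  rw [← decode_encodeNat m, h, decode_encodeNat]

namespace BTree

theorem size_ofList (l : List BTree) : size (ofList l) = (l.map fun a => size a + 1).sum + 1 := by
  induction l with
  | nil => rfl
  | cons a l ih => simp [ih]; omega

/-! ### Candidate predictors

A predictor is a machine together with the data needed for feeding two bit strings to it and for
reading its output. -/

/-- The prediction of `e` for the bit with index `j`, within the time given by the size of `t`. -/
def predict (e n j t : BTree) : BTree :=
  car (mapT (car (cdr (cdr (cdr e)))) (nthT (car (cdr (cdr e))) (cdr (simT (car e)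
    (node (car (cdr e)) (node (app (mapT (car (cdr (cdr (cdr (cdr e))))) n)
      (mapT (cdr (cdr (cdr (cdr (cdr e))))) j)) leaf)) t))))

/-- The list of all bit strings encoding numbers up to the size of `t`. -/
def candidates (t : BTree) : BTree := (fun s => node (incT (car s)) s)^[size t] (node leaf leaf)

theorem candidates_aux (j : ℕ) : (fun s => node (incT (car s)) s)^[j] (node leaf leaf) =
    ofList ((List.range (j + 1)).reverse.map fun i => ofBits (encodeNat i)) := by
  induction j with
  | zero => rfl
  | succ j ih =>
    rw [Function.iterate_succ_apply', ih, List.range_succ (n := j + 1), List.range_succ (n := j)]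
    simp only [List.reverse_append, List.reverse_singleton, List.cons_append, List.nil_append,
      List.map_cons, ofList_cons, car_node, incT_ofBits, encodeNat_succ]

theorem size_candidates_aux_le (j : ℕ) :
    size ((fun s => node (incT (car s)) s)^[j] (node leaf leaf)) ≤ (j + 1) * (4 * j + 2) + 1 := by
  rw [candidates_aux, size_ofList, List.map_map, Nat.add_le_add_iff_right]
  refine (List.sum_le_card_nsmul _ (4 * j + 2) ?_).trans (by simp)
  simp only [List.mem_map, Function.comp_apply, forall_exists_index, and_imp, List.mem_reverse,
    List.mem_range]
  rintro _ i hi rfl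
  have h1 := size_ofBits (encodeNat i)
  have h2 := length_encodeNat_le i
  omega

theorem mem_candidates (t : BTree) : ∃ l, candidates t = ofList l ∧
    ∀ m ≤ size t, ofBits (encodeNat m) ∈ l :=
  ⟨_, candidates_aux _, fun m hm => List.mem_map.2 ⟨m, by simp; omega, rfl⟩⟩

/-- Keeping a candidate if its prediction agrees with the bit read. -/
def keep (c acc e : BTree) : BTree :=
  sel (sel (cdr (cdr (cdr c))) (notT (predict (parse e) (car c) (car (cdr (cdr c))) (car (cdr c))))
    (predict (parse e) (car c) (car (cdr (cdr c))) (car (cdr c)))) acc (node e acc)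

theorem foldT_keep (n t j : BTree) (b : Bool) (l : List BTree) :
    foldT (keep (node n (node t (node j (bit b))))) leaf (ofList l) =
      ofList (l.filter fun e => isNode (predict (parse e) n j t) == b).reverse := by
  have key : ∀ acc : List BTree, l.foldl (keep (node n (node t (node j (bit b))))) (ofList acc) =
      ofList ((l.filter fun e => isNode (predict (parse e) n j t) == b).reverse ++ acc) := by
    induction l with
    | nil => intro acc; rfl
    | cons e l ih =>
      intro acc
      have h1 : keep (node n (node t (node j (bit b)))) (ofList acc) e =
          if (isNode (predict (parse e) n j t) == b) = true then ofList (e :: acc)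
          else ofList acc := by
        simp only [keep, car_node, cdr_node]
        rw [sel_eq_cond]
        cases b <;> cases h : isNode (predict (parse e) n j t) <;> simp [h]
      rw [List.foldl_cons, h1, List.filter_cons]
      split_ifs with h
      · rw [ih]; simp
      · rw [ih]
  rw [foldT_ofList, ← ofList_nil, key, List.append_nil]

/-- The states of the streaming algorithm: `n`, the time bound, the index of the next bit, whether
the second half of the input is being read, the remaining candidates, and the answer so far. -/
def mkState (n t j ph al fl : BTree) : BTree := node n (node t (node j (node ph (node al fl))))

/-- The initial state. -/
def initState (x : BTree) : BTree := mkState (car x) (cdr x) leaf leaf (candidates (cdr x)) leaf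

/-- Reading a bit `b`. -/
def readBit (b n t j ph al fl : BTree) : BTree :=
  -- In the first half a bit filters the candidates, and the index restarts from 0 when it reaches
  -- `n`. In the second half the head of the list of survivors supplies the bit of `x` to be
  -- compared.
  sel ph
    (sel (eqT (incT j) n)
      (mkState n t (incT j) leaf (foldT (keep (node n (node t (node j b)))) leaf al) fl)
      (mkState n t leaf (node leaf leaf) (foldT (keep (node n (node t (node j b)))) leaf al) fl))
    (mkState n t (incT j) ph al (sel fl (andT (predict (parse (car al)) n j t) b) fl))

/-- The transition function. -/
def nextState (y : BTree) : BTree :=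
  readBit (car y) (car (cdr y)) (car (cdr (cdr y))) (car (cdr (cdr (cdr y))))
    (car (cdr (cdr (cdr (cdr y))))) (car (cdr (cdr (cdr (cdr (cdr y))))))
    (cdr (cdr (cdr (cdr (cdr (cdr y))))))

/-- The answer. -/
def finState (w : BTree) : BTree := cdr (cdr (cdr (cdr (cdr w))))

theorem nextState_mkState (b n t j ph al fl : BTree) :
    nextState (node b (mkState n t j ph al fl)) = readBit b n t j ph al fl := rfl

end BTree

namespace FP

@[fun_prop]
theorem predict {e n j t : BTree → BTree} (he : FP e) (hn : FP n) (hj : FP j) (ht : FP t) :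
    FP fun x => predict (e x) (n x) (j x) (t x) := by
  unfold BTree.predict
  fun_prop

@[fun_prop]
theorem candidates : FP BTree.candidates := by
  refine iterate (n := fun x => x) (a := fun _ => .node .leaf .leaf) (by fun_prop) (by fun_prop)
    (by fun_prop) (fun m => (m + 1) * (4 * m + 2) + 1)
    (.add (.mul (.add .id (.const _)) (.add (.mul (.const _) .id) (.const _))) (.const _)) ?_
  intro x j hj
  refine (size_candidates_aux_le j).trans ?_
  gcongr

@[fun_prop]
theorem foldT_keep {c l : BTree → BTree} (hc : FP c) (hl : FP l) :
    FP fun x => BTree.foldT (keep (c x)) .leaf (l x) := by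
  refine foldT (h := keep) (by unfold keep; fun_prop) 1 (fun c acc a => ?_) hc (by fun_prop) hl
  unfold keep
  rw [sel_eq_cond]
  cases isNode _
  · simp
  · simp only [cond_true, size_node]
    have := size_pos c
    omega

@[fun_prop]
theorem initState : FP BTree.initState := by
  unfold BTree.initState mkState
  fun_prop

@[fun_prop]
theorem nextState : FP BTree.nextState := by
  unfold BTree.nextState readBit mkState
  fun_prop

@[fun_prop]
theorem finState : FP BTree.finState := by
  unfold BTree.finState
  fun_prop

end FP

/-! ### Invariants and correctness of the prediction algorithm -/

namespace BTree

/-- The state after the first `i` bits of `z`. -/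
def stateSeq (n t : BTree) (z : ℕ → Bool) : ℕ → BTree
  | 0 => initState (node n t)
  | i + 1 => nextState (node (bit (z i)) (stateSeq n t z i))

theorem size_ofList_le_of_subperm {l m : List BTree} (h : l.Subperm m) :
    size (ofList l) ≤ size (ofList m) := by
  obtain ⟨l', hl', hs⟩ := h
  have h1 := (hl'.map fun a => size a + 1).sum_eq
  have h2 := (hs.map fun a => size a + 1).sum_le_sum (by simp)
  rw [size_ofList, size_ofList]
  omega

/-- The survivors are the candidates consistent with everything read so far. Each filtering reverses
the list, so it is compared with the initial one only up to permutation, which suffices for the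
size. The phase changes when the bit with index `n - 1` is read, hence the condition `0 < n`. -/
theorem stateSeq_first {n : ℕ} (t : BTree) (z : ℕ → Bool) {l₀ : List BTree}
    (hl₀ : candidates t = ofList l₀) (i : ℕ) (hi : i ≤ n) (h0 : 0 < n) :
    ∃ l, l.Subperm l₀ ∧ (∀ e, e ∈ l ↔ e ∈ l₀ ∧ ∀ j < i, isNode (predict (parse e)
        (ofBits (encodeNat n)) (ofBits (encodeNat j)) t) = z j) ∧
      stateSeq (ofBits (encodeNat n)) t z i = if i < n
        then mkState (ofBits (encodeNat n)) t (ofBits (encodeNat i)) leaf (ofList l) leaf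
        else mkState (ofBits (encodeNat n)) t leaf (node leaf leaf) (ofList l) leaf := by
  induction i with
  | zero =>
    refine ⟨l₀, List.Subperm.refl _, by simp, ?_⟩
    rw [if_pos h0, ← hl₀]
    rfl
  | succ i ih =>
    obtain ⟨l, hs, hl, h⟩ := ih (by omega)
    rw [if_pos (by omega)] at h
    refine ⟨_, ((List.reverse_perm _).subperm.trans (List.filter_sublist
      (p := fun e => isNode (predict (parse e) (ofBits (encodeNat n)) (ofBits (encodeNat i)) t) ==
        z i)).subperm).trans hs, fun e => ?_, ?_⟩
    · simp only [List.mem_reverse, List.mem_filter, hl, beq_iff_eq, Nat.forall_lt_succ_right]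
      tauto
    · rw [stateSeq, h, nextState_mkState, readBit, foldT_keep, incT_ofBits, ← encodeNat_succ,
        sel_eq_cond (eqT _ _), isNode_eqT]
      have : encodeNat (i + 1) = encodeNat n ↔ ¬ i + 1 < n :=
        encodeNat_injective.eq_iff.trans (by omega)
      by_cases hin : i + 1 < n
      · simp [this, hin, sel]
      · simp [this, hin, sel]

/-- Only the head of the list matters in the second half. The flag records whether some predicted
bit of `x` and the corresponding bit of `y` were both 1, and never falls back. -/
theorem stateSeq_second {n : ℕ} (t : BTree) (z : ℕ → Bool) {l : List BTree}
    (h : stateSeq (ofBits (encodeNat n)) t z n =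
      mkState (ofBits (encodeNat n)) t leaf (node leaf leaf) (ofList l) leaf) (i : ℕ) :
    ∃ fl, size fl ≤ 3 ∧ (isNode fl = true ↔ ∃ j < i, isNode (predict (parse (car (ofList l)))
        (ofBits (encodeNat n)) (ofBits (encodeNat j)) t) = true ∧ z (n + j) = true) ∧
      stateSeq (ofBits (encodeNat n)) t z (n + i) = mkState (ofBits (encodeNat n)) t
        (ofBits (encodeNat i)) (node leaf leaf) (ofList l) fl := by
  induction i with
  | zero => exact ⟨leaf, by simp, by simp, h⟩
  | succ i ih =>
    obtain ⟨fl, h1, h2, h3⟩ := ih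
    rw [← Nat.add_assoc, stateSeq, h3, nextState_mkState, readBit, incT_ofBits, ← encodeNat_succ]
    refine ⟨_, ?_, ?_, rfl⟩
    · rw [sel_eq_cond, andT, sel_eq_cond]
      cases isNode fl
      · cases isNode (predict _ _ _ _)
        · simp
        · cases z (n + i) <;> simp
      · exact h1
    · rw [sel_eq_cond]
      cases hfl : isNode fl
      · rw [hfl] at h2
        simp only [cond_false, isNode_andT, isNode_bit, Bool.and_eq_true, Nat.exists_lt_succ_right,
          ← h2, Bool.false_eq_true, false_or]
      · rw [hfl] at h2
        simp only [cond_true, hfl, Nat.exists_lt_succ_right, ← h2, true_or]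

/-- Filtering never lengthens the list of candidates, and indices are at most `n`, so no state is
much larger than the initial one. The bound is independent of the input and of the number of bits
read. -/
theorem size_stateSeq_le : ∃ p, PolyBdd p ∧ Monotone p ∧ ∀ (n : ℕ) (t : BTree) (z : ℕ → Bool),
    ∀ i ≤ n + n, size (stateSeq (ofBits (encodeNat n)) t z i) ≤
      p ((encodeNat n).length + size t) := by
  refine ⟨fun m => 8 * m + 30 + ((m + 1) * (4 * m + 2)), .add (.add (.mul (.const _) .id) (.const _))
    (.mul (.add .id (.const _)) (.add (.mul (.const _) .id) (.const _))), ?_, ?_⟩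
  · intro a b h
    dsimp only
    gcongr
  intro n t z i hi
  dsimp only
  set m := (encodeNat n).length + size t with hm
  have hcand : size (candidates t) ≤ (m + 1) * (4 * m + 2) + 1 :=
    (size_candidates_aux_le _).trans (by gcongr <;> omega)
  have hn := size_ofBits (encodeNat n)
  have main : ∀ i ≤ n, ∀ ph al fl, size ph ≤ 3 → size fl ≤ 3 → size al ≤ size (candidates t) →
      size (mkState (ofBits (encodeNat n)) t (ofBits (encodeNat i)) ph al fl) ≤
        8 * m + 30 + ((m + 1) * (4 * m + 2)) := by
    intro i hi ph al fl h1 h2 h3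
    have h4 := size_ofBits (encodeNat i)
    have h5 := length_encodeNat_mono hi
    have := size_pos t
    simp only [mkState, size_node]
    omega
  rcases Nat.eq_zero_or_pos n with rfl | h0
  · obtain rfl : i = 0 := by omega
    exact main 0 le_rfl leaf (candidates t) leaf (by simp) (by simp) le_rfl
  obtain ⟨l₀, hl₀⟩ := exists_ofList (candidates t)
  by_cases hin : i ≤ n
  · obtain ⟨l, hs, -, h⟩ := stateSeq_first (n := n) t z hl₀ i hin h0
    have hsz : size (ofList l) ≤ size (candidates t) := by
      rw [hl₀]; exact size_ofList_le_of_subperm hs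
    rw [h]
    split_ifs
    · exact main i hin _ _ _ (by simp) (by simp) hsz
    · exact main 0 (by omega) _ _ _ (by simp) (by simp) hsz
  · obtain ⟨l, hs, -, h⟩ := stateSeq_first (n := n) t z hl₀ n le_rfl h0
    rw [if_neg (lt_irrefl n)] at h
    have hsz : size (ofList l) ≤ size (candidates t) := by
      rw [hl₀]; exact size_ofList_le_of_subperm hs
    obtain ⟨k, rfl⟩ : ∃ k, i = n + k := ⟨i - n, by omega⟩
    obtain ⟨fl, h1, -, h3⟩ := stateSeq_second t z h k
    rw [h3]
    exact main k (by omega) _ _ _ (by simp) h1 hsz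

/-- Bits in `FP` are predicted correctly in polynomial time. -/
theorem exists_predictor {B : BTree → BTree} (hB : FP B) : ∃ e c, ∀ (n j : List Bool) (t : BTree),
    c * (n.length + j.length + 2) ^ c ≤ size t → isNode (predict e (ofBits n) (ofBits j) t) =
      isNode (B (node (ofBits n) (ofBits j))) := by
  obtain ⟨M⟩ := hB.polyTime
  obtain ⟨tbl, pc, ko, tb, sym, c, H⟩ := M.toTM2ComputableAux.exists_table
  obtain ⟨d, hd⟩ := PolyBdd.eval M.time
  -- The last two components translate bits into input symbols. Two of them are needed because the
  -- encoding of pairs marks the symbols of the two components differently.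
  refine ⟨node tbl (node pc (node ko (node tb (node (ofList [sym (.inl false), sym (.inl true)])
    (ofList [sym (.inr false), sym (.inr true)]))))), c + d, fun n j t ht => ?_⟩
  have h1 := H _ _ _ ((M.outputs_iff _ _ _).2 ⟨M.outputsFun (n, j)⟩) t ?_
  · have h2 : ∀ (g : Bool → Bool ⊕ Bool) (l : List Bool),
        mapT (ofList [sym (g false), sym (g true)]) (ofBits l) =
          ofList ((l.map g).map sym) := by
      intro g l
      simp only [ofBits, mapT_ofList, List.map_map]
      congr 2
      funext b
      cases b <;> rfl
    unfold predict
    simp only [car_node, cdr_node, h2, app_ofList]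
    rw [← List.map_append]
    have h3 : (encodingProd (encodingList Bool) (encodingList Bool)).encode (n, j) =
      n.map .inl ++ j.map .inr := rfl
    rw [h3] at h1
    rw [h1]
    simp [encodeBool]
  · refine le_trans ?_ ht
    have h3 : ((encodingProd (encodingList Bool) (encodingList Bool)).encode (n, j)).length =
        n.length + j.length := by
      change (n.map Sum.inl ++ j.map Sum.inr : List (Bool ⊕ Bool)).length = _
      simp
    rw [h3]
    calc _ ≤ c * (n.length + j.length + 2) ^ d := Nat.mul_le_mul_left _ (hd _)
      _ ≤ _ := Nat.mul_le_mul (by omega) (Nat.pow_le_pow_right (by omega) (by omega))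

/-- The streaming algorithm is correct on inputs whose bits are in `FP`. -/
theorem finState_stateSeq {B : BTree → BTree} (hB : FP B) : ∃ c, ∀ (n : ℕ) (t : BTree)
    (z : ℕ → Bool), 0 < n → (∀ j < n + n, isNode (B (node (ofBits (encodeNat n))
      (ofBits (encodeNat j)))) = z j) → c * ((encodeNat n).length + 2) ^ c ≤ size t →
    (isNode (finState (stateSeq (ofBits (encodeNat n)) t z (n + n))) = true ↔
      ∃ j < n, z j = true ∧ z (n + j) = true) := by
  obtain ⟨e, c, he⟩ := exists_predictor hB
  -- This number has as bits the code of the predictor and a leading one, so it is among the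
  -- candidates as soon as `size t` reaches `m`.
  obtain ⟨m, hm⟩ := exists_encodeNat_eq_append (code e)
  -- The summand `m` puts the predictor on the list, and `c * 2 ^ c` pays for the two arguments `n`
  -- and `j`, both of length at most that of `n`.
  refine ⟨c * 2 ^ c + m + c, fun n t z h0 hz ht => ?_⟩
  obtain ⟨l₀, hl₀, hmem⟩ := mem_candidates t
  obtain ⟨l, hs, hl, h⟩ := stateSeq_first (n := n) t z hl₀ n le_rfl h0
  rw [if_neg (lt_irrefl n)] at h
  obtain ⟨fl, h1, h2, h3⟩ := stateSeq_second t z h n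
  have hL : 1 ≤ ((encodeNat n).length + 2) ^ (c * 2 ^ c + m + c) := Nat.one_le_pow _ _ (by omega)
  have hmt : m ≤ size t := le_trans (by
    calc m ≤ c * 2 ^ c + m + c := by omega
      _ ≤ _ := Nat.le_mul_of_pos_right _ hL) ht
  have hct : c * ((encodeNat n).length + (encodeNat n).length + 2) ^ c ≤ size t := by
    refine le_trans ?_ ht
    calc c * ((encodeNat n).length + (encodeNat n).length + 2) ^ c
        ≤ c * (2 * ((encodeNat n).length + 2)) ^ c := by gcongr; omega
      _ = c * 2 ^ c * ((encodeNat n).length + 2) ^ c := by rw [mul_pow]; ring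
      _ ≤ _ := Nat.mul_le_mul (by omega) (Nat.pow_le_pow_right (by omega) (by omega))
  have hel : ofBits (encodeNat m) ∈ l := by
    refine (hl _).2 ⟨hmem m hmt, fun j hj => ?_⟩
    rw [hm, parse_code, he _ _ _ ?_, hz j (by omega)]
    refine le_trans ?_ hct
    have := length_encodeNat_mono hj.le
    gcongr
  rw [h3]
  change isNode fl = true ↔ _
  rw [h2]
  refine exists_congr fun j => and_congr_right fun hj => and_congr_left fun _ => ?_
  rw [Bool.coe_iff_coe]
  -- The head of the list need not be the predictor `e`. It is enough that `e` keeps the list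
  -- nonempty, because every survivor has predicted all `n` bits of the first half.
  cases l with
  | nil => simp at hel
  | cons a l => exact ((hl a).1 (by simp)).2 j hj

end BTree

namespace Com

/-! ### The preparation of the streaming algorithm -/

/-- Copying the parameter from stack `0`: reversed to stack `1`, and as a reversed code to
stack `2`. -/
def copyParam : Com :=
  loop (0 + 0) ((push (0 + 1) false).seq (pushes (0 + 2) (true :: code (bit false)).reverse))
    ((push (0 + 1) true).seq (pushes (0 + 2) (true :: code (bit true)).reverse))

theorem runs_copyParam (s : ℕ → List Bool) (x : List Bool) : ∀ a c : List Bool,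
    Runs copyParam (st s 0 [x, a, c]) (st s 0 [[], x.reverse ++ a, (bitsCode x).reverse ++ c])
      (15 * x.length + 1) := by
  induction x with
  | nil => exact fun a c => Runs.loop_nil (st_apply s 0 _ 0)
  | cons b x ih =>
    intro a c
    have hb : Runs ((push (0 + 1) b).seq (pushes (0 + 2) (true :: code (bit b)).reverse))
        (st s 0 [x, a, c]) (st s 0 [x, b :: a, (true :: code (bit b)).reverse ++ c])
        (1 + (2 * (true :: code (bit b)).reverse.length + 1) + 1) :=
      Runs.seq (Runs.push (L := [x, a, c]) (j := 1) (by simp))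
        (Runs.pushes (L := [x, b :: a, c]) (j := 2) (by simp) _)
    have hb' := hb.mono (T' := 12) (by cases b <;> simp [code])
    have hl := Runs.loop_cons (k := 0 + 0) (s := st s 0 [b :: x, a, c])
      (f := (push (0 + 1) false).seq (pushes (0 + 2) (true :: code (bit false)).reverse))
      (g := (push (0 + 1) true).seq (pushes (0 + 2) (true :: code (bit true)).reverse))
      (s' := st s 0 [x, b :: a, (true :: code (bit b)).reverse ++ c]) (b := b) (l := x) (T := 12)
      (st_apply s 0 _ 0)
      (by rw [st_update _ (by simp)]; cases b <;> exact hb')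
      (ih (b :: a) ((true :: code (bit b)).reverse ++ c))
    exact hl.of_eq (by simp [bitsCode]) (by simp; omega)

/-- Popping `k` symbols from stack `1`. -/
def pops : ℕ → Com
  | 0 => skip
  | k + 1 => (pop (0 + 1) skip skip skip).seq (pops k)

theorem runs_pops (s : ℕ → List Bool) (p b c e : List Bool) (k : ℕ) : ∀ a : List Bool,
    Runs (pops k) (st s 0 [p, a, b, c, e]) (st s 0 [p, a.drop k, b, c, e]) (4 * k + 1) := by
  induction k with
  | zero => exact fun a => ⟨1, le_rfl, .skip⟩
  | succ k ih =>
    intro a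
    have h1 : Runs (pop (0 + 1) skip skip skip) (st s 0 [p, a, b, c, e])
        (st s 0 [p, a.drop 1, b, c, e]) 2 := by
      cases a with
      | nil => exact Runs.pop_nil (st_apply s 0 _ 1) ⟨1, le_rfl, .skip⟩
      | cons y a =>
        refine Runs.pop_cons (b := y) (l := a) (st_apply s 0 _ 1) (T := 1) ?_
        rw [st_update _ (by simp)]
        cases y <;> exact ⟨1, le_rfl, .skip⟩
    exact (h1.seq (ih _)).of_eq (by rw [List.drop_drop]; rw [add_comm 1]) (by omega)

/-- Doubling the length of stack `3`. -/
def double : Com := (trans (0 + 3) (0 + 4) fun _ => [true, true]).seq (mv (0 + 4) (0 + 3))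

theorem foldl_replicate (w : List Bool) (m : ℕ) (acc : List Bool) :
    (List.replicate m true).foldl (fun acc _ => w ++ acc) acc =
      (List.replicate m w).flatten ++ acc := by
  induction m generalizing acc with
  | zero => rfl
  | succ m ih =>
    rw [List.replicate_succ, List.foldl_cons, ih, List.replicate_succ', List.flatten_append]
    simp

theorem runs_double (s : ℕ → List Bool) (p a b : List Bool) (m : ℕ) :
    Runs double (st s 0 [p, a, b, List.replicate m true, []])
      (st s 0 [p, a, b, List.replicate (2 * m) true, []]) (14 * m + 3) := by
  have h1 := Runs.trans (s := s) (i := 0) (j := 3) (k := 4) (fun _ => [true, true]) 2 (by simp)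
    (by simp) (List.replicate m true) [p, a, b, List.replicate m true, []] (by simp) (by simp) rfl
  have h2 : (List.replicate m [true, true]).flatten = List.replicate (2 * m) true := by
    rw [show [true, true] = List.replicate 2 true from rfl, List.flatten_replicate_replicate,
      mul_comm]
  rw [foldl_replicate, h2] at h1
  have h3 : Runs (mv (0 + 4) (0 + 3))
      (st s 0 [p, a, b, [], List.replicate (2 * m) true ++ []]) _ _ :=
    Runs.mv 4 3 (by simp) (by simp) (by simp)
  refine (h1.seq h3).of_eq ?_ ?_
  · simp
  · simp; omega

/-- Emptying stack `1` and doubling stack `3` for every `k + 1` symbols. -/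
def grow (k : ℕ) : Com := loop (0 + 1) ((pops k).seq double) ((pops k).seq double)

/-- Each round removes `k + 1` symbols, or the rest, so there are `⌈L / (k + 1)⌉` rounds. The time
is dominated by the doublings, a geometric series; with the term in `m` on the left the estimate
telescopes and gives a time linear in the final height for fixed `k`. -/
theorem runs_grow (s : ℕ → List Bool) (p b : List Bool) (k : ℕ) : ∀ (L : ℕ) (a : List Bool) (m : ℕ),
    a.length = L → 0 < m → ∃ T, T + (4 * k + 20) * m ≤ (4 * k + 20) * (m * 2 ^ ((L + k) / (k + 1))) + 1 ∧
    Runs (grow k) (st s 0 [p, a, b, List.replicate m true, []])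
      (st s 0 [p, [], b, List.replicate (m * 2 ^ ((L + k) / (k + 1))) true, []]) T := by
  intro L
  induction L using Nat.strong_induction_on with
  | _ L ih =>
    intro a m ha hm
    cases a with
    | nil =>
      obtain rfl : 0 = L := by simpa using ha
      have : (0 + k) / (k + 1) = 0 := Nat.div_eq_of_lt (by omega)
      rw [this, pow_zero, mul_one]
      exact ⟨1, by omega, Runs.loop_nil (st_apply s 0 _ 1)⟩
    | cons y a =>
      simp only [List.length_cons] at ha
      obtain ⟨T, hT, h⟩ := ih (a.drop k).length (by rw [List.length_drop]; omega) (a.drop k) (2 * m) rfl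
        (by omega)
      have hL : ((a.drop k).length + k) / (k + 1) + 1 = (L + k) / (k + 1) := by
        rw [List.length_drop, ← ha]
        by_cases hk : k ≤ a.length
        · rw [Nat.sub_add_cancel hk, show a.length + 1 + k = a.length + (k + 1) by omega,
            Nat.add_div_right _ (by omega)]
        · rw [Nat.sub_eq_zero_of_le (by omega), zero_add, Nat.div_eq_of_lt (by omega),
            show a.length + 1 + k = a.length + (k + 1) by omega, Nat.add_div_right _ (by omega),
            Nat.div_eq_of_lt (by omega)]
      have hm' : 2 * m * 2 ^ (((a.drop k).length + k) / (k + 1)) = m * 2 ^ ((L + k) / (k + 1)) := by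
        rw [← hL, pow_succ]; ring
      rw [hm'] at h hT
      have h1 := (runs_pops s p b (List.replicate m true) [] k a).seq (runs_double s p (a.drop k) b m)
      refine ⟨_, ?_, Runs.loop_cons (b := y) (l := a) (st_apply s 0 _ 1)
        (by rw [st_update _ (by simp)]; cases y <;> exact h1) h⟩
      have h2 : 14 * m + 4 * k + 6 ≤ (4 * k + 20) * m := by
        obtain ⟨m, rfl⟩ : ∃ m', m = m' + 1 := ⟨m - 1, by omega⟩
        nlinarith [Nat.zero_le (k * m)]
      have h3 : (4 * k + 20) * (2 * m) = (4 * k + 20) * m + (4 * k + 20) * m := by ring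
      omega

/-- Building the code of the pair of the parameter and a unary number from the stacks `1`
and `2`. -/
def buildPair (k : ℕ) : Com :=
  (push (0 + 3) true).seq <| (grow k).seq <| (push (0 + 0) false).seq <|
  (trans (0 + 3) (0 + 0) fun _ => [true, false]).seq <| (push (0 + 0) false).seq <|
  (mv (0 + 2) (0 + 0)).seq (push (0 + 0) true)

theorem code_num (r : ℕ) : code (num r) = (List.replicate r [true, false]).flatten ++ [false] := by
  induction r with
  | zero => rfl
  | succ r ih =>
    rw [num_succ, code, ih, List.replicate_succ, List.flatten_cons]
    rfl

/-- If `a` has the length of the binary representation of a number, the unary component is about the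
`(k + 1)`-st root of this number. It is obtained from the bit length alone, in time linear in the
root and in the length of `x`, for fixed `k`. -/
theorem runs_buildPair (s : ℕ → List Bool) (a x : List Bool) (k : ℕ) :
    Runs (buildPair k) (st s 0 [[], a, (bitsCode x).reverse, [], []])
      (st s 0 [code (node (ofBits x) (num (2 ^ ((a.length + k) / (k + 1)))))])
      ((4 * k + 30) * 2 ^ ((a.length + k) / (k + 1)) + 16 * x.length + 20) := by
  set r := 2 ^ ((a.length + k) / (k + 1)) with hr
  have h1 : Runs (push (0 + 3) true) (st s 0 [[], a, (bitsCode x).reverse, [], []])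
      (st s 0 [[], a, (bitsCode x).reverse, List.replicate 1 true, []]) 1 :=
    Runs.push (L := [[], a, (bitsCode x).reverse, [], []]) (j := 3) (by simp)
  obtain ⟨T, hT, h2⟩ := runs_grow s [] (bitsCode x).reverse k a.length a 1 rfl (by omega)
  rw [one_mul, ← hr] at hT h2
  have h3 : Runs (push (0 + 0) false) (st s 0 [[], [], (bitsCode x).reverse, List.replicate r true, []])
      (st s 0 [[false], [], (bitsCode x).reverse, List.replicate r true, []]) 1 :=
    Runs.push (L := [[], [], (bitsCode x).reverse, List.replicate r true, []]) (j := 0) (by simp)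
  have h4 := Runs.trans (s := s) (i := 0) (j := 3) (k := 0) (fun _ => [true, false]) 2 (by simp)
    (by simp) (List.replicate r true) [[false], [], (bitsCode x).reverse, List.replicate r true, []]
    (by simp) (by simp) rfl
  rw [foldl_replicate] at h4
  change Runs _ _ (st s 0 [(List.replicate r [true, false]).flatten ++ [false], [],
    (bitsCode x).reverse, [], []]) _ at h4
  rw [← code_num] at h4
  have h5 : Runs (push (0 + 0) false) (st s 0 [code (num r), [], (bitsCode x).reverse, [], []])
      (st s 0 [false :: code (num r), [], (bitsCode x).reverse, [], []]) 1 :=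
    Runs.push (L := [code (num r), [], (bitsCode x).reverse, [], []]) (j := 0) (by simp)
  have h6 : Runs (mv (0 + 2) (0 + 0))
      (st s 0 [false :: code (num r), [], (bitsCode x).reverse, [], []])
      (st s 0 [(bitsCode x).reverse.reverse ++ false :: code (num r), [], [], [], []])
      (4 * (bitsCode x).reverse.length + 1) := Runs.mv 2 0 (by simp) (by simp) (by simp)
  rw [List.reverse_reverse, List.length_reverse, List.append_cons, ← code_ofBits] at h6
  have h7 : Runs (push (0 + 0) true) (st s 0 [code (ofBits x) ++ code (num r), [], [], [], []])
    (st s 0 [code (node (ofBits x) (num r)), [], [], [], []]) 1 := Runs.push (j := 0) (by simp)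
  refine (h1.seq <| h2.seq <| h3.seq <| h4.seq <| h5.seq <| h6.seq h7).of_eq ?_ ?_
  · rw [st_pad1, st_pad2, st_pad3]
    exact (st_append_nil s 0 [_, [], [], []])
  · have e1 := length_bitsCode_le x
    rw [List.length_replicate]
    have e2 : (4 * k + 30) * r = (4 * k + 20) * r + 10 * r := by ring
    omega

end Com

/-! ### Space-bounded runs -/

namespace Turing.TM2

variable {K : Type} [DecidableEq K] {Γ : K → Type} {Λ σ : Type}

/-- The machine goes from `c` to `c'` in at most `T` steps, with at most `S` symbols on the
stacks in `F`. -/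
def SpaceReach (m : Λ → Stmt Γ Λ σ) (F : Finset K) (T S : ℕ) (c c' : Cfg Γ Λ σ) : Prop :=
  ∃ j ≤ T, StepsIn m j c c' ∧ ∀ i ≤ j, ∀ c'', StepsIn m i c c'' → ∑ k ∈ F, (c''.stk k).length ≤ S

variable {m : Λ → Stmt Γ Λ σ} {F : Finset K}

theorem StepsIn.of_add {i j : ℕ} {a b c : Cfg Γ Λ σ} (h : StepsIn m (i + j) a c)
    (h' : StepsIn m i a b) : StepsIn m j b c := by
  unfold StepsIn at *
  rwa [add_comm, Function.iterate_add_apply, h'] at h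

theorem SpaceReach.trans {T T' S : ℕ} {a b c : Cfg Γ Λ σ} (h : SpaceReach m F T S a b)
    (h' : SpaceReach m F T' S b c) : SpaceReach m F (T + T') S a c := by
  obtain ⟨j, hj, h1, h2⟩ := h
  obtain ⟨j', hj', h1', h2'⟩ := h'
  refine ⟨j + j', by omega, h1.trans h1', fun i hi c'' hc => ?_⟩
  by_cases hij : i ≤ j
  · exact h2 i hij c'' hc
  · obtain ⟨i', rfl⟩ : ∃ i', i = j + i' := ⟨i - j, by omega⟩
    exact h2' i' (by omega) c'' (hc.of_add h1)

theorem SpaceReach.mono {T T' S S' : ℕ} {a b : Cfg Γ Λ σ} (h : SpaceReach m F T S a b)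
    (hT : T ≤ T') (hS : S ≤ S') : SpaceReach m F T' S' a b :=
  let ⟨j, hj, h1, h2⟩ := h
  ⟨j, hj.trans hT, h1, fun i hi c'' hc => (h2 i hi c'' hc).trans hS⟩

theorem StepsIn.sum_length_le {D : ℕ} (hD : ∀ l, (m l).depth ≤ D) {j : ℕ} {c c' : Cfg Γ Λ σ}
    (h : StepsIn m j c c') :
    ∑ k ∈ F, (c'.stk k).length ≤ ∑ k ∈ F, (c.stk k).length + D * j := by
  induction j generalizing c with
  | zero =>
    have : c = c' := by simpa [StepsIn] using h
    subst this
    simp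
  | succ j ih =>
    obtain ⟨b, h1, h2⟩ := StepsIn.succ_iff.1 h
    obtain ⟨_ | l, v, S⟩ := c
    · simp [step] at h1
    · simp only [step, Option.some.injEq] at h1
      have h3 := ih h2
      have h4 := sum_length_stepAux_le F (m l) v S
      rw [h1] at h4
      have h5 := hD l
      rw [Nat.mul_succ]
      dsimp only
      omega

/-- This is applied to each phase separately, the processing of one input bit being a phase. The
space is then governed by the longest phase and not by the total time. -/
theorem ReachIn.spaceReach {D : ℕ} (hD : ∀ l, (m l).depth ≤ D) {T : ℕ} {c c' : Cfg Γ Λ σ}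
    (h : ReachIn m T c c') : SpaceReach m F T (∑ k ∈ F, (c.stk k).length + D * T) c c' := by
  obtain ⟨j, hj, h1⟩ := h
  refine ⟨j, hj, h1, fun i hi c'' hc => (hc.sum_length_le hD).trans ?_⟩
  have := Nat.mul_le_mul_left D (hi.trans hj)
  omega

end Turing.TM2

/-! ### Runs of streaming algorithms that ignore their coins -/

namespace StreamingAlgorithm

variable (A : StreamingAlgorithm) {m : A.Λ → TM2.Stmt A.Γ A.Λ A.σ}

theorem run_eq_iterate (hm : ∀ b, A.program b = m) {n : ℕ} (z : Fin (n + n) → Bool) (r : List Bool) :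
    A.run z r = (fun c => (TM2.step m c).getD c)^[r.length] (A.start z) := by
  unfold run
  rw [← List.foldl_const]
  congr 1
  funext c b
  rw [step, hm]

/-- The runs of an algorithm that makes no use of its coins. -/
theorem run_of_spaceReach (hm : ∀ b, A.program b = m) {n : ℕ} {z : Fin (n + n) → Bool} {T S : ℕ}
    {cf : A.Cfg} (hcf : cf.l = none) (h : TM2.SpaceReach m (Finset.univ.erase A.stream) T S (A.start z) cf)
    (r : List Bool) : (T ≤ r.length → A.run z r = cf) ∧ A.space (A.run z r) ≤ S := by
  obtain ⟨j, hj, h1, h2⟩ := h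
  have hhalt : j ≤ r.length → A.run z r = cf := by
    intro hr
    obtain ⟨i, hi⟩ : ∃ i, r.length = i + j := ⟨r.length - j, by omega⟩
    rw [A.run_eq_iterate hm, hi, Function.iterate_add_apply, h1.iterate]
    apply Function.iterate_fixed
    obtain ⟨l, v, S⟩ := cf
    subst hcf
    rfl
  refine ⟨fun hr => hhalt (hj.trans hr), ?_⟩
  by_cases hr : j ≤ r.length
  · rw [hhalt hr]
    exact h2 j le_rfl _ h1
  · obtain ⟨i, hi⟩ : ∃ i, j = i + r.length := ⟨j - r.length, by omega⟩
    obtain ⟨c', hc'⟩ : ∃ c', TM2.StepsIn m r.length (A.start z) c' := by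
      unfold TM2.StepsIn at h1 ⊢
      rw [hi, Function.iterate_add_apply] at h1
      cases h : (flip Bind.bind (TM2.step m))^[r.length] (some (A.start z)) with
      | some c' => exact ⟨c', rfl⟩
      | none =>
        have h4 : (flip Bind.bind (TM2.step m))^[i] none = none := Function.iterate_fixed rfl i
        rw [h, h4] at h1
        cases h1
    rw [A.run_eq_iterate hm, hc'.iterate]
    exact h2 _ (by omega) _ hc'

end StreamingAlgorithm

/-! ### Streaming algorithms obtained from stack programs -/

namespace Com

theorem conts_seq_left (a b : Com) (κ : List Com) : conts a (b :: κ) ⊆ conts (seq a b) κ :=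
  fun _ h => Or.inr (Or.inl h)

theorem conts_seq_right (a b : Com) (κ : List Com) : conts b κ ⊆ conts (seq a b) κ :=
  fun _ h => Or.inr (Or.inr h)

/-- The streaming algorithm that executes a program, the input being the external stack. It makes no
use of its coins. -/
def streaming (tm : FinTM2) (ia : tm.Γ tm.k₀ ≃ Bool) (oa : tm.Γ tm.k₁ ≃ Bool) (c₀ : Com) (N : ℕ)
    (hfin : ∀ k, Finite (tm.Γ k)) : StreamingAlgorithm :=
  have := tm.kFin
  have := tm.ΛFin
  have := tm.σFin
  { K := Option (Fin (N + 1) ⊕ tm.K)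
    Γ := Alph tm N
    finΓ := fun k => match k with
      | none => inferInstanceAs (Fintype (Bool ⊕ Bool))
      | some (.inl _) => inferInstanceAs (Fintype Bool)
      | some (.inr k) => @Fintype.ofFinite (tm.Γ k) (hfin k)
    Λ := Lab tm c₀
    finΛ := Fintype.ofFinite _
    σ := Mem tm
    finσ := Fintype.ofFinite _
    stream := none
    param := stack tm N 0
    stream_ne_param := by simp
    streamSymbol := ⟨Sum.inl, Sum.inl_injective⟩
    paramSymbol := Function.Embedding.refl Bool
    main := lab tm c₀ [c₀]
    initialState := (none, tm.initialState)
    program := fun _ => prog tm ia oa c₀ N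
    noPush_stream := fun _ l => noPush_prog tm ia oa l
    answer := fun v => lastBit v.1 }

section

variable (tm : FinTM2) (ia : tm.Γ tm.k₀ ≃ Bool) (oa : tm.Γ tm.k₁ ≃ Bool) (c₀ : Com) (N : ℕ)
  (hfin : ∀ k, Finite (tm.Γ k))

theorem streaming_start {n : ℕ} (z : Fin (n + n) → Bool) (s : ℕ → List Bool) :
    (streaming tm ia oa c₀ N hfin).start z =
      cfg tm c₀ N [c₀] (none, tm.initialState) ((List.ofFn z).map .inl)
        (st s 0 [encodeNat n]) (fun _ => []) := by
  have h1 : st s 0 [encodeNat n] = Function.update (st s 0 [[]]) 0 (encodeNat n) :=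
    (st_update_zero (L := [[]]) _ (by simp)).symm
  have h2 : allStk tm N [] (st s 0 [[]]) (fun _ => []) = fun _ => [] := by
    funext k
    match k with
    | none => rfl
    | some (.inr k) => rfl
    | some (.inl ⟨0, _⟩) => rfl
    | some (.inl ⟨i + 1, _⟩) => rfl
  rw [cfg, h1, ← update_ext tm N (x := []), ← update_stack tm N (Nat.zero_le N), h2,
    ← List.map_id (encodeNat n)]
  rfl

theorem sum_length_st [Fintype tm.K] (x : List (Bool ⊕ Bool)) (s : ℕ → List Bool) (a : List Bool) :
    ∑ k ∈ Finset.univ.erase none, (allStk tm N x (st s 0 [a]) (fun _ => []) k).length =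
      a.length := by
  rw [Finset.sum_eq_single (stack tm N 0)]
  · rw [allStk_stack tm N (Nat.zero_le _)]
    rfl
  · intro k hk hk'
    match k, hk, hk' with
    | none, hk, _ => simp at hk
    | some (.inr k), _, _ => rfl
    | some (.inl i), _, hk' =>
      have : (i : ℕ) ≠ 0 := fun h => hk' (by
        simp only [stack, Option.some.injEq, Sum.inl.injEq]
        exact Fin.ext (by simpa using h))
      obtain ⟨j, hj⟩ : ∃ j, (i : ℕ) = 0 + (j + 1) := ⟨i - 1, by omega⟩
      change (st s 0 [a] i).length = 0
      rw [hj, st_apply]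
      rfl
  · intro h
    simp at h

end

/-- Reading an input bit. -/
def readBit (c : Com) (x : Bool ⊕ Bool) : Com :=
  (pushes (0 + 0) (true :: code (bit (x.elim id id)))).seq c

theorem runs_readBit {c : Com} {s : ℕ → List Bool} {b : Bool} {w w' : BTree} {T : ℕ}
    (h : Runs c (st s 0 [code (node (bit b) w)]) (st s 0 [code w']) T) :
    Runs (readBit c (.inl b)) (st s 0 [code w]) (st s 0 [code w']) (T + 10) := by
  have h1 : Runs (pushes (0 + 0) (true :: code (bit b))) (st s 0 [code w])
    (st s 0 [code (node (bit b) w)]) _ := Runs.pushes (L := [code w]) (j := 0) (by simp) _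
  refine (h1.seq h).mono ?_
  have : (true :: code (bit b)).length ≤ 4 := by cases b <;> decide
  omega

end Com

namespace Com

/-- Between two input bits the work stacks hold nothing but the code of the current state, of size
at most `P`. Hence the times add up over the bits while the space bound does not. Per bit, one step
reads, ten bound the pushing and `T` the update. -/
theorem spaceReach_ext (tm : FinTM2) (ia : tm.Γ tm.k₀ ≃ Bool) (oa : tm.Γ tm.k₁ ≃ Bool)
    [Fintype tm.K] {c₀ c : Com} {N D : ℕ} (hD : ∀ l, (prog tm ia oa c₀ N l).depth ≤ D)
    {κ : List Com} (hκ : conts (ext (readBit c)) κ ⊆ insert [] (conts c₀ []))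
    (hN : StkLE N (ext (readBit c))) (u : tm.σ) (s : ℕ → List Bool) (z : ℕ → Bool) (W : ℕ → BTree)
    {P T : ℕ} (m : ℕ) : ∀ (i : ℕ) (o : Option (Bool ⊕ Bool)), (∀ j ≤ i + m, size (W j) ≤ P) →
    (∀ j < i + m, Runs c (st s 0 [code (node (bit (z j)) (W j))]) (st s 0 [code (W (j + 1))]) T) →
    TM2.SpaceReach (prog tm ia oa c₀ N) (Finset.univ.erase none) (m * (T + 11) + 1)
      (P + D * (T + 11))
      (cfg tm c₀ N (ext (readBit c) :: κ) (o, u) ((List.range' i m).map fun j => .inl (z j))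
        (st s 0 [code (W i)]) fun _ => [])
      (cfg tm c₀ N κ (none, u) [] (st s 0 [code (W (i + m))]) fun _ => []) := by
  have hself := hκ (mem_conts_self _ _)
  have hwork : ∀ (κ : List Com) (v : Mem tm) (x : List (Bool ⊕ Bool)) (w : BTree),
      ∑ k ∈ Finset.univ.erase none,
        ((cfg tm c₀ N κ v x (st s 0 [code w]) fun _ => []).stk k).length = size w :=
    fun κ v x w => sum_length_st tm N x s (code w)
  induction m with
  | zero =>
    intro i o hP _
    refine (TM2.ReachIn.spaceReach hD (reachIn_ext_nil tm ia oa hself _ _ _)).mono (by omega) ?_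
    rw [hwork]
    have := hP i (by omega)
    nlinarith
  | succ m ih =>
    intro i o hP hT
    have h1 := reachIn_ext_cons tm ia oa (N := N) hself (o, u) (.inl (z i))
      ((List.range' (i + 1) m).map fun j => .inl (z j)) (st s 0 [code (W i)]) fun _ => []
    obtain ⟨o', h2⟩ := (runs_readBit (hT i (by omega))).reachIn tm ia oa (hN (.inl (z i)))
      (κ := ext (readBit c) :: κ) (fun y hy => hκ (Or.inr (Set.mem_iUnion.2 ⟨_, hy⟩))) hself
      (some (.inl (z i))) u ((List.range' (i + 1) m).map fun j => .inl (z j)) fun _ => []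
    have h3 := (TM2.ReachIn.spaceReach hD (h1.trans h2)
      (F := Finset.univ.erase none)).mono (T' := T + 11) (S' := P + D * (T + 11)) (by omega) (by
        rw [hwork]
        have := hP i (by omega)
        have : D * (1 + (T + 10)) = D * (T + 11) := by ring
        omega)
    have h4 := ih (i + 1) o' (fun j hj => hP j (by omega)) (fun j hj => hT j (by omega))
    have h5 := h3.trans h4
    rw [show i + 1 + m = i + (m + 1) by omega] at h5
    rw [List.range'_succ]
    exact h5.mono (by rw [Nat.succ_mul]; omega) le_rfl

end Com

/-- The costs of the phases of the streaming algorithm. -/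
theorem cost_le {d₁ d₂ d₃ k n x r y P Ts D : ℕ} (hr : 0 < r) (hy : y ≤ (k + 1) * r) :
    let Q := (x + r + P + 2) ^ (d₁ + d₂ + d₃ + 1)
    let C := (D + 1) * (5 * k + 4 ^ d₁ + 2 * 4 ^ d₂ + 4 ^ d₃ + 150)
    let pre := 32 * x + Ts + y + (4 * k + 30) * r + 30 + (4 * x + 2 * r + 5) ^ d₁
    let per := (P + 6) ^ d₂ + 11
    let post := (P + 2) ^ d₃ + 2
    pre + ((n + n) * per + 1) + post ≤ C * (Ts + (n + 1) * Q) ∧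
      x + D * pre ≤ C * (Ts + Q) ∧ P + D * per ≤ C * (Ts + Q) ∧ P + D * post ≤ C * (Ts + Q) := by
  intro Q C pre per post
  set X := x + r + P + 2 with hX
  have hQ : ∀ e ≤ d₁ + d₂ + d₃ + 1, X ^ e ≤ Q := fun e he => Nat.pow_le_pow_right (by omega) he
  have hXQ : X ≤ Q := by simpa using hQ 1 (by omega)
  have hpow : ∀ (a e : ℕ), a ≤ 4 * X → e ≤ d₁ + d₂ + d₃ + 1 → a ^ e ≤ 4 ^ e * Q := by
    intro a e ha he
    calc a ^ e ≤ (4 * X) ^ e := Nat.pow_le_pow_left ha e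
      _ = 4 ^ e * X ^ e := mul_pow _ _ _
      _ ≤ _ := Nat.mul_le_mul_left _ (hQ e he)
  have h1 := hpow (4 * x + 2 * r + 5) d₁ (by omega) (by omega)
  have h2 := hpow (P + 6) d₂ (by omega) (by omega)
  have h3 := hpow (P + 2) d₃ (by omega) (by omega)
  have p₁ : 0 < 4 ^ d₁ := by positivity
  have p₂ : 0 < 4 ^ d₂ := by positivity
  have p₃ : 0 < 4 ^ d₃ := by positivity
  have hkr : k * r ≤ k * Q := Nat.mul_le_mul_left _ (by omega)
  have hpre : pre ≤ Ts + (5 * k + 4 ^ d₁ + 100) * Q := by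
    have e1 : (5 * k + 4 ^ d₁ + 100) * Q = 5 * (k * Q) + 4 ^ d₁ * Q + 100 * Q := by ring
    have e2 : (4 * k + 30) * r = 4 * (k * r) + 30 * r := by ring
    have e3 : (k + 1) * r = k * r + r := by ring
    dsimp only [pre]
    omega
  have hper : per ≤ (4 ^ d₂ + 11) * Q := by
    have e1 : (4 ^ d₂ + 11) * Q = 4 ^ d₂ * Q + 11 * Q := by ring
    dsimp only [per]
    omega
  have hpost : post ≤ (4 ^ d₃ + 2) * Q := by
    have e1 : (4 ^ d₃ + 2) * Q = 4 ^ d₃ * Q + 2 * Q := by ring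
    dsimp only [post]
    omega
  set E := 5 * k + 4 ^ d₁ + 2 * 4 ^ d₂ + 4 ^ d₃ + 150 with hE
  have hEpos : 1 ≤ E := by omega
  have key : ∀ a b : ℕ, a ≤ Q → b ≤ Ts + (E - 1) * Q → a + D * b ≤ C * (Ts + Q) := by
    intro a b ha hb
    have e1 : (E - 1) * Q + Q = E * Q := by
      rw [← Nat.succ_mul, Nat.succ_eq_add_one, Nat.sub_add_cancel hEpos]
    have e2 : a + b ≤ E * (Ts + Q) := by
      have : Ts ≤ E * Ts := Nat.le_mul_of_pos_left _ hEpos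
      rw [Nat.mul_add]
      omega
    calc a + D * b ≤ (D + 1) * (a + b) := by nlinarith [Nat.zero_le (D * a)]
      _ ≤ (D + 1) * (E * (Ts + Q)) := Nat.mul_le_mul_left _ e2
      _ = _ := by rw [← Nat.mul_assoc]
  have hE1 : ∀ a, a ≤ E - 1 → a * Q ≤ (E - 1) * Q := fun a ha => Nat.mul_le_mul_right _ ha
  refine ⟨?_, key _ _ (by omega) (hpre.trans ?_), key _ _ (by omega) (hper.trans ?_),
    key _ _ (by omega) (hpost.trans ?_)⟩
  · have e1 : (n + n) * per ≤ (n + 1) * ((2 * 4 ^ d₂ + 22) * Q) := by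
      calc (n + n) * per ≤ (n + n) * ((4 ^ d₂ + 11) * Q) := Nat.mul_le_mul_left _ hper
        _ = n * ((2 * 4 ^ d₂ + 22) * Q) := by ring
        _ ≤ _ := Nat.mul_le_mul_right _ (by omega)
    have e2 : pre + ((n + n) * per + 1) + post ≤ E * (Ts + (n + 1) * Q) := by
      have e3 : ∀ a : ℕ, a * Q ≤ (n + 1) * (a * Q) := fun a => Nat.le_mul_of_pos_left _ (by omega)
      have e4 := e3 (5 * k + 4 ^ d₁ + 100)
      have e5 := e3 (4 ^ d₃ + 2)
      have e6 := e3 1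
      have e7 : Ts ≤ E * Ts := Nat.le_mul_of_pos_left _ hEpos
      have e8 : E * (Ts + (n + 1) * Q) = E * Ts + ((n + 1) * ((5 * k + 4 ^ d₁ + 100) * Q) +
          (n + 1) * ((2 * 4 ^ d₂ + 22) * Q) + (n + 1) * ((4 ^ d₃ + 2) * Q) +
            26 * ((n + 1) * (1 * Q))) := by rw [hE]; ring
      omega
    calc _ ≤ E * (Ts + (n + 1) * Q) := e2
      _ ≤ (D + 1) * (E * (Ts + (n + 1) * Q)) := Nat.le_mul_of_pos_left _ (by omega)
      _ = _ := by rw [← Nat.mul_assoc]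
  · have := hE1 (5 * k + 4 ^ d₁ + 100) (by omega)
    omega
  · have := hE1 (4 ^ d₂ + 11) (by omega)
    omega
  · have := hE1 (4 ^ d₃ + 2) (by omega)
    omega

open Com in
/-- Streaming algorithms from functions in `FP`: the state is initialized from the parameter `n`
and a unary number of the order of the `(k + 1)`-st root of a number computed from `n`, and it
is updated with every input bit. -/
theorem exists_streamingAlgorithm {ini next fin : BTree → BTree} (hi : FP ini) (hn : FP next)
    (hf : FP fin) : ∃ d, ∀ (M : TM2ComputableAux Bool Bool) (k : ℕ), ∃ (A : StreamingAlgorithm)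
    (C : ℕ), ∀ (n Ts P : ℕ) (ys : List Bool) (z : ℕ → Bool) (W : ℕ → BTree),
    M.Outputs (encodeNat n) ys Ts →
    W 0 = ini (node (ofBits (encodeNat n)) (num (2 ^ ((ys.length + k) / (k + 1))))) →
    (∀ i, W (i + 1) = next (node (bit (z i)) (W i))) → (∀ i ≤ n + n, size (W i) ≤ P) →
    ∃ cf : A.Cfg, cf.l = none ∧ A.answer cf.var = isNode (fin (W (n + n))) ∧
      ∀ r, (C * (Ts + (n + 1) * ((encodeNat n).length + 2 ^ ((ys.length + k) / (k + 1)) + P + 2) ^ d)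
          ≤ r.length → A.run (fun i : Fin (n + n) => z i) r = cf) ∧
        A.space (A.run (fun i : Fin (n + n) => z i) r) ≤
          C * (Ts + ((encodeNat n).length + 2 ^ ((ys.length + k) / (k + 1)) + P + 2) ^ d) := by
  obtain ⟨ci, d₁, hci⟩ := hi
  obtain ⟨cn, d₂, hcn⟩ := hn
  obtain ⟨cf, d₃, hcf⟩ := hf
  -- The exponent is fixed before `M` and `k`, which enter only the constant. The later choice of
  -- `k` in terms of this exponent depends on this order.
  refine ⟨d₁ + d₂ + d₃ + 1, fun M k => ?_⟩
  obtain ⟨⟨tm, ia, oa⟩, hfin, hM'⟩ := M.exists_finite_alphabets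
  change tm.Γ tm.k₀ ≃ Bool at ia
  change tm.Γ tm.k₁ ≃ Bool at oa
  set c₄ : Com := (ext (readBit (cn 0))).seq (cf 0) with hc₄
  set c₃ : Com := (ci 0).seq c₄ with hc₃
  set c₂ : Com := (buildPair k).seq c₃ with hc₂
  set c₁ : Com := Com.run.seq c₂ with hc₁
  set c₀ : Com := copyParam.seq c₁ with hc₀
  obtain ⟨N, hN⟩ := exists_stkLE c₀
  have hN₁ : StkLE N c₁ := hN.2
  have hN₂ : StkLE N c₂ := hN₁.2
  have hN₃ : StkLE N c₃ := hN₂.2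
  have hN₄ : StkLE N c₄ := hN₃.2
  have s₀ : conts c₀ [] ⊆ insert [] (conts c₀ []) := Set.subset_insert _ _
  have s₁ : conts c₁ [] ⊆ insert [] (conts c₀ []) := (conts_seq_right _ _ _).trans s₀
  have s₂ : conts c₂ [] ⊆ insert [] (conts c₀ []) := (conts_seq_right _ _ _).trans s₁
  have s₃ : conts c₃ [] ⊆ insert [] (conts c₀ []) := (conts_seq_right _ _ _).trans s₂
  have s₄ : conts c₄ [] ⊆ insert [] (conts c₀ []) := (conts_seq_right _ _ _).trans s₃
  let := tm.kFin
  have := tm.ΛFin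
  obtain ⟨D, hD⟩ : ∃ D, ∀ l, (prog tm ia oa c₀ N l).depth ≤ D := by
    have : Fintype (Lab tm c₀) := Fintype.ofFinite _
    exact ⟨Finset.univ.sup fun l => (prog tm ia oa c₀ N l).depth,
      fun l => Finset.le_sup (f := fun l => (prog tm ia oa c₀ N l).depth) (Finset.mem_univ l)⟩
  refine ⟨streaming tm ia oa c₀ N hfin,
    (D + 1) * (5 * k + 4 ^ d₁ + 2 * 4 ^ d₂ + 4 ^ d₃ + 150), ?_⟩
  intro n Ts P ys z W hM hW0 hW hP
  have hM := hM' _ _ _ hM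
  set x := encodeNat n with hx
  set r := 2 ^ ((ys.length + k) / (k + 1)) with hr
  have hr0 : 0 < r := by positivity
  -- The output of the called machine is only logarithmically long compared with powers of `r`; this
  -- crude linear bound charges its copying to `r`.
  have hy : ys.length ≤ (k + 1) * r := by
    have h1 : ys.length < (k + 1) * ((ys.length + k) / (k + 1) + 1) := by
      have := Nat.lt_mul_div_succ (ys.length + k) (b := k + 1) (by omega)
      omega
    have h2 : (ys.length + k) / (k + 1) + 1 ≤ r := Nat.lt_two_pow_self
    exact h1.le.trans (Nat.mul_le_mul_left _ h2)
  obtain ⟨q₁, q₂, q₃, q₄⟩ := cost_le (d₁ := d₁) (d₂ := d₂) (d₃ := d₃) (k := k) (n := n)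
    (x := x.length) (y := ys.length) (P := P) (Ts := Ts) (D := D) hr0 hy
  let s : ℕ → List Bool := fun _ => []
  let u := tm.initialState
  let inp : List (Bool ⊕ Bool) := (List.range' 0 (n + n)).map fun j => .inl (z j)
  have hinp : (List.ofFn fun i : Fin (n + n) => z i).map Sum.inl = inp := by
    refine List.ext_getElem (by simp [inp]) fun i h1 h2 => ?_
    simp [inp]
  have hpre : ∃ o, TM2.ReachIn (prog tm ia oa c₀ N)
      (32 * x.length + Ts + ys.length + (4 * k + 30) * r + 30 + (4 * x.length + 2 * r + 5) ^ d₁)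
      (cfg tm c₀ N [c₀] (none, u) inp (st s 0 [x]) fun _ => [])
      (cfg tm c₀ N [ext (readBit (cn 0)), cf 0] (o, u) inp (st s 0 [code (W 0)]) fun _ => []) := by
    have h1 := reachIn_seq tm ia oa (N := N) (s₀ (mem_conts_self _ _)) (none, u) inp
      (st s 0 [x]) fun _ => []
    have e1 := runs_copyParam s x [] []
    rw [← st_pad2, ← st_pad1, List.append_nil, List.append_nil] at e1
    obtain ⟨o₁, h2⟩ := e1.reachIn tm ia oa (N := N) hN.1 (κ := [c₁])
      ((conts_seq_left _ _ _).trans s₀) (s₁ (mem_conts_self _ _)) none u inp fun _ => []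
    have h3 := reachIn_seq tm ia oa (N := N) (s₁ (mem_conts_self _ _)) (o₁, u) inp
      (st s 0 [[], x.reverse, (bitsCode x).reverse]) fun _ => []
    have h4 := reachIn_run tm ia oa (N := N) (κ := [c₂])
      (s₁ (conts_seq_left _ _ _ (mem_conts_self _ _))) hN₁.1 hM o₁ inp
      (st s 0 [[], x.reverse, (bitsCode x).reverse]) rfl
    have e2 : Function.update (st s 0 [[], x.reverse, (bitsCode x).reverse]) 1 ys.reverse =
        st s 0 [[], ys.reverse, (bitsCode x).reverse, [], []] := by
      refine Eq.trans ?_ (st_append_nil s 0 [[], ys.reverse, (bitsCode x).reverse, []]).symm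
      refine Eq.trans ?_ (st_pad3 s 0 [] ys.reverse (bitsCode x).reverse)
      exact st_update (i := 0) (j := 1) (L := [[], x.reverse, (bitsCode x).reverse]) _ (by simp)
    rw [e2] at h4
    have h5 := reachIn_seq tm ia oa (N := N) (s₂ (mem_conts_self _ _)) (none, u) inp
      (st s 0 [[], ys.reverse, (bitsCode x).reverse, [], []]) fun _ => []
    have e3 := runs_buildPair s ys.reverse x k
    rw [List.length_reverse, ← hr] at e3
    obtain ⟨o₂, h6⟩ := e3.reachIn tm ia oa (N := N) hN₂.1 (κ := [c₃])
      ((conts_seq_left _ _ _).trans s₂) (s₃ (mem_conts_self _ _)) none u inp fun _ => []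
    have h7 := reachIn_seq tm ia oa (N := N) (s₃ (mem_conts_self _ _)) (o₂, u) inp
      (st s 0 [code (node (ofBits x) (num r))]) fun _ => []
    have e4 := hci 0 s (node (ofBits x) (num r))
    rw [← hW0] at e4
    obtain ⟨o₃, h8⟩ := e4.reachIn tm ia oa (N := N) hN₃.1 (κ := [c₄])
      ((conts_seq_left _ _ _).trans s₃) (s₄ (mem_conts_self _ _)) o₂ u inp fun _ => []
    have h9 := reachIn_seq tm ia oa (N := N) (s₄ (mem_conts_self _ _)) (o₃, u) inp
      (st s 0 [code (W 0)]) fun _ => []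
    refine ⟨o₃, (h1.trans <| h2.trans <| h3.trans <| h4.trans <| h5.trans <| h6.trans <|
      h7.trans <| h8.trans h9).mono ?_⟩
    have e5 : (size (node (ofBits x) (num r)) + 2) ^ d₁ ≤ (4 * x.length + 2 * r + 5) ^ d₁ := by
      refine Nat.pow_le_pow_left ?_ _
      have := size_ofBits x
      rw [size_node, size_num]
      omega
    omega
  obtain ⟨o, hpre⟩ := hpre
  have hext := spaceReach_ext tm ia oa hD (c := cn 0) (κ := [cf 0])
    ((conts_seq_left _ _ _).trans s₄) hN₄.1 u s z W (P := P) (T := (P + 6) ^ d₂) (n + n) 0 o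
    (fun j hj => hP j (by omega)) (fun j hj => by
      rw [hW]
      refine (hcn 0 s _).mono (Nat.pow_le_pow_left ?_ _)
      have := hP j (by omega)
      have : size (bit (z j)) ≤ 3 := by cases z j <;> decide
      rw [size_node]
      omega)
  rw [zero_add] at hext
  obtain ⟨o', h1⟩ := (hcf 0 s (W (n + n))).reachIn tm ia oa (N := N) hN₄.2 (κ := [])
    ((conts_seq_right _ _ _).trans s₄) (Set.mem_insert _ _) none u [] fun _ => []
  have h2 := reachIn_halt tm ia oa (c₀ := c₀) (N := N) (o', u) []
    (st s 0 [code (fin (W (n + n)))]) fun _ => []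
  have hpost := (h1.trans h2).mono (U := (P + 2) ^ d₃ + 2) (by
    have := Nat.pow_le_pow_left (Nat.add_le_add_right (hP (n + n) le_rfl) 2) d₃
    omega)
  have hw1 : ∑ j ∈ Finset.univ.erase none,
      ((cfg tm c₀ N [c₀] (none, u) inp (st s 0 [x]) fun _ => []).stk j).length = x.length :=
    sum_length_st tm N inp s x
  have hw2 : ∑ j ∈ Finset.univ.erase none, ((cfg tm c₀ N [cf 0] (none, u) []
      (st s 0 [code (W (n + n))]) fun _ => []).stk j).length ≤ P :=
    (sum_length_st tm N [] s (code (W (n + n)))).trans_le (hP _ le_rfl)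
  have h3 := (hpre.spaceReach hD (F := Finset.univ.erase none)).mono le_rfl
    (S' := (D + 1) * (5 * k + 4 ^ d₁ + 2 * 4 ^ d₂ + 4 ^ d₃ + 150) *
      (Ts + (x.length + r + P + 2) ^ (d₁ + d₂ + d₃ + 1))) (by rw [hw1]; exact q₂)
  have h4 := hext.mono le_rfl q₃
  have h5 := (hpost.spaceReach hD (F := Finset.univ.erase none)).mono le_rfl
    (S' := (D + 1) * (5 * k + 4 ^ d₁ + 2 * 4 ^ d₂ + 4 ^ d₃ + 150) *
      (Ts + (x.length + r + P + 2) ^ (d₁ + d₂ + d₃ + 1))) (by omega)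
  have h6 := ((h3.trans h4).trans h5).mono q₁ le_rfl
  rw [← hinp, hx, ← streaming_start tm ia oa c₀ N hfin (fun i : Fin (n + n) => z i) s] at h6
  refine ⟨_, rfl, ?_, fun r => (streaming tm ia oa c₀ N hfin).run_of_spaceReach
    (m := prog tm ia oa c₀ N) (fun _ => rfl) (by exact rfl) h6 r⟩
  change lastBit ((code (fin (W (n + n)))).head?.map Sum.inl) = _
  rw [head?_code]
  rfl

/-! ### Growth rates -/

theorem tendsto_logb_natCast : Tendsto (fun n : ℕ => Real.logb 2 n) atTop atTop :=
  (Real.tendsto_logb_atTop (by norm_num)).comp tendsto_natCast_atTop_atTop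

theorem length_encodeNat_le_logb {n : ℕ} (hn : 0 < n) :
    ((encodeNat n).length : ℝ) ≤ Real.logb 2 n + 2 := by
  have h1 : (2 : ℝ) ^ (encodeNat n).length ≤ n * 2 ^ 2 := by
    have := two_pow_length_encodeNat_le n
    have h2 : 2 ^ (encodeNat n).length ≤ n * 2 ^ 2 := by omega
    exact_mod_cast h2
  have hn' : (0 : ℝ) < n := by exact_mod_cast hn
  have h2 := Real.logb_le_logb_of_le (b := 2) (by norm_num) (by positivity) h1
  rw [Real.logb_mul hn'.ne' (by norm_num), Real.logb_pow, Real.logb_pow,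
    Real.logb_self_eq_one (by norm_num)] at h2
  norm_num at h2
  linarith

/-- Eventually `f n ≥ m + 1`. Of the `m + 1` factors `log n`, one absorbs the constant `a * 5 ^ m`;
the 5 comes from `log n + 4 ≤ 5 * log n`. -/
theorem eventually_pow_le_logPow {f : ℕ → ℝ} (hf : Tendsto f atTop atTop) (a m : ℕ) :
    ∀ᶠ n in atTop, (a : ℝ) * ((encodeNat n).length + 2 : ℝ) ^ m ≤ logPow f n := by
  filter_upwards [tendsto_logb_natCast.eventually_ge_atTop (max 1 (a * 5 ^ m)),
    hf.eventually_ge_atTop ((m + 1 : ℕ) : ℝ), eventually_gt_atTop 0] with n h1 h2 h3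
  have hl1 : 1 ≤ Real.logb 2 n := (le_max_left _ _).trans h1
  have hl2 : (a : ℝ) * 5 ^ m ≤ Real.logb 2 n := (le_max_right _ _).trans h1
  have h4 := length_encodeNat_le_logb h3
  set ℓ := Real.logb 2 n
  calc (a : ℝ) * ((encodeNat n).length + 2 : ℝ) ^ m ≤ a * (5 * ℓ) ^ m := by
        gcongr
        linarith
    _ = a * 5 ^ m * ℓ ^ m := by rw [mul_pow]; ring
    _ ≤ ℓ * ℓ ^ m := by gcongr
    _ = ℓ ^ ((m + 1 : ℕ) : ℝ) := by rw [Real.rpow_natCast]; ring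
    _ ≤ ℓ ^ f n := Real.rpow_le_rpow_of_exponent_le hl1 h2

/-- The power of `2` with exponent the number of bits of `s`, divided by `k + 1` and rounded up. -/
def binRoot (k s : ℕ) : ℕ := 2 ^ (((encodeNat s).length + k) / (k + 1))

theorem binRoot_pos (k s : ℕ) : 0 < binRoot k s := by unfold binRoot; positivity

/-- Rounding up the exponent costs at most `k` bits. Together with `lt_binRoot_pow` this determines
the `(k + 1)`-st power up to a constant factor. -/
theorem binRoot_pow_le (k s : ℕ) : binRoot k s ^ (k + 1) ≤ 2 ^ k * (2 * s + 1) := by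
  rw [binRoot, ← pow_mul]
  calc 2 ^ (((encodeNat s).length + k) / (k + 1) * (k + 1)) ≤ 2 ^ ((encodeNat s).length + k) :=
        Nat.pow_le_pow_right (by omega) (Nat.div_mul_le_self _ _)
    _ = 2 ^ k * 2 ^ (encodeNat s).length := by rw [pow_add, mul_comm]
    _ ≤ _ := Nat.mul_le_mul_left _ (two_pow_length_encodeNat_le s)

theorem lt_binRoot_pow (k s : ℕ) : s < binRoot k s ^ (k + 1) := by
  rw [binRoot, ← pow_mul]
  refine (lt_two_pow_length_encodeNat s).trans_le (Nat.pow_le_pow_right (by omega) ?_)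
  have := Nat.lt_mul_div_succ ((encodeNat s).length + k) (b := k + 1) (by omega)
  rw [Nat.mul_succ, Nat.mul_comm] at this
  omega

/-- After raising to the power `k + 1` the left side is still a fixed power of `log n`, while the
right side exceeds `s n`, which is of order `(log n)^{f(n)}`. Taking a fixed root thus does not
prevent the number from outgrowing every polylogarithm. -/
theorem eventually_le_binRoot {f : ℕ → ℝ} (hf : Tendsto f atTop atTop) {s : ℕ → ℕ}
    (hs : (fun n => (s n : ℝ)) =Θ[atTop] logPow f) (k c : ℕ) :
    ∀ᶠ n in atTop, c * ((encodeNat n).length + 2) ^ c ≤ binRoot k (s n) := by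
  obtain ⟨K, hK⟩ := hs.2.bound
  obtain ⟨K', hK'⟩ := exists_nat_ge K
  filter_upwards [hK, eventually_pow_le_logPow hf (K' * c ^ (k + 1) + 1) (c * (k + 1))] with n h1 h2
  refine (Nat.pow_le_pow_iff_left (n := k + 1) (by omega)).1 (le_trans ?_ (lt_binRoot_pow k _).le)
  rw [mul_pow, ← pow_mul]
  set X : ℝ := ((encodeNat n).length + 2 : ℝ) ^ (c * (k + 1)) with hX
  have hX0 : 0 < X := by positivity
  have h3 : logPow f n ≤ K' * s n := by
    refine (le_abs_self _).trans (h1.trans ?_)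
    rw [Real.norm_natCast]
    gcongr
  have hK0 : 0 < K' := by
    rcases Nat.eq_zero_or_pos K' with h | h
    · exfalso
      rw [h] at h2 h3
      push_cast at h2 h3
      nlinarith
    · exact h
  have h4 : (K' : ℝ) * (c ^ (k + 1) * X) ≤ K' * s n := by
    push_cast at h2
    nlinarith
  have h5 : (c : ℝ) ^ (k + 1) * X ≤ s n := le_of_mul_le_mul_left h4 (by exact_mod_cast hK0)
  rw [hX] at h5
  exact_mod_cast h5

/-- As `x ≤ r`, the whole cost is polynomial in `r`, of degree `(e + 1) * d`. With `k` equal to this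
degree it is at most a constant times `r ^ (k + 1)`, hence of the order of the number whose root `r`
is. -/
theorem cost_le_binRoot_pow {x r e d : ℕ} {p : ℕ → ℕ} (hp : ∀ m, p m ≤ (m + 2) ^ e) (hr : 0 < r)
    (hx : x ≤ r) :
    (x + r + p (x + (2 * r + 1)) + 2) ^ d ≤ 10 ^ ((e + 1) * d) * r ^ ((e + 1) * d + 1) := by
  have h1 : p (x + (2 * r + 1)) ≤ (6 * r) ^ e :=
    (hp _).trans (Nat.pow_le_pow_left (by omega) e)
  have h2 : (6 * r) ^ e ≤ (10 * r) ^ e := Nat.pow_le_pow_left (by omega) e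
  have h3 : 1 ≤ (10 * r) ^ e := Nat.one_le_pow _ _ (by omega)
  have h4 : x + r + p (x + (2 * r + 1)) + 2 ≤ (10 * r) ^ (e + 1) := by
    rw [pow_succ]
    have : r ≤ (10 * r) ^ e * r := Nat.le_mul_of_pos_left _ h3
    have : (10 * r) ^ e ≤ (10 * r) ^ e * r := Nat.le_mul_of_pos_right _ hr
    have : (10 * r) ^ e * (10 * r) = 10 * ((10 * r) ^ e * r) := by ring
    omega
  calc _ ≤ ((10 * r) ^ (e + 1)) ^ d := Nat.pow_le_pow_left h4 d
    _ = 10 ^ ((e + 1) * d) * r ^ ((e + 1) * d) := by rw [← pow_mul, mul_pow]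
    _ ≤ _ := Nat.mul_le_mul_left _ (Nat.pow_le_pow_right hr (by omega))

/-! ### Deterministic answers -/

namespace StreamingAlgorithm

variable (A : StreamingAlgorithm) {n : ℕ} {z : Fin (n + n) → Bool} {cf : A.Cfg} {T : ℕ}

theorem outputs_answer (hl : cf.l = none) (h : ∀ r : List Bool, T ≤ r.length → A.run z r = cf) :
    A.Outputs z (A.answer cf.var) := by
  have h1 : ∀ r : Fin T → Bool, A.run z (List.ofFn r) = cf := fun r => h _ (by simp)
  refine ⟨T, fun r => by rw [h1, hl], ?_⟩
  simp only [h1, Finset.filter_true, Finset.card_univ, Fintype.card_fun, Fintype.card_bool,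
    Fintype.card_fin, Nat.cast_pow, Nat.cast_ofNat]
  rw [div_self (by positivity)]
  norm_num

/-- The time in `Outputs` is unrelated to `T`, but a halted run does not change when more coins are
appended. So all runs end in the same configuration, and any other answer has probability 0. -/
theorem eq_answer_of_outputs (h : ∀ r : List Bool, T ≤ r.length → A.run z r = cf) {b : Bool}
    (hb : A.Outputs z b) : b = A.answer cf.var := by
  obtain ⟨t, hl, hp⟩ := hb
  have hstay : ∀ (r : List Bool) (c : A.Cfg), c.l = none → r.foldl A.step c = c := by
    intro r c hc
    induction r with
    | nil => rfl
    | cons b r ih =>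
      have : A.step c b = c := by
        obtain ⟨l, v, S⟩ := c
        subst hc
        rfl
      rw [List.foldl_cons, this, ih]
  have h1 : ∀ r : Fin t → Bool, A.run z (List.ofFn r) = cf := by
    intro r
    rw [← h (List.ofFn r ++ List.replicate T false) (by simp)]
    conv_rhs => rw [run, List.foldl_append]
    exact (hstay _ _ (hl r)).symm
  by_contra hne
  have hne' : A.answer cf.var ≠ b := fun h => hne h.symm
  simp only [h1, hne', if_false, Finset.filter_const, Finset.card_empty, Nat.cast_zero,
    zero_div] at hp
  norm_num at hp

end StreamingAlgorithm

theorem DISJ_eq_true_iff {n : ℕ} (z : ℕ → Bool) : DISJ (fun i : Fin (n + n) => z i) = true ↔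
    ∃ j < n, z j = true ∧ z (n + j) = true := by
  unfold DISJ
  rw [decide_eq_true_iff, Ne, Finset.sum_eq_zero_iff]
  simp only [Finset.mem_univ, forall_const, not_forall, Fin.val_castAdd, Fin.val_natAdd]
  constructor
  · rintro ⟨⟨j, hj⟩, h⟩
    refine ⟨j, hj, ?_⟩
    cases h1 : z j <;> cases h2 : z (n + j) <;> simp_all
  · rintro ⟨j, hj, h1, h2⟩
    exact ⟨⟨j, hj⟩, by simp [h1, h2]⟩

/-! ### The main theorem -/

/-- If `P = NP`, then some streaming algorithm is correct on the outputs of all uniform `AC⁰`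
circuits. -/
theorem exists_correct_streamingAlgorithm (hPNP : ClassP = ClassNP) {f : ℕ → ℝ}
    (hf : Tendsto f atTop atTop) (hconstr : TimeConstructible f) :
    ∃ A ∈ StreamingClass f, ∀ C : ∀ n, Circuit n (n + n), PolylogtimeUniformAC0 C → ¬ Refutes C A := by
  obtain ⟨s, T, M, hs, hT, hM⟩ := hconstr
  obtain ⟨d, hd⟩ := exists_streamingAlgorithm FP.initState FP.nextState FP.finState
  obtain ⟨p, ⟨e, hp⟩, -, hps⟩ := size_stateSeq_le
  -- Both exponents are already known here: `d` of the running time in the size of the states, and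
  -- `e` of that size in `log n + r`.
  set k := (e + 1) * d with hk
  obtain ⟨A, C, hA⟩ := hd M k
  set r : ℕ → ℕ := fun n => binRoot k (s n) with hr
  set Q : ℕ → ℕ := fun n => ((encodeNat n).length + r n +
    p ((encodeNat n).length + (2 * r n + 1)) + 2) ^ d with hQ
  have hrun : ∀ (n : ℕ) (z : ℕ → Bool), ∃ cf : A.Cfg, cf.l = none ∧ A.answer cf.var =
      isNode (finState (stateSeq (ofBits (encodeNat n)) (num (r n)) z (n + n))) ∧
      ∀ w, (C * (T n + (n + 1) * Q n) ≤ w.length → A.run (fun i : Fin (n + n) => z i) w = cf) ∧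
        A.space (A.run (fun i : Fin (n + n) => z i) w) ≤ C * (T n + Q n) := by
    intro n z
    refine hA n (T n) (p ((encodeNat n).length + (2 * r n + 1))) (encodeNat (s n)) z
      (stateSeq (ofBits (encodeNat n)) (num (r n)) z) ((M.outputs_iff _ _ _).2 (hM n)) rfl
      (fun _ => rfl) fun i hi => ?_
    have := hps n (num (r n)) z i hi
    rwa [size_num] at this
  have hext : ∀ (n : ℕ) (z : Fin (n + n) → Bool), ∃ z' : ℕ → Bool,
      (fun i : Fin (n + n) => z' i) = z := fun n z =>
    ⟨fun i => if h : i < n + n then z ⟨i, h⟩ else false, by funext i; simp⟩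
  have hQO : (fun n => (Q n : ℝ)) =O[atTop] logPow f := by
    have h1 : (fun n => (Q n : ℝ)) =O[atTop] fun n => (2 * s n + 1 : ℝ) := by
      refine IsBigO.of_bound (10 ^ k * 2 ^ k) ?_
      -- The case of exponent 1 says that `r n` eventually dominates the length of `n`.
      filter_upwards [eventually_le_binRoot hf hs k 1] with n hn
      have h2 := cost_le_binRoot_pow (x := (encodeNat n).length) (d := d) hp
        (binRoot_pos k (s n)) (by rw [pow_one] at hn; omega)
      have h3 := Nat.mul_le_mul_left (10 ^ k) (binRoot_pow_le k (s n))
      have h4 : Q n ≤ 10 ^ k * 2 ^ k * (2 * s n + 1) := by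
        rw [Nat.mul_assoc]
        exact h2.trans h3
      rw [Real.norm_natCast, Real.norm_of_nonneg (by positivity)]
      exact_mod_cast h4
    refine h1.trans (IsBigO.add (hs.1.const_mul_left 2) ?_)
    refine IsBigO.of_bound 1 ?_
    filter_upwards [eventually_pow_le_logPow hf 1 0] with n hn
    rw [pow_zero, mul_one, Nat.cast_one] at hn
    rw [norm_one, one_mul, Real.norm_of_nonneg (by linarith)]
    exact hn
  refine ⟨A, ⟨fun n z => ?_, fun n => C * (T n + (n + 1) * Q n), fun n => C * (T n + Q n),
    fun n z w => ?_, ?_, ?_⟩, fun Ci hCi href => ?_⟩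
  · obtain ⟨z, rfl⟩ := hext n z
    obtain ⟨cf, hl, -, h⟩ := hrun n z
    exact ⟨_, A.outputs_answer hl fun w => (h w).1⟩
  · obtain ⟨z, rfl⟩ := hext n z
    obtain ⟨cf, hl, -, h⟩ := hrun n z
    exact ⟨fun hw => by rw [(h w).1 hw.ge, hl], (h w).2⟩
  · have h1 : (fun n => ((T n + (n + 1) * Q n : ℕ) : ℝ)) =O[atTop]
        fun n => (n : ℝ) * logPow f n := by
      push_cast
      have hone : (fun _ : ℕ => (1 : ℝ)) =O[atTop] fun n : ℕ => (n : ℝ) := by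
        refine IsBigO.of_bound 1 ?_
        filter_upwards [eventually_ge_atTop 1] with n hn
        have : (1 : ℝ) ≤ n := by exact_mod_cast hn
        simpa using this
      refine IsBigO.add ?_ (((isBigO_refl _ _).add hone).mul hQO)
      simpa using hone.mul hT
    simpa using h1.const_mul_left (C : ℝ)
  · simpa using (hT.add hQO).const_mul_left (C : ℝ)
  · obtain ⟨B, hB, hBe⟩ := exists_FP_eval hPNP hCi
    obtain ⟨c, hc⟩ := finState_stateSeq hB
    -- `Refutes` asserts errors for infinitely many `n`, so it is contradicted by correctness for
    -- all large `n`.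
    refine href ?_
    filter_upwards [eventually_le_binRoot hf hs k c, eventually_gt_atTop 0] with n hn h0 hout
    obtain ⟨z, hz⟩ := hext n ((Ci n).eval fun _ => true)
    have h1 := hc n (num (r n)) z h0 (fun j hj => by
      rw [hBe n ⟨j, hj⟩, ← hz]) (by
        rw [size_num]
        change _ ≤ r n at hn
        omega)
    rw [← hz] at hout
    obtain ⟨cf, hl, hans, h⟩ := hrun n z
    have h2 := A.eq_answer_of_outputs (fun w => (h w).1) hout
    rw [hans] at h2
    rw [← DISJ_eq_true_iff, ← Bool.eq_iff_iff] at h1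
    rw [h1] at h2
    simp at h2

end

theorem theorem3 (f : ℕ → ℝ) (hf : Filter.Tendsto f Filter.atTop Filter.atTop)
    (hconstr : TimeConstructible f) (hsep : ConstructiveSeparation f) :
    ClassP ≠ ClassNP := by
  intro hPNP
  obtain ⟨A, hA, h⟩ := exists_correct_streamingAlgorithm hPNP hf hconstr
  obtain ⟨C, hC, hR⟩ := hsep A hA
  exact h C hC hR
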